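/- \textbf{Setting.} For $k\ge 2$, a $k$-OV instance consists of $k$ sets $W_0,\dots,W_{k-1}\subseteq\{0,1\}^d$ of $n$ vectors each ($n,d\ge 1$). A solution is a choice of $a_i\in W_i$ with $\sum_{x=1}^d\prod_{i=0}^{k-1}a_i[x]=0$. Algorithms are deterministic word-RAM programs on words of logarithmic length, i.e. $O(\log (nd))$ bits on $k$-OV instances and $O(\log(N+M))$ bits on graphs with $N$ vertices and $M$ edges, where the constants may depend on the program. Graphs are simple, directed and unweighted, and are given as lists of edges. The distance $d(u,v)$ is the number of edges of a shortest directed path from $u$ to $v$ ($\infty$ if there is none), and the diameter is $D=\max_{u,v}d(u,v)$. For a fixed $k$, the $k$-OV Conjecture says that for no $\varepsilon>0$ can $k$-OV be decided in time $O(n^{k-\varepsilon}\,\mathrm{poly}(d))$. \textbf{Theorem.} There is an absolute constant $C$ such that for every integer $k\ge 3$ the following hold. (1) There is an algorithm that transforms any $k$-OV instance in time at most $C\,k\,n^{k-1}d^{k-1}$ into a directed unweighted graph with at most $C\,(k\,n^{k-1}+k\,n^{k-2}d^{k-1})$ vertices and at most $C\,k\,n^{k-1}d^{k-1}$ edges such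 that - if the instance has no solution, then $d(u,v)\le 3k-4$ for all pairs of vertices $u,v$; - if the instance has a solution, then $d(u,v)\ge 5k-7$ for some pair of vertices $u,v$. (2) Assume the $k$-OV Conjecture for this $k$. Then directed Diameter on sparse graphs has an $N^{1+1/(k-1)-o(1)}$ lower bound for distinguishing diameter at most $3k-4$ from diameter at least $5k-7$, and for $\left(\frac{5k-7}{3k-4}-\varepsilon\right)$-approximation. Precisely, there is a constant $K$ (depending only on $k$) such that for every $\delta>0$ no algorithm running in time $O(N^{1+1/(k-1)-\delta})$ on the directed unweighted graphs with $N$ vertices and at most $KN$ edges - distinguishes those with $D\le 3k-4$ from those with $D\ge 5k-7$ (nothing being required of the algorithm on the other graphs), or - returns, for some fixed $\varepsilon>0$, an estimate $E\in\{0,1,2,\dots\}\cup\{\infty\}$ with $E\le D\le\alpha E$, where $\alpha=\frac{5k-7}{3k-4}-\varepsilon$ (so that $E=\infty$ has to be reported if $D=\infty$). -/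

import Mathlib

open scoped ENNReal

/-! ### Word RAM

A deterministic random access machine with `w`-bit words. A program is a finite text over finitely
many registers and finitely many random-access arrays, all of whose cells hold words. Every
elementary instruction and every test costs one time unit. An instruction whose result does not fit
into a word has no execution. -/

namespace WordRAM

/-- The arithmetic, comparison and bitwise word operations. -/
inductive BinOp
  | add | sub | mul | div | mod | lt | eq | and | or | xor | shl | shr

/-- The value of an operation (subtraction is truncated, comparisons return `0` or `1`). -/
def BinOp.eval : BinOp → ℕ → ℕ → ℕ
  | .add, x, y => x + y
  | .sub, x, y => x - y
  | .mul, x, y => x * y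
  | .div, x, y => x / y
  | .mod, x, y => x % y
  | .lt, x, y => if x < y then 1 else 0
  | .eq, x, y => if x = y then 1 else 0
  | .and, x, y => Nat.land x y
  | .or, x, y => Nat.lor x y
  | .xor, x, y => Nat.xor x y
  | .shl, x, y => x <<< y
  | .shr, x, y => x >>> y

/-- Programs. Registers and arrays are named by natural numbers; the names are part of the program
text, only the index of a cell of an array is computed at run time. -/
inductive Prog
  | skip
  /-- `const r v`: put the constant `v` into register `r`. -/
  | const (r v : ℕ)
  /-- `op o r a b`: put the result of `o` on registers `a`, `b` into register `r`. -/
  | op (o : BinOp) (r a b : ℕ)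
  /-- `load r A i`: put cell number (content of register `i`) of array `A` into register `r`. -/
  | load (r A i : ℕ)
  /-- `store A i r`: put register `r` into cell number (content of register `i`) of array `A`. -/
  | store (A i r : ℕ)
  | seq (p q : Prog)
  /-- `cond r p q`: run `p` if register `r` is nonzero, and `q` otherwise. -/
  | cond (r : ℕ) (p q : Prog)
  /-- `loop r p`: run `p` as long as register `r` is nonzero. -/
  | loop (r : ℕ) (p : Prog)

/-- The contents of the registers and of the arrays. -/
structure State where
  reg : ℕ → ℕ
  mem : ℕ → ℕ → ℕ

/-- Overwrite register `r` by `v`. -/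
def State.setReg (s : State) (r v : ℕ) : State :=
  { s with reg := Function.update s.reg r v }

/-- Overwrite cell `x` of array `A` by `v`. -/
def State.setMem (s : State) (A x v : ℕ) : State :=
  { s with mem := Function.update s.mem A (Function.update (s.mem A) x v) }

/-- `Exec w p s s' t`: on `w`-bit words, program `p` started in state `s` halts in state `s'` after
exactly `t` time units. -/
inductive Exec (w : ℕ) : Prog → State → State → ℕ → Prop
  | skip (s : State) : Exec w .skip s s 1
  | const (s : State) (r v : ℕ) (h : v < 2 ^ w) : Exec w (.const r v) s (s.setReg r v) 1
  | op (s : State) (o : BinOp) (r a b : ℕ) (h : o.eval (s.reg a) (s.reg b) < 2 ^ w) :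
      Exec w (.op o r a b) s (s.setReg r (o.eval (s.reg a) (s.reg b))) 1
  | load (s : State) (r A i : ℕ) : Exec w (.load r A i) s (s.setReg r (s.mem A (s.reg i))) 1
  | store (s : State) (A i r : ℕ) : Exec w (.store A i r) s (s.setMem A (s.reg i) (s.reg r)) 1
  | seq {p q : Prog} {s s₁ s₂ : State} {t₁ t₂ : ℕ} (h₁ : Exec w p s s₁ t₁)
      (h₂ : Exec w q s₁ s₂ t₂) : Exec w (.seq p q) s s₂ (t₁ + t₂)
  | cond_true {r : ℕ} {p q : Prog} {s s₁ : State} {t : ℕ} (h : s.reg r ≠ 0)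
      (h₁ : Exec w p s s₁ t) : Exec w (.cond r p q) s s₁ (t + 1)
  | cond_false {r : ℕ} {p q : Prog} {s s₁ : State} {t : ℕ} (h : s.reg r = 0)
      (h₁ : Exec w q s s₁ t) : Exec w (.cond r p q) s s₁ (t + 1)
  | loop_done {r : ℕ} {p : Prog} {s : State} (h : s.reg r = 0) : Exec w (.loop r p) s s 1
  | loop_step {r : ℕ} {p : Prog} {s s₁ s₂ : State} {t₁ t₂ : ℕ} (h : s.reg r ≠ 0)
      (h₁ : Exec w p s s₁ t₁) (h₂ : Exec w (.loop r p) s₁ s₂ t₂) :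
      Exec w (.loop r p) s s₂ (t₁ + t₂ + 1)

end WordRAM

/-! ### Orthogonal vectors -/

/-- An instance of `k`-OV: `k` sets of `n` vectors in `{0,1}^d`, each set being listed without
repetition. -/
structure OVInstance (k n d : ℕ) where
  vec : Fin k → Fin n → Fin d → Bool
  injective : ∀ i, Function.Injective (vec i)

namespace OVInstance

variable {k n d : ℕ}

/-- One vector can be picked from each set so that the generalized inner product vanishes. -/
def HasSolution (I : OVInstance k n d) : Prop :=
  ∃ v : Fin k → Fin n, ∑ x : Fin d, ∏ i : Fin k, (I.vec i (v i) x).toNat = 0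

/-- Coordinate `x` of the `j`-th vector of the `i`-th set, as a number, and `0` out of range. -/
def bit (I : OVInstance k n d) (i j x : ℕ) : ℕ :=
  if h : i < k ∧ j < n ∧ x < d then (I.vec ⟨i, h.1⟩ ⟨j, h.2.1⟩ ⟨x, h.2.2⟩).toNat else 0

/-- The initial state for an instance: `n` and `d` are in registers `0` and `1`, coordinate `x` of
the `j`-th vector of the `i`-th set is in cell `(i * n + j) * d + x` of array `0`, and everything
else is `0`. -/
def init (I : OVInstance k n d) : WordRAM.State where
  reg r := if r = 0 then n else if r = 1 then d else 0
  mem A c := if A = 0 then I.bit (c / (n * d)) (c / d % n) (c % d) else 0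

end OVInstance

/-- The `k`-OV Conjecture: `k`-OV requires time `n ^ (k - o(1))` on a word RAM with words of
logarithmic length, that is, for no `ε > 0` is there an algorithm for `k`-OV that runs in time
`O(n ^ (k - ε) * poly(d))`. The answer of an algorithm is read off register `0`. -/
def KOVConjecture (k : ℕ) : Prop :=
  ∀ ε : ℝ, 0 < ε → ¬ ∃ (P : WordRAM.Prog) (c a : ℕ) (C : ℝ),
    ∀ (n d : ℕ), 0 < n → 0 < d → ∀ I : OVInstance k n d,
      ∃ (s : WordRAM.State) (t : ℕ),
        WordRAM.Exec (c * Nat.size (n * d)) P I.init s t ∧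
        (t : ℝ) ≤ C * (n : ℝ) ^ ((k : ℝ) - ε) * (d : ℝ) ^ a ∧
        (I.HasSolution → s.reg 0 = 1) ∧ (¬ I.HasSolution → s.reg 0 = 0)

/-! ### Directed unweighted graphs -/

/-- A simple directed graph on the vertices `0, …, N - 1`, given by a list of its edges. -/
structure EdgeListGraph (N : ℕ) where
  edges : List (Fin N × Fin N)
  nodup : edges.Nodup
  loopless : ∀ e ∈ edges, e.1 ≠ e.2

namespace EdgeListGraph

variable {N : ℕ}

/-- `G.HasWalk m u v`: there is a directed walk with `m` edges from `u` to `v`. -/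
inductive HasWalk (G : EdgeListGraph N) : ℕ → Fin N → Fin N → Prop
  | nil (u : Fin N) : HasWalk G 0 u u
  | cons {m : ℕ} {u v x : Fin N} (h : (u, v) ∈ G.edges) (p : HasWalk G m v x) :
      HasWalk G (m + 1) u x

/-- The distance from `u` to `v`, which is `⊤` if `v` cannot be reached from `u`. -/
noncomputable def dist (G : EdgeListGraph N) (u v : Fin N) : ℕ∞ :=
  ⨅ (m : ℕ) (_ : G.HasWalk m u v), (m : ℕ∞)

/-- The diameter: the largest distance from a vertex to a vertex. -/
noncomputable def diam (G : EdgeListGraph N) : ℕ∞ :=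
  ⨆ (u : Fin N) (v : Fin N), G.dist u v

/-- The graph is stored in state `s`: the numbers of vertices and of edges are in registers `0` and
`1`, and the tail and the head of edge number `e` are in cell `e` of arrays `1` and `2`. -/
def StoredIn (G : EdgeListGraph N) (s : WordRAM.State) : Prop :=
  s.reg 0 = N ∧ s.reg 1 = G.edges.length ∧
    ∀ (e : ℕ) (h : e < G.edges.length),
      s.mem 1 e = (G.edges[e].1 : ℕ) ∧ s.mem 2 e = (G.edges[e].2 : ℕ)

/-- The initial state for a graph: the graph is stored and everything else is `0`. -/
def init (G : EdgeListGraph N) : WordRAM.State where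
  reg r := if r = 0 then N else if r = 1 then G.edges.length else 0
  mem A e :=
    if h : e < G.edges.length then
      if A = 1 then (G.edges[e].1 : ℕ) else if A = 2 then (G.edges[e].2 : ℕ) else 0
    else 0

end EdgeListGraph

/-! ### Algorithms for the directed diameter of sparse graphs -/

/-- There is a word RAM algorithm (words of logarithmic length) which, on the directed unweighted
graphs with `N` vertices and at most `K * N` edges, runs in time `O(N ^ τ)` and distinguishes
diameter at most `D₁` from diameter at least `D₂`. On other graphs nothing is required. -/
def DiameterDistinguishable (K D₁ D₂ : ℕ) (τ : ℝ) : Prop :=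
  ∃ (P : WordRAM.Prog) (c : ℕ) (C : ℝ),
    ∀ (N : ℕ), 0 < N → ∀ G : EdgeListGraph N, G.edges.length ≤ K * N →
      (G.diam ≤ D₁ ∨ (D₂ : ℕ∞) ≤ G.diam) →
      ∃ (s : WordRAM.State) (t : ℕ),
        WordRAM.Exec (c * Nat.size (N + G.edges.length)) P G.init s t ∧
        (t : ℝ) ≤ C * (N : ℝ) ^ τ ∧
        (G.diam ≤ D₁ → s.reg 0 = 0) ∧ ((D₂ : ℕ∞) ≤ G.diam → s.reg 0 = 1)

/-- The estimate of the diameter that an algorithm returns: the content of register `0`, or `⊤` if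
the flag in register `1` is nonzero. -/
def WordRAM.State.estimate (s : WordRAM.State) : ℕ∞ :=
  if s.reg 1 = 0 then (s.reg 0 : ℕ∞) else ⊤

/-- There is a word RAM algorithm (words of logarithmic length) which, on the directed unweighted
graphs with `N` vertices and at most `K * N` edges, runs in time `O(N ^ τ)` and returns an
`α`-approximation of the diameter `D`, that is, an estimate `E` with `D / α ≤ E ≤ D`. -/
def DiameterApproximable (K : ℕ) (α τ : ℝ) : Prop :=
  ∃ (P : WordRAM.Prog) (c : ℕ) (C : ℝ),
    ∀ (N : ℕ), 0 < N → ∀ G : EdgeListGraph N, G.edges.length ≤ K * N →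
      ∃ (s : WordRAM.State) (t : ℕ),
        WordRAM.Exec (c * Nat.size (N + G.edges.length)) P G.init s t ∧
        (t : ℝ) ≤ C * (N : ℝ) ^ τ ∧
        s.estimate ≤ G.diam ∧
        (G.diam : ℝ≥0∞) ≤ ENNReal.ofReal α * (s.estimate : ℝ≥0∞)

/-! A tuple of the first half of the layers picks vectors from the sets `0, …, k - 2`, a tuple of
the second half from the sets `1, …, k - 1`. The `k - 1` inner layers between them exchange the left
vectors for the right ones, one per step. Layer `i` still has the left vectors of the sets up to `k
- 2 - i`, already has the right vectors of the sets from `k + 1 - i` on, and carries coordinates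
`X_0, …, X_{k-2}` that never change inside. An inner vertex exists only if each `X_j` is `1` in its
left vectors of sets `≤ j` and in its right vectors of sets `> j`.

No solution: for tuples `Q`, `Q'` and every `j`, the left vectors of sets `≤ j` and the right
vectors of sets `> j` have a common `1`. Taking it as `X_j` makes the straight path valid
(`first_second`), so the two outermost layers are at distance at most `3k - 4`. The other pairs are
joined through two hubs: `h1` is entered near the end of the second half and leads to the first
inner layer, `h2` is entered from the last inner layer and leads to the first tuple layers. An extra
all-ones vector, digit `n`, lets every inner vertex move to both ends of the inner part (`mid_up`,
`mid_down`). This gives `within_of_not_hasSolution`.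

Solution `v`: take `s = (v_0, …, v_{k-2})` in the first layer and `t = (v_1, …, v_{k-1})` in the
last. The lower bounds `level` (from the first layer) and `colevel` (to the last) add up to `5k - 7`
at either hub, so a shorter walk avoids the hubs. Then each step changes the level by one and the
length is `3k - 4` plus twice the number of backward steps, of which there are at most `k - 2`. Look
at the first arc into the second half, with `a` backward steps before it and `b` after it, `a + b ≤
k - 2`. Destroying the vector of set `l` in the left tuple takes `k - 1 - l` backward steps. Hence
when `X` was last chosen, the vectors of sets `≤ k - 2 - a` were those of `s`. Symmetrically the
right vectors of sets `> b` are those of `t`. So coordinate `X_b` is `1` in all of `v_0, …,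
v_{k-1}`, a contradiction (`suffix_of_walk`, `no_short_walk`).

For the word RAM, tuples are numbers and every potential inner vertex owns a number. An invalid one
becomes a `dead` vertex, so nothing has to be renumbered, and further dead vertices pad the graph
when it has to be sparse. If `n < k ^ 3`, replacing `n` by `n + 1` and tabulating validity could be
too expensive. Such instances are solved by brute force, which is affordable because `n ≤ 2 ^ d`,
and an edgeless graph with one or two vertices is output (`exists_reduction`).

For the lower bound, the padded graph has `N = O(k n^{k-1} d^{k-1})` vertices, so time `N ^ τ` with
`τ < 1 + 1 / (k - 1)` would decide `k`-OV in time `n^{(k-1)τ} d^k` up to a constant, where `(k - 1)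
τ < k` (`not_diameterDistinguishable`). A good enough approximation distinguishes the two cases by
comparing the estimate with `3k - 4`. -/

namespace WordRAM

/-! ### General facts on executions -/

/-- Longer words allow the same executions. -/
theorem Exec.mono {w w' : ℕ} (hw : w ≤ w') {p : Prog} {s s' : State} {t : ℕ}
    (h : Exec w p s s' t) : Exec w' p s s' t := by
  have hp : 2 ^ w ≤ 2 ^ w' := Nat.pow_le_pow_right (by norm_num) hw
  induction h with
  | skip s => exact .skip s
  | const s r v h => exact .const s r v (h.trans_le hp)
  | op s o r a b h => exact .op s o r a b (h.trans_le hp)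
  | load s r A i => exact .load s r A i
  | store s A i r => exact .store s A i r
  | seq _ _ h₁ h₂ => exact .seq h₁ h₂
  | cond_true h _ h₁ => exact .cond_true h h₁
  | cond_false h _ h₁ => exact .cond_false h h₁
  | loop_done h => exact .loop_done h
  | loop_step h _ _ h₁ h₂ => exact .loop_step h h₁ h₂

/-- Rename register `r` to `r + R` and array `A` to `A + B`. -/
def Prog.shift (R B : ℕ) : Prog → Prog
  | .skip => .skip
  | .const r v => .const (r + R) v
  | .op o r a b => .op o (r + R) (a + R) (b + R)
  | .load r A i => .load (r + R) (A + B) (i + R)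
  | .store A i r => .store (A + B) (i + R) (r + R)
  | .seq p q => .seq (p.shift R B) (q.shift R B)
  | .cond r p q => .cond (r + R) (p.shift R B) (q.shift R B)
  | .loop r p => .loop (r + R) (p.shift R B)

/-- State `s'` contains a copy of state `s` in the shifted registers and arrays. -/
def State.ShiftOf (R B : ℕ) (s s' : State) : Prop :=
  (∀ r, s'.reg (r + R) = s.reg r) ∧ ∀ A, s'.mem (A + B) = s.mem A

theorem State.ShiftOf.setReg {R B : ℕ} {s s' : State} (h : s.ShiftOf R B s') (r v : ℕ) :
    (s.setReg r v).ShiftOf R B (s'.setReg (r + R) v) := by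
  refine ⟨fun x => ?_, h.2⟩
  by_cases hx : x = r
  · subst hx; simp [State.setReg]
  · simp [State.setReg, Function.update_of_ne, hx, h.1]

theorem State.ShiftOf.setMem {R B : ℕ} {s s' : State} (h : s.ShiftOf R B s') (A x v : ℕ) :
    (s.setMem A x v).ShiftOf R B (s'.setMem (A + B) x v) := by
  refine ⟨h.1, fun y => ?_⟩
  by_cases hy : y = A
  · subst hy; simp [State.setMem, h.2]
  · simp [State.setMem, Function.update_of_ne, hy, h.2]

/-- Shifting names is injective, so the copy evolves like the original and in the same time. This
lets a given diameter algorithm run next to the reduction without clashes. -/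
theorem Exec.shift {w R B : ℕ} {p : Prog} {s s' : State} {t : ℕ} (h : Exec w p s s' t) :
    ∀ S, s.ShiftOf R B S → ∃ S', Exec w (p.shift R B) S S' t ∧ s'.ShiftOf R B S' := by
  induction h with
  | skip s => exact fun S hS => ⟨S, .skip S, hS⟩
  | const s r v h => exact fun S hS => ⟨_, .const S _ v h, hS.setReg r v⟩
  | op s o r a b h =>
    intro S hS
    rw [← hS.1 a, ← hS.1 b] at h ⊢
    exact ⟨_, .op S o _ _ _ h, hS.setReg r _⟩
  | load s r A i =>
    intro S hS
    rw [← hS.1 i, ← hS.2 A]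
    exact ⟨_, .load S _ _ _, hS.setReg r _⟩
  | store s A i r =>
    intro S hS
    rw [← hS.1 i, ← hS.1 r]
    exact ⟨_, .store S _ _ _, hS.setMem A _ _⟩
  | seq _ _ ih₁ ih₂ =>
    intro S hS
    obtain ⟨S₁, e₁, h₁⟩ := ih₁ S hS
    obtain ⟨S₂, e₂, h₂⟩ := ih₂ S₁ h₁
    exact ⟨S₂, .seq e₁ e₂, h₂⟩
  | cond_true h _ ih =>
    intro S hS
    obtain ⟨S₁, e₁, h₁⟩ := ih S hS
    exact ⟨S₁, .cond_true (by rwa [hS.1]) e₁, h₁⟩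
  | cond_false h _ ih =>
    intro S hS
    obtain ⟨S₁, e₁, h₁⟩ := ih S hS
    exact ⟨S₁, .cond_false (by rwa [hS.1]) e₁, h₁⟩
  | loop_done h => exact fun S hS => ⟨S, .loop_done (by rwa [hS.1]), hS⟩
  | loop_step h _ _ ih₁ ih₂ =>
    intro S hS
    obtain ⟨S₁, e₁, h₁⟩ := ih₁ S hS
    obtain ⟨S₂, e₂, h₂⟩ := ih₂ S₁ h₁
    exact ⟨S₂, .loop_step (by rwa [hS.1]) e₁ e₂, h₂⟩

/-- All registers that a program writes to are below this bound. -/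
def Prog.regBound : Prog → ℕ
  | .skip => 0
  | .const r _ => r + 1
  | .op _ r _ _ => r + 1
  | .load r _ _ => r + 1
  | .store _ _ _ => 0
  | .seq p q => max p.regBound q.regBound
  | .cond _ p q => max p.regBound q.regBound
  | .loop _ p => p.regBound

/-- Needed for composing programs: beyond the bound of the first program the registers still hold
their initial `0`, as the second one expects. -/
theorem Exec.reg_eq {w : ℕ} {p : Prog} {s s' : State} {t : ℕ} (h : Exec w p s s' t) :
    ∀ x, p.regBound ≤ x → s'.reg x = s.reg x := by
  induction h with
  | skip s => exact fun _ _ => rfl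
  | const s r v h =>
    intro x hx
    simp only [Prog.regBound] at hx
    exact Function.update_of_ne (by omega) _ _
  | op s o r a b h =>
    intro x hx
    simp only [Prog.regBound] at hx
    exact Function.update_of_ne (by omega) _ _
  | load s r A i =>
    intro x hx
    simp only [Prog.regBound] at hx
    exact Function.update_of_ne (by omega) _ _
  | store s A i r => exact fun _ _ => rfl
  | seq _ _ ih₁ ih₂ =>
    intro x hx
    simp only [Prog.regBound, max_le_iff] at hx
    rw [ih₂ x hx.2, ih₁ x hx.1]
  | cond_true h _ ih =>
    intro x hx
    simp only [Prog.regBound, max_le_iff] at hx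
    exact ih x hx.1
  | cond_false h _ ih =>
    intro x hx
    simp only [Prog.regBound, max_le_iff] at hx
    exact ih x hx.2
  | loop_done h => exact fun _ _ => rfl
  | loop_step h _ _ ih₁ ih₂ =>
    intro x hx
    rw [ih₂ x hx, ih₁ x hx]

/-! ### Expressions -/

/-- Expressions over registers, constants, word operations and array cells. -/
inductive Ex
  | var (r : ℕ)
  | lit (v : ℕ)
  | bin (o : BinOp) (a b : Ex)
  | ld (A : ℕ) (e : Ex)

namespace Ex

/-- The value of an expression. -/
def ev (ρ : ℕ → ℕ) (μ : ℕ → ℕ → ℕ) : Ex → ℕ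
  | var r => ρ r
  | lit v => v
  | bin o a b => o.eval (a.ev ρ μ) (b.ev ρ μ)
  | ld A e => μ A (e.ev ρ μ)

/-- Code that puts the value into register `t`, and uses only registers from `t` on. -/
def comp : Ex → ℕ → Prog
  -- A copy instruction: `x and x = x`.
  | var r, t => .op .and t r r
  | lit v, t => .const t v
  | bin o a b, t => .seq (a.comp t) (.seq (b.comp (t + 1)) (.op o t t (t + 1)))
  | ld A e, t => .seq (e.comp t) (.load t A t)

/-- The running time of the code of an expression. -/
def cost : Ex → ℕ
  | var _ => 1
  | lit _ => 1
  | bin _ a b => a.cost + b.cost + 1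
  | ld _ e => e.cost + 1

/-- No overflow occurs. -/
def Fits (w : ℕ) (ρ : ℕ → ℕ) (μ : ℕ → ℕ → ℕ) : Ex → Prop
  | var r => ρ r < 2 ^ w
  | lit v => v < 2 ^ w
  | bin o a b => a.Fits w ρ μ ∧ b.Fits w ρ μ ∧ o.eval (a.ev ρ μ) (b.ev ρ μ) < 2 ^ w
  | ld A e => e.Fits w ρ μ ∧ μ A (e.ev ρ μ) < 2 ^ w

/-- All registers of the expression satisfy `S`. -/
def Vars (S : ℕ → Prop) : Ex → Prop
  | var r => S r
  | lit _ => True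
  | bin _ a b => a.Vars S ∧ b.Vars S
  | ld _ e => e.Vars S

/-- All arrays of the expression satisfy `S`. -/
def Reads (S : ℕ → Prop) : Ex → Prop
  | var _ => True
  | lit _ => True
  | bin _ a b => a.Reads S ∧ b.Reads S
  | ld A e => S A ∧ e.Reads S

theorem Vars.mono {S S' : ℕ → Prop} (h : ∀ r, S r → S' r) : ∀ {e : Ex}, e.Vars S → e.Vars S'
  | var r, hv => h r hv
  | lit _, _ => trivial
  | bin _ _ _, hv => ⟨Vars.mono h hv.1, Vars.mono h hv.2⟩
  | ld _ e, hv => Vars.mono (e := e) h hv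

theorem Reads.mono {S S' : ℕ → Prop} (h : ∀ r, S r → S' r) : ∀ {e : Ex}, e.Reads S → e.Reads S'
  | var _, _ => trivial
  | lit _, _ => trivial
  | bin _ _ _, hv => ⟨Reads.mono h hv.1, Reads.mono h hv.2⟩
  | ld _ _, hv => ⟨h _ hv.1, Reads.mono h hv.2⟩

theorem ev_congr {ρ ρ' : ℕ → ℕ} {μ μ' : ℕ → ℕ → ℕ} {S S' : ℕ → Prop}
    (h : ∀ r, S r → ρ r = ρ' r) (h' : ∀ A, S' A → μ A = μ' A) :
    ∀ {e : Ex}, e.Vars S → e.Reads S' → e.ev ρ μ = e.ev ρ' μ'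
  | var r, hv, _ => h r hv
  | lit _, _, _ => rfl
  | bin o a b, hv, hr => by
    rw [ev, ev, ev_congr h h' hv.1 hr.1, ev_congr h h' hv.2 hr.2]
  | ld A e, hv, hr => by
    rw [ev, ev, ev_congr (e := e) h h' hv hr.2, h' A hr.1]

theorem Fits.congr {w : ℕ} {ρ ρ' : ℕ → ℕ} {μ μ' : ℕ → ℕ → ℕ} {S S' : ℕ → Prop}
    (h : ∀ r, S r → ρ r = ρ' r) (h' : ∀ A, S' A → μ A = μ' A) :
    ∀ {e : Ex}, e.Vars S → e.Reads S' → e.Fits w ρ μ → e.Fits w ρ' μ'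
  | var r, hv, _, hf => by rw [Fits] at hf ⊢; rwa [← h r hv]
  | lit _, _, _, hf => hf
  | bin o a b, hv, hr, hf => by
    refine ⟨hf.1.congr h h' hv.1 hr.1, hf.2.1.congr h h' hv.2 hr.2, ?_⟩
    rw [← ev_congr h h' hv.1 hr.1, ← ev_congr h h' hv.2 hr.2]
    exact hf.2.2
  | ld A e, hv, hr, hf => by
    refine ⟨Fits.congr (e := e) h h' hv hr.2 hf.1, ?_⟩
    rw [← ev_congr (e := e) h h' hv hr.2, ← h' A hr.1]
    exact hf.2

theorem Fits.ev_lt {w : ℕ} {ρ : ℕ → ℕ} {μ : ℕ → ℕ → ℕ} : ∀ {e : Ex}, e.Fits w ρ μ →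
    e.ev ρ μ < 2 ^ w
  | var _, h => h
  | lit _, h => h
  | bin _ _ _, h => h.2.2
  | ld _ _, h => h.2

theorem reads_true : ∀ e : Ex, e.Reads fun _ => True
  | var _ => trivial
  | lit _ => trivial
  | bin _ a b => ⟨a.reads_true, b.reads_true⟩
  | ld _ e => ⟨trivial, e.reads_true⟩

/-- Stack discipline: the left operand waits in register `t` while the right one is computed from `t
+ 1` on. -/
theorem exec_comp {w : ℕ} : ∀ (e : Ex) (t : ℕ) (s : State), e.Vars (· < t) →
    e.Fits w s.reg s.mem → ∃ s', Exec w (e.comp t) s s' e.cost ∧ s'.mem = s.mem ∧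
      (∀ r < t, s'.reg r = s.reg r) ∧ s'.reg t = e.ev s.reg s.mem
  | var r, t, s, _, hf => by
    have hx : BinOp.and.eval (s.reg r) (s.reg r) = s.reg r := Nat.and_self _
    refine ⟨_, .op s .and t r r (by rw [hx]; exact hf), rfl, fun x hx => ?_, ?_⟩
    · exact Function.update_of_ne (by omega) _ _
    · simp only [State.setReg, Function.update_self, hx]; rfl
  | lit v, t, s, _, hf => by
    refine ⟨_, .const s t v hf, rfl, fun x hx => ?_, ?_⟩
    · exact Function.update_of_ne (by omega) _ _
    · simp [State.setReg, ev]
  | bin o a b, t, s, hv, hf => by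
    obtain ⟨s₁, e₁, m₁, r₁, v₁⟩ := exec_comp a t s hv.1 hf.1
    have hvb : b.Vars (· < t + 1) := hv.2.mono fun r hr => Nat.lt_succ_of_lt hr
    obtain ⟨s₂, e₂, m₂, r₂, v₂⟩ := exec_comp b (t + 1) s₁ hvb
      (hf.2.1.congr (fun r hr => (r₁ r hr).symm) (fun A _ => by rw [m₁]) hv.2 b.reads_true)
    have hb : b.ev s₁.reg s₁.mem = b.ev s.reg s.mem :=
      ev_congr (fun r hr => r₁ r hr) (fun A _ => by rw [m₁]) hv.2 b.reads_true
    have ha : s₂.reg t = a.ev s.reg s.mem := by rw [r₂ t (Nat.lt_succ_self t), v₁]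
    have hb' : s₂.reg (t + 1) = b.ev s.reg s.mem := by rw [v₂, hb]
    have hE := Exec.seq e₁ (.seq e₂ (.op s₂ o t t (t + 1) (by rw [ha, hb']; exact hf.2.2)))
    refine ⟨_, hE, ?_, fun x hx => ?_, ?_⟩
    · simp [State.setReg, m₂, m₁]
    · simp only [State.setReg]
      rw [Function.update_of_ne (by omega), r₂ x (by omega), r₁ x hx]
    · simp [State.setReg, ev, ha, hb']
  | ld A e, t, s, hv, hf => by
    obtain ⟨s₁, e₁, m₁, r₁, v₁⟩ := exec_comp e t s hv hf.1
    refine ⟨_, .seq e₁ (.load s₁ t A t), ?_, fun x hx => ?_, ?_⟩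
    · simp [State.setReg, m₁]
    · simp only [State.setReg]
      rw [Function.update_of_ne (by omega), r₁ x hx]
    · simp [State.setReg, ev, v₁, m₁]

/-- Exponent of a monomial bound for the values of the subexpressions. -/
def deg : Ex → ℕ
  | var _ => 1
  | lit _ => 1
  -- For `M ≥ 2`, twice `M ^ e` is at most `M ^ (e + 1)`.
  | bin .add a b => max a.deg b.deg + 1
  | bin .mul a b => a.deg + b.deg
  | bin _ a b => max a.deg b.deg
  | ld _ e => max 1 e.deg

/-- Only arithmetic and comparisons, and constants up to `M`. -/
def Tame (M : ℕ) : Ex → Prop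
  | var _ => True
  | lit v => v ≤ M
  | bin .and _ _ => False
  | bin .or _ _ => False
  | bin .xor _ _ => False
  | bin .shl _ _ => False
  | bin .shr _ _ => False
  | bin _ a b => a.Tame M ∧ b.Tame M
  | ld _ e => e.Tame M

theorem deg_pos : ∀ e : Ex, 1 ≤ e.deg
  | var _ => le_rfl
  | lit _ => le_rfl
  | bin o a b => by
    have := a.deg_pos
    have := b.deg_pos
    cases o <;> simp only [deg] <;> omega
  | ld _ e => by simp [deg]

/-- Registers and cells are bounded by `M`, whatever the index of the cell. Only sums and products
enlarge values; the other tame operations are bounded by their operands or by `1`. -/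
theorem ev_le_pow {ρ : ℕ → ℕ} {μ : ℕ → ℕ → ℕ} {M : ℕ} (hM : 2 ≤ M) (hρ : ∀ r, ρ r ≤ M)
    (hμ : ∀ A x, μ A x ≤ M) : ∀ e : Ex, e.Tame M → e.ev ρ μ ≤ M ^ e.deg
  | var r, _ => by simpa [ev, deg] using hρ r
  | lit v, h => by
    rw [ev, deg, pow_one]
    exact h
  | ld A e, _ => by
    have h1 : M ^ 1 ≤ M ^ (ld A e).deg := Nat.pow_le_pow_right (by omega) (deg_pos _)
    rw [pow_one] at h1
    exact (hμ _ _).trans h1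
  | bin o a b, h => by
    have hM' : 0 < M := by omega
    have hab : a.Tame M ∧ b.Tame M := by cases o <;> first | exact h | exact h.elim
    have iha := ev_le_pow hM hρ hμ a hab.1
    have ihb := ev_le_pow hM hρ hμ b hab.2
    have h1 : a.ev ρ μ ≤ M ^ max a.deg b.deg :=
      iha.trans (Nat.pow_le_pow_right hM' (le_max_left _ _))
    have h2 : b.ev ρ μ ≤ M ^ max a.deg b.deg :=
      ihb.trans (Nat.pow_le_pow_right hM' (le_max_right _ _))
    have h3 : 1 ≤ M ^ max a.deg b.deg := Nat.one_le_pow _ _ hM'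
    cases o with
    | add =>
      simp only [ev, BinOp.eval, deg, pow_succ]
      nlinarith
    | sub => exact (Nat.sub_le _ _).trans h1
    | mul =>
      simp only [ev, BinOp.eval, deg, pow_add]
      exact Nat.mul_le_mul iha ihb
    | div => exact (Nat.div_le_self _ _).trans h1
    | mod => exact (Nat.mod_le _ _).trans h1
    | lt => simp only [ev, BinOp.eval, deg]; split_ifs <;> omega
    | eq => simp only [ev, BinOp.eval, deg]; split_ifs <;> omega
    | and => exact h.elim
    | or => exact h.elim
    | xor => exact h.elim
    | shl => exact h.elim
    | shr => exact h.elim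

/-- The degree does not decrease from a subexpression to the expression. Hence the absence of
overflow everywhere follows from the single inequality `M ^ D < 2 ^ w`. -/
theorem fits_of_deg {w : ℕ} {ρ : ℕ → ℕ} {μ : ℕ → ℕ → ℕ} {M D : ℕ} (hM : 2 ≤ M)
    (hρ : ∀ r, ρ r ≤ M) (hμ : ∀ A x, μ A x ≤ M) (hD : M ^ D < 2 ^ w) :
    ∀ e : Ex, e.Tame M → e.deg ≤ D → e.Fits w ρ μ := by
  intro e
  have key : ∀ e : Ex, e.Tame M → e.deg ≤ D → e.ev ρ μ < 2 ^ w := fun e h hd =>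
    ((ev_le_pow hM hρ hμ e h).trans (Nat.pow_le_pow_right (by omega) hd)).trans_lt hD
  induction e with
  | var r => exact key (var r)
  | lit v => exact key (lit v)
  | ld A e ih =>
    intro h hd
    exact ⟨ih h (le_trans (le_max_right _ _) hd), key _ h hd⟩
  | bin o a b iha ihb =>
    intro h hd
    have hab : a.Tame M ∧ b.Tame M := by cases o <;> first | exact h | exact h.elim
    have hd' : a.deg ≤ D ∧ b.deg ≤ D := by
      have := a.deg_pos
      have := b.deg_pos
      cases o <;> simp only [deg] at hd <;> omega
    exact ⟨iha hab.1 hd'.1, ihb hab.2 hd'.2, key _ h hd⟩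

end Ex

end WordRAM


namespace WordRAM

/-! ### Commands -/

/-- Put the value of `e` into register `r`. -/
def setTo (r : ℕ) (e : Ex) : Prog := .seq (e.comp 30) (.op .and r 30 30)

theorem exec_setTo {w r : ℕ} {e : Ex} {s : State} (hv : e.Vars (· < 30))
    (hf : e.Fits w s.reg s.mem) :
    ∃ s', Exec w (setTo r e) s s' (e.cost + 1) ∧ s'.mem = s.mem ∧
      ∀ x < 30, s'.reg x = Function.update s.reg r (e.ev s.reg s.mem) x := by
  obtain ⟨s₁, e₁, m₁, r₁, v₁⟩ := Ex.exec_comp e 30 s hv hf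
  have hx : BinOp.and.eval (s₁.reg 30) (s₁.reg 30) = e.ev s.reg s.mem := by
    rw [← v₁]; exact Nat.and_self _
  refine ⟨_, .seq e₁ (.op s₁ .and r 30 30 (by rw [hx]; exact hf.ev_lt)), m₁, fun x hx' => ?_⟩
  by_cases hxr : x = r
  · subst hxr; simp only [State.setReg, Function.update_self, hx]
  · simp only [State.setReg, Function.update_of_ne hxr]
    exact r₁ x hx'

/-- Run `body` for the values `0, 1, …` of register `i` that are less than register `n`. -/
def forLoop (i n : ℕ) (body : Prog) : Prog :=
  .seq (.const i 0) (.seq (.op .lt 30 i n) (.loop 30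
    (.seq body (.seq (.const 31 1) (.seq (.op .add i i 31) (.op .lt 30 i n))))))

/-- By `hcongr` the invariant ignores the counter and the scratch registers from `30` on, which is
all that the loop itself writes to. The overhead of `4` per round is a constant, an addition, a
comparison and the test. -/
theorem exec_forLoop {w i n c T : ℕ} {body : Prog} (hi : i < 30) (hn : n < 30) (hin : i ≠ n)
    (hc : c < 2 ^ w) (hw : 1 < 2 ^ w) (Inv : ℕ → State → Prop)
    (hcongr : ∀ j s s', Inv j s → s'.mem = s.mem → (∀ r < 30, r ≠ i → s'.reg r = s.reg r) →
      Inv j s')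
    (hstep : ∀ j < c, ∀ s, Inv j s → s.reg i = j → s.reg n = c →
      ∃ s' t, Exec w body s s' t ∧ t ≤ T ∧ Inv (j + 1) s' ∧ s'.reg i = j ∧ s'.reg n = c)
    (s : State) (hs : s.reg n = c) (h0 : Inv 0 s) :
    ∃ s' t, Exec w (forLoop i n body) s s' t ∧ t ≤ c * (T + 4) + 3 ∧ Inv c s' := by
  have aux : ∀ m j s, j + m = c → Inv j s → s.reg i = j → s.reg n = c →
      s.reg 30 = (if j < c then 1 else 0) →
      ∃ s' t, Exec w (.loop 30 (.seq body (.seq (.const 31 1) (.seq (.op .add i i 31)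
        (.op .lt 30 i n))))) s s' t ∧ t ≤ m * (T + 4) + 1 ∧ Inv c s' := by
    intro m
    induction m with
    | zero =>
      intro j s hj hI _ _ h30
      obtain rfl : j = c := by omega
      exact ⟨s, 1, .loop_done (by simpa using h30), by omega, hI⟩
    | succ m ih =>
      intro j s hj hI hi' hn' h30
      have hjc : j < c := by omega
      obtain ⟨s₁, t₁, e₁, ht₁, I₁, i₁, n₁⟩ := hstep j hjc s hI hi' hn'
      have e₂ : Exec w (.const 31 1) s₁ _ 1 := .const s₁ 31 1 hw
      set s₂ := s₁.setReg 31 1 with hs₂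
      have i₂ : s₂.reg i = j := by
        simp only [hs₂, State.setReg]; rw [Function.update_of_ne (by omega), i₁]
      have o₂ : s₂.reg 31 = 1 := by simp [hs₂, State.setReg]
      have e₃ : Exec w (.op .add i i 31) s₂ _ 1 := .op s₂ .add i i 31 (by
        rw [i₂, o₂]; simp only [BinOp.eval]; omega)
      set s₃ := s₂.setReg i (BinOp.add.eval (s₂.reg i) (s₂.reg 31)) with hs₃
      have i₃ : s₃.reg i = j + 1 := by
        simp [hs₃, State.setReg, i₂, o₂, BinOp.eval]
      have n₃ : s₃.reg n = c := by
        simp only [hs₃, hs₂, State.setReg]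
        rw [Function.update_of_ne (by omega), Function.update_of_ne (by omega), n₁]
      have hlt : BinOp.lt.eval (s₃.reg i) (s₃.reg n) = if j + 1 < c then 1 else 0 := by
        rw [i₃, n₃]; rfl
      have e₄ : Exec w (.op .lt 30 i n) s₃ _ 1 := .op s₃ .lt 30 i n (by
        rw [hlt]; split_ifs <;> omega)
      set s₄ := s₃.setReg 30 (BinOp.lt.eval (s₃.reg i) (s₃.reg n)) with hs₄
      have hr : ∀ r < 30, r ≠ i → s₄.reg r = s₁.reg r := by
        intro r hr hri
        simp only [hs₄, hs₃, hs₂, State.setReg]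
        rw [Function.update_of_ne (by omega), Function.update_of_ne (by omega),
          Function.update_of_ne (by omega)]
      have i₄ : s₄.reg i = j + 1 := by
        simp only [hs₄, State.setReg]; rw [Function.update_of_ne (by omega), i₃]
      obtain ⟨s', t', e', ht', I'⟩ := ih (j + 1) s₄ (by omega) (hcongr _ _ _ I₁ rfl hr) i₄
        (by rw [hr n hn hin.symm, n₁]) (by simp [hs₄, State.setReg, hlt])
      refine ⟨s', _, .loop_step (by rw [h30]; simp [hjc]) (.seq e₁ (.seq e₂ (.seq e₃ e₄))) e', ?_,
        I'⟩
      have : (m + 1) * (T + 4) = m * (T + 4) + (T + 4) := by ring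
      omega
  have e₁ : Exec w (.const i 0) s _ 1 := .const s i 0 (by omega)
  set s₁ := s.setReg i 0 with hs₁
  have i₁ : s₁.reg i = 0 := by simp [hs₁, State.setReg]
  have n₁ : s₁.reg n = c := by
    simp only [hs₁, State.setReg]; rw [Function.update_of_ne hin.symm, hs]
  have hlt : BinOp.lt.eval (s₁.reg i) (s₁.reg n) = if 0 < c then 1 else 0 := by rw [i₁, n₁]; rfl
  have e₂ : Exec w (.op .lt 30 i n) s₁ _ 1 := .op s₁ .lt 30 i n (by
    rw [hlt]; split_ifs <;> omega)
  set s₂ := s₁.setReg 30 (BinOp.lt.eval (s₁.reg i) (s₁.reg n)) with hs₂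
  have hr : ∀ r < 30, r ≠ i → s₂.reg r = s.reg r := by
    intro r hr hri
    simp only [hs₂, hs₁, State.setReg]
    rw [Function.update_of_ne (by omega), Function.update_of_ne (by omega)]
  obtain ⟨s', t', e', ht', I'⟩ := aux c 0 s₂ (by omega) (hcongr _ _ _ h0 rfl hr)
    (by simp only [hs₂, State.setReg]; rw [Function.update_of_ne (by omega), i₁])
    (by rw [hr n hn hin.symm, hs]) (by simp [hs₂, State.setReg, hlt])
  exact ⟨s', _, .seq e₁ (.seq e₂ e'), by omega, I'⟩

/-- The registers that hold global variables. -/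
def Glob (r : ℕ) : Prop := r < 2 ∨ 7 ≤ r ∧ r < 30

/-- The arrays are `μ` and the global registers are `ρ`. -/
def St (ρ : ℕ → ℕ) (μ : ℕ → ℕ → ℕ) (s : State) : Prop :=
  s.mem = μ ∧ ∀ r, Glob r → s.reg r = ρ r

/-- Started in a state with `Pre`, the program halts within time `T` in a state with `Post`. -/
def Runs (w : ℕ) (p : Prog) (T : ℕ) (Pre Post : State → Prop) : Prop :=
  ∀ s, Pre s → ∃ s' t, Exec w p s s' t ∧ t ≤ T ∧ Post s'

theorem Runs.seq {w : ℕ} {p q : Prog} {T₁ T₂ : ℕ} {P₁ P₂ P₃ : State → Prop}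
    (h₁ : Runs w p T₁ P₁ P₂) (h₂ : Runs w q T₂ P₂ P₃) : Runs w (.seq p q) (T₁ + T₂) P₁ P₃ := by
  intro s hs
  obtain ⟨s₁, t₁, e₁, ht₁, h₁⟩ := h₁ s hs
  obtain ⟨s₂, t₂, e₂, ht₂, h₂⟩ := h₂ s₁ h₁
  exact ⟨s₂, _, .seq e₁ e₂, by omega, h₂⟩

theorem Runs.mono {w : ℕ} {p : Prog} {T T' : ℕ} {P Q : State → Prop} (h : Runs w p T P Q)
    (hT : T ≤ T') : Runs w p T' P Q := by
  intro s hs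
  obtain ⟨s₁, t₁, e₁, ht₁, h₁⟩ := h s hs
  exact ⟨s₁, t₁, e₁, ht₁.trans hT, h₁⟩

/-- All values are at most `M`, and monomials of degree `D` in such values fit into a word. -/
structure Room (w M D : ℕ) (ρ : ℕ → ℕ) (μ : ℕ → ℕ → ℕ) : Prop where
  two_le : 2 ≤ M
  one_le : 1 ≤ D
  pow_lt : M ^ D < 2 ^ w
  reg_le : ∀ r, ρ r ≤ M
  mem_le : ∀ A x, μ A x ≤ M

theorem Room.lt {w M D : ℕ} {ρ : ℕ → ℕ} {μ : ℕ → ℕ → ℕ} (h : Room w M D ρ μ) : M < 2 ^ w :=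
  (Nat.le_self_pow (by have := h.one_le; omega) M).trans_lt h.pow_lt

theorem Room.update {w M D : ℕ} {ρ : ℕ → ℕ} {μ : ℕ → ℕ → ℕ} (h : Room w M D ρ μ) {r v : ℕ}
    (hv : v ≤ M) : Room w M D (Function.update ρ r v) μ := by
  refine ⟨h.two_le, h.one_le, h.pow_lt, fun x => ?_, h.mem_le⟩
  by_cases hx : x = r
  · subst hx; simpa using hv
  · rw [Function.update_of_ne hx]; exact h.reg_le x

theorem Room.update_mem {w M D : ℕ} {ρ : ℕ → ℕ} {μ : ℕ → ℕ → ℕ} (h : Room w M D ρ μ) {A : ℕ}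
    {f : ℕ → ℕ} (hv : ∀ x, f x ≤ M) : Room w M D ρ (Function.update μ A f) := by
  refine ⟨h.two_le, h.one_le, h.pow_lt, h.reg_le, fun B => ?_⟩
  by_cases hx : B = A
  · subst hx; simpa using hv
  · rw [Function.update_of_ne hx]; exact h.mem_le B

/-- The expression is simple enough for words with room for monomials of degree `D`. -/
structure Ex.Good (e : Ex) (M D : ℕ) (S : ℕ → Prop) : Prop where
  vars : e.Vars S
  tame : e.Tame M
  deg_le : e.deg ≤ D

theorem Ex.Good.fits {e : Ex} {w M D : ℕ} {S : ℕ → Prop} {ρ : ℕ → ℕ} {μ : ℕ → ℕ → ℕ}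
    (h : e.Good M D S) (hR : Room w M D ρ μ) : e.Fits w ρ μ :=
  Ex.fits_of_deg hR.two_le hR.reg_le hR.mem_le hR.pow_lt e h.tame h.deg_le

theorem runs_setTo {w M D r : ℕ} {e : Ex} {ρ : ℕ → ℕ} {μ : ℕ → ℕ → ℕ} (hR : Room w M D ρ μ)
    (he : e.Good M D Glob) :
    Runs w (setTo r e) (e.cost + 1) (St ρ μ) (St (Function.update ρ r (e.ev ρ μ)) μ) := by
  rintro s ⟨rfl, hs⟩
  have hg : ∀ r, Glob r → r < 30 := by unfold Glob; omega
  obtain ⟨s', e', m', r'⟩ := exec_setTo (r := r) (s := s) (he.vars.mono hg)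
    ((he.fits hR).congr (fun r hr => (hs r hr).symm) (fun _ _ => rfl) he.vars e.reads_true)
  refine ⟨s', _, e', le_rfl, m', fun x hx => ?_⟩
  rw [r' x (hg x hx), Ex.ev_congr hs (fun _ _ => rfl) he.vars e.reads_true]
  by_cases hxr : x = r
  · subst hxr; simp
  · simp only [Function.update_of_ne hxr]; exact hs x hx

/-- Cell `i` of array `A`, for `i < cnt`, becomes the result of starting with `init` and applying
`m` times `body`. Register `2` is `i`, register `4` the number of the step, register `6` the current
value. -/
def tabFold (A : ℕ) (cnt m init body : Ex) : Prog :=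
  .seq (setTo 3 cnt) (forLoop 2 3 (.seq (setTo 5 m) (.seq (setTo 6 init)
    (.seq (forLoop 4 5 (setTo 6 body)) (.store A 2 6)))))

/-- The environment of the body of a `tabFold`. -/
def loopEnv (ρ : ℕ → ℕ) (i j a : ℕ) : ℕ → ℕ :=
  Function.update (Function.update (Function.update ρ 2 i) 4 j) 6 a

/-- Global registers and the index of the outer loop. -/
def Glob₂ (r : ℕ) : Prop := Glob r ∨ r = 2

/-- Global registers and the registers of the body of a `tabFold`. -/
def Glob₆ (r : ℕ) : Prop := Glob r ∨ r = 2 ∨ r = 4 ∨ r = 6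

/-- Inside a loop the state agrees with `ρ` and `μ` only on some registers and arrays: one array is
being filled. Agreement on what the expression uses suffices. -/
theorem exec_setTo_of_agree {w M D r : ℕ} {e : Ex} {S S' : ℕ → Prop} {ρ : ℕ → ℕ}
    {μ : ℕ → ℕ → ℕ} {s : State} (hR : Room w M D ρ μ) (he : e.Good M D S) (hr : r < 30)
    (hS : ∀ x, S x → x < 30 ∧ s.reg x = ρ x) (hS' : ∀ A, S' A → s.mem A = μ A)
    (hrd : e.Reads S') :
    ∃ s', Exec w (setTo r e) s s' (e.cost + 1) ∧ s'.mem = s.mem ∧ s'.reg r = e.ev ρ μ ∧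
      ∀ x < 30, x ≠ r → s'.reg x = s.reg x := by
  obtain ⟨s', e', m', r'⟩ := exec_setTo (r := r) (s := s) (he.vars.mono fun x hx => (hS x hx).1)
    ((he.fits hR).congr (fun x hx => (hS x hx).2.symm) (fun A hA => (hS' A hA).symm) he.vars hrd)
  refine ⟨s', e', m', ?_, fun x hx hxr => ?_⟩
  · rw [r' r hr, Function.update_self]
    exact Ex.ev_congr (fun x hx => (hS x hx).2) hS' he.vars hrd
  · rw [r' x hx, Function.update_of_ne hxr]

/-- After `j` rounds the cells below `j` are final and the others untouched. Since the expressions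
in the loop do not read array `A`, they can be evaluated in the original memory `μ` throughout. -/
theorem runs_tabFold {w M D A : ℕ} {cnt m init body : Ex} {ρ : ℕ → ℕ} {μ : ℕ → ℕ → ℕ}
    (hR : Room w M D ρ μ) (val : ℕ → ℕ → ℕ) (mm : ℕ → ℕ) (c mb : ℕ)
    (gcnt : cnt.Good M D Glob) (gm : m.Good M D Glob₂) (ginit : init.Good M D Glob₂)
    (gbody : body.Good M D Glob₆) (rm : m.Reads (· ≠ A)) (rinit : init.Reads (· ≠ A))
    (rbody : body.Reads (· ≠ A)) (hcnt : cnt.ev ρ μ = c) (hcM : c ≤ M)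
    (hm : ∀ i < c, m.ev (Function.update ρ 2 i) μ = mm i) (hmb : ∀ i < c, mm i ≤ mb)
    (hmM : ∀ i < c, mm i ≤ M)
    (h0 : ∀ i < c, init.ev (Function.update ρ 2 i) μ = val i 0)
    (hs : ∀ i < c, ∀ j < mm i, body.ev (loopEnv ρ i j (val i j)) μ = val i (j + 1))
    (hv : ∀ i < c, ∀ j ≤ mm i, val i j ≤ M) :
    Runs w (tabFold A cnt m init body)
      (c * (mb * (body.cost + 5) + m.cost + init.cost + 10) + cnt.cost + 10) (St ρ μ)
      (St ρ (Function.update μ A fun x => if x < c then val x (mm x) else μ A x)) := by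
  rintro s ⟨hmem, hreg⟩
  have hM2 := hR.two_le
  have hMw := hR.lt
  have g30 : ∀ r, Glob r → r < 30 := by unfold Glob; omega
  obtain ⟨s₁, e₁, m₁, v₁, r₁⟩ := exec_setTo_of_agree (r := 3) (s := s) hR gcnt (by norm_num)
    (fun x hx => ⟨g30 x hx, hreg x hx⟩) (fun A _ => by rw [hmem]) cnt.reads_true
  set mu : ℕ → ℕ → ℕ → ℕ := fun j => Function.update μ A
    fun x => if x < j then val x (mm x) else μ A x with hmu
  have hmuA : ∀ j B, B ≠ A → mu j B = μ B := fun j B hB => by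
    simp only [hmu]; exact Function.update_of_ne hB _ _
  have hg3 : ∀ r, Glob r → r ≠ 2 ∧ r ≠ 3 ∧ r ≠ 4 ∧ r ≠ 5 ∧ r ≠ 6 := by unfold Glob; omega
  obtain ⟨s₂, t₂, e₂, ht₂, I₂⟩ := exec_forLoop (w := w) (i := 2) (n := 3) (c := c)
    (T := mb * (body.cost + 5) + m.cost + init.cost + 6)
    (body := .seq (setTo 5 m) (.seq (setTo 6 init)
      (.seq (forLoop 4 5 (setTo 6 body)) (.store A 2 6))))
    (by norm_num) (by norm_num) (by norm_num) (by omega) (by omega) (fun j s => St ρ (mu j) s)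
    (by
      rintro j s s' ⟨h1, h2⟩ hm' hr'
      exact ⟨by rw [hm', h1], fun r hr => by rw [hr' r (g30 r hr) (hg3 r hr).1, h2 r hr]⟩)
    (by
      rintro j hj s ⟨hmj, hgj⟩ h2 h3
      have hRj : Room w M D (Function.update ρ 2 j) μ := hR.update (by omega)
      have hag : ∀ x, Glob₂ x → x < 30 ∧ s.reg x = Function.update ρ 2 j x := by
        rintro x (hx | rfl)
        · rw [Function.update_of_ne (hg3 x hx).1]; exact ⟨g30 x hx, hgj x hx⟩
        · simp [h2]
      obtain ⟨u₁, f₁, n₁, w₁, q₁⟩ := exec_setTo_of_agree (r := 5) (s := s) (S' := (· ≠ A)) hRj gm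
        (by norm_num) hag (fun B hB => by rw [hmj, hmuA j B hB]) rm
      obtain ⟨u₂, f₂, n₂, w₂, q₂⟩ := exec_setTo_of_agree (r := 6) (s := u₁) (S' := (· ≠ A)) hRj
        ginit (by norm_num)
        (fun x hx => ⟨(hag x hx).1, by
          rw [q₁ x (hag x hx).1 (by rcases hx with hx | rfl; exacts [(hg3 x hx).2.2.2.1, by norm_num])]
          exact (hag x hx).2⟩)
        (fun B hB => by rw [n₁, hmj, hmuA j B hB]) rinit
      rw [hm j hj] at w₁
      rw [h0 j hj] at w₂
      obtain ⟨u₃, t₃, f₃, ht₃, I₃⟩ := exec_forLoop (w := w) (i := 4) (n := 5) (c := mm j)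
        (T := body.cost + 1) (body := setTo 6 body) (by norm_num) (by norm_num) (by norm_num)
        (by have := hmM j hj; omega) (by omega)
        (fun l s => St ρ (mu j) s ∧ s.reg 2 = j ∧ s.reg 3 = c ∧ s.reg 6 = val j l)
        (by
          rintro l s s' ⟨⟨h1, h2⟩, h3, h4, h5⟩ hm' hr'
          refine ⟨⟨by rw [hm', h1], fun r hr => by
            rw [hr' r (g30 r hr) (hg3 r hr).2.2.1, h2 r hr]⟩, ?_, ?_, ?_⟩
          · rw [hr' 2 (by norm_num) (by norm_num), h3]
          · rw [hr' 3 (by norm_num) (by norm_num), h4]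
          · rw [hr' 6 (by norm_num) (by norm_num), h5])
        (by
          rintro l hl s ⟨⟨h1, h2⟩, h3, h4, h5⟩ h6 h7
          have hRl : Room w M D (loopEnv ρ j l (val j l)) μ := by
            have := hmM j hj
            exact ((hR.update (by omega)).update (by omega)).update (hv j hj l hl.le)
          obtain ⟨u, f, n, v, q⟩ := exec_setTo_of_agree (r := 6) (s := s) (S' := (· ≠ A)) hRl
            gbody (by norm_num)
            (by
              rintro x (hx | rfl | rfl | rfl)
              · refine ⟨g30 x hx, ?_⟩
                obtain ⟨n2, -, n4, -, n6⟩ := hg3 x hx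
                simp only [loopEnv, Function.update_of_ne n2, Function.update_of_ne n4,
                  Function.update_of_ne n6]
                exact h2 x hx
              · simp [loopEnv, h3]
              · simp [loopEnv, h6]
              · simp [loopEnv, h5])
            (fun B hB => by rw [h1, hmuA j B hB]) rbody
          rw [hs j hj l hl] at v
          refine ⟨u, _, f, le_rfl, ⟨⟨by rw [n, h1], fun r hr => ?_⟩, ?_, ?_, v⟩, ?_, ?_⟩
          · rw [q r (g30 r hr) (hg3 r hr).2.2.2.2, h2 r hr]
          · rw [q 2 (by norm_num) (by norm_num), h3]
          · rw [q 3 (by norm_num) (by norm_num), h4]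
          · rw [q 4 (by norm_num) (by norm_num), h6]
          · rw [q 5 (by norm_num) (by norm_num), h7])
        u₂ (by rw [q₂ 5 (by norm_num) (by norm_num), w₁])
        (by
          refine ⟨⟨by rw [n₂, n₁, hmj], fun r hr => ?_⟩, ?_, ?_, w₂⟩
          · rw [q₂ r (g30 r hr) (hg3 r hr).2.2.2.2, q₁ r (g30 r hr) (hg3 r hr).2.2.2.1, hgj r hr]
          · rw [q₂ 2 (by norm_num) (by norm_num), q₁ 2 (by norm_num) (by norm_num), h2]
          · rw [q₂ 3 (by norm_num) (by norm_num), q₁ 3 (by norm_num) (by norm_num), h3])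
      obtain ⟨⟨hm₃, hg₃⟩, h₃2, h₃3, h₃6⟩ := I₃
      refine ⟨_, _, .seq f₁ (.seq f₂ (.seq f₃ (.store u₃ A 2 6))), ?_, ⟨?_, fun r hr => hg₃ r hr⟩,
        h₃2, h₃3⟩
      · have : mm j * (body.cost + 1 + 4) ≤ mb * (body.cost + 5) :=
          Nat.mul_le_mul (hmb j hj) le_rfl
        omega
      · simp only [State.setMem]
        rw [h₃2, h₃6, hm₃]
        funext B
        by_cases hB : B = A
        · subst hB
          simp only [hmu, Function.update_self]
          funext x
          by_cases hx : x = j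
          · subst hx; simp
          · rw [Function.update_of_ne hx]
            by_cases hxj : x < j
            · rw [if_pos hxj, if_pos (by omega)]
            · rw [if_neg hxj, if_neg (by omega)]
        · rw [Function.update_of_ne hB, hmuA _ _ hB, hmuA _ _ hB])
    s₁ (by rw [v₁, hcnt])
    ⟨by
      rw [m₁, hmem]
      funext B
      by_cases hB : B = A
      · subst hB; simp [hmu]
      · rw [hmuA 0 B hB],
     fun r hr => by rw [r₁ r (g30 r hr) (hg3 r hr).2.1, hreg r hr]⟩
  refine ⟨s₂, _, .seq e₁ e₂, ?_, I₂⟩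
  have : c * (mb * (body.cost + 5) + m.cost + init.cost + 6 + 4) =
    c * (mb * (body.cost + 5) + m.cost + init.cost + 10) := by ring
  omega

/-! ### Emitting edges -/

/-- A loop that appends edges to the list that is stored in arrays `o + 1` and `o + 2` and has its
length in register `7`. -/
structure Fam where
  cnt : Ex
  flag : Ex
  src : Ex
  dst : Ex

/-- The code of a family of edges. -/
def Fam.prog (o : ℕ) (F : Fam) : Prog :=
  .seq (setTo 3 F.cnt) (forLoop 2 3 (.seq (setTo 6 F.flag) (.cond 6
    (.seq (setTo 6 F.src) (.seq (.store (o + 1) 7 6) (.seq (setTo 6 F.dst)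
      (.seq (.store (o + 2) 7 6) (.seq (.const 30 1) (.op .add 7 7 30))))))
    .skip)))

/-- The pairs that a family of edges appends. -/
def Fam.list (ρ : ℕ → ℕ) (μ : ℕ → ℕ → ℕ) (F : Fam) : List (ℕ × ℕ) :=
  ((List.range (F.cnt.ev ρ μ)).filter fun i => F.flag.ev (Function.update ρ 2 i) μ ≠ 0).map
    fun i => (F.src.ev (Function.update ρ 2 i) μ, F.dst.ev (Function.update ρ 2 i) μ)

/-- The memory after the list `L` has been written to the output arrays. -/
def outMem (o : ℕ) (μ : ℕ → ℕ → ℕ) (L : List (ℕ × ℕ)) : ℕ → ℕ → ℕ := fun A x =>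
  if A = o + 1 then (L.getD x (0, 0)).1 else if A = o + 2 then (L.getD x (0, 0)).2 else μ A x

/-- The registers that a family of edges may use. -/
def GlobE (r : ℕ) : Prop := r < 3 ∨ 8 ≤ r ∧ r < 30

/-- A family of edges fits into words with room for monomials of degree `D`. -/
structure Fam.Good (F : Fam) (o M D : ℕ) : Prop where
  cnt : F.cnt.Good M D fun r => Glob r ∧ r ≠ 7
  flag : F.flag.Good M D GlobE
  src : F.src.Good M D GlobE
  dst : F.dst.Good M D GlobE
  cnt_reads : F.cnt.Reads fun A => A ≠ o + 1 ∧ A ≠ o + 2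
  flag_reads : F.flag.Reads fun A => A ≠ o + 1 ∧ A ≠ o + 2
  src_reads : F.src.Reads fun A => A ≠ o + 1 ∧ A ≠ o + 2
  dst_reads : F.dst.Reads fun A => A ≠ o + 1 ∧ A ≠ o + 2

end WordRAM


namespace WordRAM

/-- The arrays are `μ` plus the list `L` in the output arrays, register `7` is the length of `L`,
and the other global registers are `ρ`. -/
def StE (o : ℕ) (ρ : ℕ → ℕ) (μ : ℕ → ℕ → ℕ) (L : List (ℕ × ℕ)) (s : State) : Prop :=
  s.mem = outMem o μ L ∧ (∀ r, Glob r ∧ r ≠ 7 → s.reg r = ρ r) ∧ s.reg 7 = L.length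

theorem outMem_of_ne {o : ℕ} {μ : ℕ → ℕ → ℕ} {L : List (ℕ × ℕ)} {A : ℕ}
    (h : A ≠ o + 1 ∧ A ≠ o + 2) : outMem o μ L A = μ A := by
  funext x; simp [outMem, h.1, h.2]

theorem getD_snoc (L : List (ℕ × ℕ)) (p : ℕ × ℕ) (x : ℕ) :
    (L ++ [p]).getD x (0, 0) = if x = L.length then p else L.getD x (0, 0) := by
  rcases lt_trichotomy x L.length with h | h | h
  · rw [if_neg h.ne, List.getD_append _ _ _ _ h]
  · subst h; simp
  · rw [if_neg h.ne', List.getD_eq_default _ _ (by simp; omega), List.getD_eq_default _ _ h.le]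

theorem outMem_snoc (o : ℕ) (μ : ℕ → ℕ → ℕ) (L : List (ℕ × ℕ)) (p : ℕ × ℕ) (m : ℕ → ℕ → ℕ)
    (hm : m = Function.update (outMem o μ L) (o + 1)
      (Function.update (outMem o μ L (o + 1)) L.length p.1)) :
    Function.update m (o + 2) (Function.update (m (o + 2)) L.length p.2) =
      outMem o μ (L ++ [p]) := by
  subst hm
  funext A x
  by_cases h1 : A = o + 1
  · subst h1
    rw [Function.update_of_ne (by omega), Function.update_self]
    simp only [outMem, if_true, getD_snoc, Function.update_apply]
    split_ifs <;> rfl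
  · by_cases h2 : A = o + 2
    · subst h2
      rw [Function.update_self, Function.update_of_ne h1]
      simp only [outMem, if_neg h1, if_true, getD_snoc, Function.update_apply]
      split_ifs <;> rfl
    · rw [Function.update_of_ne h2, Function.update_of_ne h1, outMem_of_ne ⟨h1, h2⟩,
        outMem_of_ne ⟨h1, h2⟩]

/-- After `j` rounds the list has grown by the pairs with index below `j`. Register `7` is the write
position, and so is not among the registers that the expressions may use. -/
theorem Fam.runs_prog {w M D o : ℕ} {F : Fam} {ρ : ℕ → ℕ} {μ : ℕ → ℕ → ℕ} {L : List (ℕ × ℕ)}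
    (hR : Room w M D ρ μ) (hF : F.Good o M D) (hL : L.length + F.cnt.ev ρ μ ≤ M) :
    Runs w (F.prog o)
      (F.cnt.ev ρ μ * (F.flag.cost + F.src.cost + F.dst.cost + 15) + F.cnt.cost + 10)
      (StE o ρ μ L) (StE o ρ μ (L ++ F.list ρ μ)) := by
  rintro s ⟨hmem, hreg, h7⟩
  have hM2 := hR.two_le
  have hMw := hR.lt
  set c := F.cnt.ev ρ μ with hc
  have g30 : ∀ r, Glob r → r < 30 := by unfold Glob; omega
  have hg3 : ∀ r, Glob r → r ≠ 2 ∧ r ≠ 3 ∧ r ≠ 4 ∧ r ≠ 5 ∧ r ≠ 6 := by unfold Glob; omega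
  obtain ⟨s₁, e₁, m₁, v₁, r₁⟩ := exec_setTo_of_agree (r := 3) (s := s) hR hF.cnt (by norm_num)
    (fun x hx => ⟨g30 x hx.1, hreg x hx⟩) (fun A hA => by rw [hmem, outMem_of_ne hA]) hF.cnt_reads
  set fl : ℕ → ℕ := fun i => F.flag.ev (Function.update ρ 2 i) μ with hfl
  set pr : ℕ → ℕ × ℕ := fun i =>
    (F.src.ev (Function.update ρ 2 i) μ, F.dst.ev (Function.update ρ 2 i) μ) with hpr
  set Lj : ℕ → List (ℕ × ℕ) := fun j => L ++ ((List.range j).filter fun i => fl i ≠ 0).map pr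
    with hLj
  have hlen : ∀ j, (Lj j).length ≤ L.length + j := by
    intro j
    have := List.length_filter_le (fun i => decide (fl i ≠ 0)) (List.range j)
    simp only [List.length_range] at this
    simp only [hLj, List.length_append, List.length_map]
    omega
  obtain ⟨s₂, t₂, e₂, ht₂, I₂⟩ := exec_forLoop (w := w) (i := 2) (n := 3) (c := c)
    (T := F.flag.cost + F.src.cost + F.dst.cost + 11)
    (body := .seq (setTo 6 F.flag) (.cond 6
      (.seq (setTo 6 F.src) (.seq (.store (o + 1) 7 6) (.seq (setTo 6 F.dst)
        (.seq (.store (o + 2) 7 6) (.seq (.const 30 1) (.op .add 7 7 30))))))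
      .skip))
    (by norm_num) (by norm_num) (by norm_num) (by omega) (by omega)
    (fun j s => StE o ρ μ (Lj j) s)
    (by
      rintro j s s' ⟨h1, h2, h3⟩ hm' hr'
      exact ⟨by rw [hm', h1], fun r hr => by
        rw [hr' r (g30 r hr.1) (hg3 r hr.1).1, h2 r hr], by
        rw [hr' 7 (by norm_num) (by norm_num), h3]⟩)
    (by
      rintro j hj s ⟨hmj, hgj, h7j⟩ h2 h3
      have hRj : Room w M D (Function.update ρ 2 j) μ := hR.update (by omega)
      have hag : ∀ x, GlobE x → x < 30 ∧ s.reg x = Function.update ρ 2 j x := by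
        intro x hx
        by_cases hx2 : x = 2
        · subst hx2; simp [h2]
        · rw [Function.update_of_ne hx2]
          have : Glob x ∧ x ≠ 7 := by unfold Glob; unfold GlobE at hx; omega
          exact ⟨g30 x this.1, hgj x this⟩
      have hE6 : ∀ x, GlobE x → x ≠ 6 := by unfold GlobE; omega
      obtain ⟨u₁, f₁, n₁, w₁, q₁⟩ := exec_setTo_of_agree (r := 6) (s := s)
        (S' := fun A => A ≠ o + 1 ∧ A ≠ o + 2) hRj hF.flag
        (by norm_num) hag (fun B hB => by rw [hmj, outMem_of_ne hB]) hF.flag_reads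
      have hw1 : u₁.reg 6 = fl j := w₁
      by_cases hz : fl j = 0
      · refine ⟨u₁, _, .seq f₁ (.cond_false (by rw [hw1, hz]) (.skip u₁)), by omega, ?_, ?_, ?_⟩
        · have : Lj (j + 1) = Lj j := by
            simp [hLj, List.range_succ, List.filter_append, hz]
          rw [this]
          refine ⟨by rw [n₁, hmj], fun r hr => ?_, ?_⟩
          · rw [q₁ r (g30 r hr.1) (hg3 r hr.1).2.2.2.2, hgj r hr]
          · rw [q₁ 7 (by norm_num) (by norm_num), h7j]
        · rw [q₁ 2 (by norm_num) (by norm_num), h2]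
        · rw [q₁ 3 (by norm_num) (by norm_num), h3]
      · obtain ⟨u₂, f₂, n₂, w₂, q₂⟩ := exec_setTo_of_agree (r := 6) (s := u₁)
          (S' := fun A => A ≠ o + 1 ∧ A ≠ o + 2) hRj hF.src (by norm_num)
          (fun x hx => ⟨(hag x hx).1, by rw [q₁ x (hag x hx).1 (hE6 x hx), (hag x hx).2]⟩)
          (fun B hB => by rw [n₁, hmj, outMem_of_ne hB]) hF.src_reads
        have hr2 : ∀ x < 30, x ≠ 6 → u₂.reg x = s.reg x := fun x hx hx6 => by
          rw [q₂ x hx hx6, q₁ x hx hx6]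
        have f₃ : Exec w (.store (o + 1) 7 6) u₂ _ 1 := .store u₂ (o + 1) 7 6
        set u₃ := u₂.setMem (o + 1) (u₂.reg 7) (u₂.reg 6) with hu₃
        have n₃ : u₃.mem = Function.update (outMem o μ (Lj j)) (o + 1)
            (Function.update (outMem o μ (Lj j) (o + 1)) (Lj j).length (pr j).1) := by
          simp only [hu₃, State.setMem, n₂, n₁, hmj, w₂, hr2 7 (by norm_num) (by norm_num), h7j]
          rfl
        obtain ⟨u₄, f₄, n₄, w₄, q₄⟩ := exec_setTo_of_agree (r := 6) (s := u₃)
          (S' := fun A => A ≠ o + 1 ∧ A ≠ o + 2) hRj hF.dst (by norm_num)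
          (fun x hx => ⟨(hag x hx).1, by
            rw [show u₃.reg x = u₂.reg x from rfl, hr2 x (hag x hx).1 (hE6 x hx), (hag x hx).2]⟩)
          (fun B hB => by rw [n₃, Function.update_of_ne hB.1, outMem_of_ne hB]) hF.dst_reads
        have hr4 : ∀ x < 30, x ≠ 6 → u₄.reg x = s.reg x := fun x hx hx6 => by
          rw [q₄ x hx hx6, show u₃.reg x = u₂.reg x from rfl, hr2 x hx hx6]
        have f₅ : Exec w (.store (o + 2) 7 6) u₄ _ 1 := .store u₄ (o + 2) 7 6
        set u₅ := u₄.setMem (o + 2) (u₄.reg 7) (u₄.reg 6) with hu₅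
        have n₅ : u₅.mem = outMem o μ (Lj j ++ [pr j]) := by
          rw [← outMem_snoc o μ (Lj j) (pr j) u₃.mem n₃]
          simp only [hu₅, State.setMem, n₄, w₄, hr4 7 (by norm_num) (by norm_num), h7j]
          rfl
        have f₆ : Exec w (.const 30 1) u₅ _ 1 := .const u₅ 30 1 (by omega)
        set u₆ := u₅.setReg 30 1 with hu₆
        have h67 : u₆.reg 7 = (Lj j).length := by
          rw [← h7j, ← hr4 7 (by norm_num) (by norm_num)]
          simp only [hu₆, State.setReg]; rw [Function.update_of_ne (by norm_num)]; rfl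
        have h630 : u₆.reg 30 = 1 := by simp [hu₆, State.setReg]
        have f₇ : Exec w (.op .add 7 7 30) u₆ _ 1 := .op u₆ .add 7 7 30 (by
          rw [h67, h630]; simp only [BinOp.eval]; have := hlen j; omega)
        set u₇ := u₆.setReg 7 (BinOp.add.eval (u₆.reg 7) (u₆.reg 30)) with hu₇
        have hr7 : ∀ x < 30, x ≠ 6 → x ≠ 7 → u₇.reg x = s.reg x := fun x hx hx6 hx7 => by
          rw [← hr4 x hx hx6]
          simp only [hu₇, hu₆, State.setReg]
          rw [Function.update_of_ne hx7, Function.update_of_ne (by omega)]; rfl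
        have hL' : Lj (j + 1) = Lj j ++ [pr j] := by
          simp [hLj, List.range_succ, List.filter_append, hz]
        refine ⟨u₇, _, .seq f₁ (.cond_true (by rw [hw1]; exact hz)
          (.seq f₂ (.seq f₃ (.seq f₄ (.seq f₅ (.seq f₆ f₇)))))), by omega, ⟨?_, ?_, ?_⟩, ?_, ?_⟩
        · rw [hL']; exact n₅
        · intro r hr
          rw [hr7 r (g30 r hr.1) (hg3 r hr.1).2.2.2.2 hr.2, hgj r hr]
        · rw [hL']; simp [hu₇, State.setReg, h67, h630, BinOp.eval]
        · rw [hr7 2 (by norm_num) (by norm_num) (by norm_num), h2]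
        · rw [hr7 3 (by norm_num) (by norm_num) (by norm_num), h3])
    s₁ v₁ (by
      refine ⟨by rw [m₁, hmem]; simp [hLj], fun r hr => ?_, ?_⟩
      · rw [r₁ r (g30 r hr.1) (hg3 r hr.1).2.1, hreg r hr]
      · rw [r₁ 7 (by norm_num) (by norm_num), h7]; simp [hLj])
  refine ⟨s₂, _, .seq e₁ e₂, ?_, I₂⟩
  have : c * (F.flag.cost + F.src.cost + F.dst.cost + 11 + 4) =
    c * (F.flag.cost + F.src.cost + F.dst.cost + 15) := by ring
  omega

/-- The code of a list of families of edges. -/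
def famsProg (o : ℕ) : List Fam → Prog
  | [] => .skip
  | F :: Fs => .seq (F.prog o) (famsProg o Fs)

theorem runs_famsProg {w M D o κ cb : ℕ} {ρ : ℕ → ℕ} {μ : ℕ → ℕ → ℕ} (hR : Room w M D ρ μ) :
    ∀ (Fs : List Fam) (L : List (ℕ × ℕ)), (∀ F ∈ Fs, F.Good o M D ∧ F.cnt.ev ρ μ ≤ cb ∧
      F.flag.cost + F.src.cost + F.dst.cost + F.cnt.cost + 15 ≤ κ) →
      L.length + Fs.length * cb ≤ M →
      Runs w (famsProg o Fs) (Fs.length * (cb * κ + κ) + 1) (StE o ρ μ L)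
        (StE o ρ μ (L ++ Fs.flatMap fun F => F.list ρ μ))
  | [], L, _, _ => by
    intro s hs
    exact ⟨s, 1, .skip s, by simp, by simpa using hs⟩
  | F :: Fs, L, h, hL => by
    obtain ⟨h1, h2, h3⟩ := h F (by simp)
    have hlen : (F.list ρ μ).length ≤ cb := by
      rw [Fam.list, List.length_map]
      refine (List.length_filter_le _ _).trans ?_
      simpa using h2
    have hL' : (Fs.length + 1) * cb = Fs.length * cb + cb := by ring
    simp only [List.length_cons] at hL
    have r1 := Fam.runs_prog (L := L) hR h1 (by omega)
    have r2 := runs_famsProg hR (κ := κ) (cb := cb) Fs (L ++ F.list ρ μ)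
      (fun G hG => h G (List.mem_cons_of_mem _ hG)) (by simp only [List.length_append]; omega)
    have r := r1.seq r2
    simp only [List.flatMap_cons, ← List.append_assoc]
    refine r.mono ?_
    have h4 : F.cnt.ev ρ μ * (F.flag.cost + F.src.cost + F.dst.cost + 15) ≤ cb * κ :=
      Nat.mul_le_mul h2 (by omega)
    have h5 : (Fs.length + 1) * (cb * κ + κ) = Fs.length * (cb * κ + κ) + (cb * κ + κ) := by ring
    simp only [List.length_cons, h5]
    omega

end WordRAM


/-! ### Digits -/

/-- Digit `r` of `x` in base `β`. -/
def dig (β x r : ℕ) : ℕ := x / β ^ r % β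

/-- Replace digit `r` by `c`. -/
def setDigit (β x r c : ℕ) : ℕ := x % β ^ r + c * β ^ r + x / β ^ (r + 1) * β ^ (r + 1)

theorem dig_lt {β : ℕ} (hβ : 0 < β) (x r : ℕ) : dig β x r < β := Nat.mod_lt _ hβ

theorem dig_mod {β m r : ℕ} (h : r < m) (x : ℕ) : dig β (x % β ^ m) r = dig β x r := by
  obtain ⟨s, rfl⟩ := Nat.exists_eq_add_of_lt h
  unfold dig
  rw [show r + s + 1 = r + (s + 1) by ring, pow_add, Nat.mod_mul_right_div_self,
    Nat.mod_mod_of_dvd _ (dvd_pow_self β (by omega))]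

theorem dig_div_pow (β x m r : ℕ) : dig β (x / β ^ m) r = dig β x (m + r) := by
  unfold dig; rw [Nat.div_div_eq_div_mul, ← pow_add]

theorem dig_div (β x r : ℕ) : dig β (x / β) r = dig β x (r + 1) := by
  have := dig_div_pow β x 1 r
  rwa [pow_one, add_comm] at this

theorem setDigit_mod (β x r c : ℕ) : setDigit β x r c % β ^ r = x % β ^ r := by
  unfold setDigit
  rw [show x % β ^ r + c * β ^ r + x / β ^ (r + 1) * β ^ (r + 1) =
    x % β ^ r + β ^ r * (c + x / β ^ (r + 1) * β) by ring, Nat.add_mul_mod_self_left, Nat.mod_mod]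

theorem setDigit_div {β : ℕ} (hβ : 0 < β) (x r c : ℕ) :
    setDigit β x r c / β ^ r = c + x / β ^ (r + 1) * β := by
  have hp : 0 < β ^ r := Nat.pow_pos hβ
  unfold setDigit
  rw [show x % β ^ r + c * β ^ r + x / β ^ (r + 1) * β ^ (r + 1) =
    x % β ^ r + β ^ r * (c + x / β ^ (r + 1) * β) by ring, Nat.add_mul_div_left _ _ hp,
    Nat.div_eq_of_lt (Nat.mod_lt _ hp), zero_add]

theorem setDigit_div_succ {β : ℕ} {c : ℕ} (hc : c < β) (x r : ℕ) :
    setDigit β x r c / β ^ (r + 1) = x / β ^ (r + 1) := by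
  have hβ : 0 < β := by omega
  rw [pow_succ, ← Nat.div_div_eq_div_mul, setDigit_div hβ, Nat.add_mul_div_right _ _ hβ,
    Nat.div_eq_of_lt hc, zero_add, pow_succ]

theorem dig_setDigit {β c : ℕ} (hc : c < β) (x r s : ℕ) :
    dig β (setDigit β x r c) s = if s = r then c else dig β x s := by
  have hβ : 0 < β := by omega
  rcases lt_trichotomy s r with h | h | h
  · rw [if_neg h.ne, ← dig_mod h, setDigit_mod, dig_mod h]
  · subst h
    rw [if_pos rfl, dig, setDigit_div hβ, Nat.add_mul_mod_self_right, Nat.mod_eq_of_lt hc]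
  · obtain ⟨m, rfl⟩ := Nat.exists_eq_add_of_lt h
    rw [if_neg h.ne', show r + m + 1 = r + 1 + m by ring, ← dig_div_pow, ← dig_div_pow,
      setDigit_div_succ hc]

theorem setDigit_lt {β c m r x : ℕ} (hc : c < β) (hr : r < m) (hx : x < β ^ m) :
    setDigit β x r c < β ^ m := by
  have hβ : 0 < β := by omega
  obtain ⟨s, rfl⟩ := Nat.exists_eq_add_of_lt hr
  have hm : β ^ (r + s + 1) = β ^ s * β ^ (r + 1) := by rw [← pow_add]; congr 1; ring
  rw [hm] at hx ⊢
  rw [← Nat.div_lt_iff_lt_mul (Nat.pow_pos hβ)] at hx ⊢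
  rwa [setDigit_div_succ hc]

theorem eq_of_dig_eq {β : ℕ} : ∀ {m x y : ℕ}, x < β ^ m → y < β ^ m →
    (∀ r < m, dig β x r = dig β y r) → x = y
  | 0, x, y, hx, hy, _ => by simp at hx hy; omega
  | m + 1, x, y, hx, hy, h => by
    rcases Nat.eq_zero_or_pos β with rfl | hβ
    · simp at hx
    have h0 := h 0 (by omega)
    simp only [dig, pow_zero, Nat.div_one] at h0
    have := eq_of_dig_eq (β := β) (m := m) (x := x / β) (y := y / β)
      (by rw [Nat.div_lt_iff_lt_mul hβ, ← pow_succ]; exact hx)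
      (by rw [Nat.div_lt_iff_lt_mul hβ, ← pow_succ]; exact hy)
      (fun r hr => by rw [dig_div, dig_div]; exact h (r + 1) (by omega))
    rw [← Nat.div_add_mod x β, ← Nat.div_add_mod y β, h0, this]

/-- With `eq_of_dig_eq`: numbers below `β ^ m` are the same as `m`-tuples. Tuples are defined below
by prescribing their digits. -/
theorem exists_dig_eq {β : ℕ} : ∀ (m : ℕ) (f : ℕ → ℕ), (∀ r < m, f r < β) →
    ∃ x < β ^ m, ∀ r < m, dig β x r = f r
  | 0, _, _ => ⟨0, by simp, by simp⟩
  | m + 1, f, hf => by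
    obtain ⟨x, hx, h⟩ := exists_dig_eq m (fun r => f (r + 1)) fun r hr => hf _ (by omega)
    have h0 := hf 0 (by omega)
    have hβ : 0 < β := by omega
    refine ⟨f 0 + x * β, ?_, fun r hr => ?_⟩
    · have h2 : (x + 1) * β ≤ β ^ m * β := Nat.mul_le_mul_right _ hx
      rw [pow_succ]
      linarith
    · cases r with
      | zero => simp [dig, Nat.mod_eq_of_lt h0]
      | succ r =>
        rw [← dig_div, Nat.add_mul_div_right _ _ hβ, Nat.div_eq_of_lt h0, zero_add]
        exact h r (by omega)

/-! ### Walks in a relation -/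

/-- `RelWalk r m u v`: there is a walk with `m` steps from `u` to `v`. -/
inductive RelWalk {V : Type*} (r : V → V → Prop) : ℕ → V → V → Prop
  | nil (u : V) : RelWalk r 0 u u
  | cons {m : ℕ} {u v x : V} (h : r u v) (p : RelWalk r m v x) : RelWalk r (m + 1) u x

theorem RelWalk.append {V : Type*} {r : V → V → Prop} {m m' : ℕ} {u v x : V}
    (h : RelWalk r m u v) (h' : RelWalk r m' v x) : RelWalk r (m + m') u x := by
  induction h with
  | nil u => simpa using h'
  | cons h _ ih => rw [Nat.succ_add]; exact .cons h (ih h')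

/-- `v` can be reached from `u` by a walk with at most `m` steps. -/
def Within {V : Type*} (r : V → V → Prop) (m : ℕ) (u v : V) : Prop := ∃ m' ≤ m, RelWalk r m' u v

theorem Within.refl {V : Type*} {r : V → V → Prop} (m : ℕ) (u : V) : Within r m u u :=
  ⟨0, Nat.zero_le _, .nil u⟩

theorem Within.single {V : Type*} {r : V → V → Prop} {u v : V} (h : r u v) : Within r 1 u v :=
  ⟨1, le_rfl, .cons h (.nil v)⟩

theorem Within.mono {V : Type*} {r : V → V → Prop} {m m' : ℕ} {u v : V} (h : Within r m u v)
    (hm : m ≤ m') : Within r m' u v := by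
  obtain ⟨l, hl, h⟩ := h
  exact ⟨l, hl.trans hm, h⟩

theorem Within.trans {V : Type*} {r : V → V → Prop} {m m' : ℕ} {u v x : V} (h : Within r m u v)
    (h' : Within r m' v x) : Within r (m + m') u x := by
  obtain ⟨l, hl, h⟩ := h
  obtain ⟨l', hl', h'⟩ := h'
  exact ⟨l + l', by omega, h.append h'⟩

/-! ### The graph of an instance -/

/-- Vertices: `blk g Q` for the layers of `(k - 1)`-tuples `Q`, `mid i P X` for the inner layers of
`(k - 2)`-tuples `P` together with `k - 1` coordinates `X`, further vertices `dead e`, and two hubs.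
Tuples are given as numbers with digits in base `n + 1` and `d`. -/
inductive Vtx
  | blk (g Q : ℕ)
  | mid (i P X : ℕ)
  | dead (e : ℕ)
  | h1
  | h2

namespace OVInstance

variable {k n d : ℕ} (I : OVInstance k n d) (dd : ℕ → Prop)

/-- Coordinate `x` of vector `a` of set `l` is `1`, where vector `n` is the all-ones vector. -/
def Wok (l a x : ℕ) : Prop := a = n ∨ I.bit l a x = 1

/-- In layer `i`, digit `r` of `P` is a vector of set `r` if `r + i ≤ k - 2`, and of set `r + 2`
otherwise. Coordinate `j` has to be `1` in the vectors of the sets up to `j` of the first kind and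
of the sets above `j` of the second kind. -/
def Valid (i P X : ℕ) : Prop :=
  ∀ r < k - 2, ∀ j < k - 1,
    (r + i ≤ k - 2 → r ≤ j → I.Wok r (dig (n + 1) P r) (dig d X j)) ∧
    (k - 2 < r + i → j < r + 2 → I.Wok (r + 2) (dig (n + 1) P r) (dig d X j))

/-- The vertices of the graph; the further vertices are those with `dd`. -/
def InG : Vtx → Prop
  | .blk g Q => g < 2 * (k - 1) ∧ Q < (n + 1) ^ (k - 1)
  | .mid i P X => 1 ≤ i ∧ i ≤ k - 1 ∧ P < (n + 1) ^ (k - 2) ∧ X < d ^ (k - 1) ∧ I.Valid i P X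
  | .dead e => dd e
  | .h1 => True
  | .h2 => True

/-- The shapes of the arcs. -/
inductive Arc₀ : Vtx → Vtx → Prop
  | chain (g Q : ℕ) (h : g ≠ k - 2) : Arc₀ (.blk g Q) (.blk (g + 1) Q)
  -- The three outermost layers at either end are attached to a hub. For `k = 3` each half has only
  -- two layers, and the adjacent inner layer serves as the third (`lowMid`, `midH1`).
  | low (g Q : ℕ) (h : g ≤ 2) (h' : g ≤ k - 2) : Arc₀ .h2 (.blk g Q)
  | high (g Q : ℕ) (h : k - 1 ≤ g) (h' : 2 * (k - 1) ≤ g + 3) : Arc₀ (.blk g Q) .h1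
  | deadIn (e : ℕ) : Arc₀ .h2 (.dead e)
  -- Into layer `1`, not `0`: from there all distances are at most `3k - 5` in the unsolvable case.
  | deadOut (e : ℕ) : Arc₀ (.dead e) (.blk 1 0)
  | lowMid (P X : ℕ) (h : k = 3) : Arc₀ .h2 (.mid 1 P X)
  | midH2 (P X : ℕ) : Arc₀ (.mid (k - 1) P X) .h2
  | midH1 (P X : ℕ) (h : k = 3) : Arc₀ (.mid (k - 1) P X) .h1
  | h1Mid (P X : ℕ) : Arc₀ .h1 (.mid 1 P X)
  -- The vector of set `k - 2` is dropped here, and the only coordinate `j < k - 1` with `k - 2 ≤ j`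
  -- is `k - 2`, so one bit is tested. Likewise set `1` concerns only coordinate `0` at the other
  -- end.
  | sDown (Q X : ℕ) (h : I.Wok (k - 2) (dig (n + 1) Q (k - 2)) (dig d X (k - 2))) :
      Arc₀ (.blk (k - 2) Q) (.mid 1 (Q % (n + 1) ^ (k - 2)) X)
  | sUp (Q X : ℕ) (h : I.Wok (k - 2) (dig (n + 1) Q (k - 2)) (dig d X (k - 2))) :
      Arc₀ (.mid 1 (Q % (n + 1) ^ (k - 2)) X) (.blk (k - 2) Q)
  | mDown (i P X c : ℕ) (hi : i ≤ k - 2) (hc : c ≤ n) :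
      Arc₀ (.mid i P X) (.mid (i + 1) (setDigit (n + 1) P (k - 2 - i) c) X)
  | mUp (i P X c : ℕ) (hi : i ≤ k - 2) (hc : c ≤ n) :
      Arc₀ (.mid (i + 1) (setDigit (n + 1) P (k - 2 - i) c) X) (.mid i P X)
  | tDown (Q X : ℕ) (h : I.Wok 1 (dig (n + 1) Q 0) (dig d X 0)) :
      Arc₀ (.mid (k - 1) (Q / (n + 1)) X) (.blk (k - 1) Q)
  | tUp (Q X : ℕ) (h : I.Wok 1 (dig (n + 1) Q 0) (dig d X 0)) :
      Arc₀ (.blk (k - 1) Q) (.mid (k - 1) (Q / (n + 1)) X)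

/-- The arcs of the graph. -/
def Arc (u v : Vtx) : Prop := I.InG dd u ∧ I.InG dd v ∧ I.Arc₀ u v

/-! #### Long distances for solvable instances -/

/-- A lower bound for the distance from the first layer. -/
def level (k : ℕ) : Vtx → ℕ
  | .blk g _ => if g ≤ k - 2 then g else g + (k - 1)
  | .mid i _ _ => k - 2 + i
  | .dead _ => 0
  -- `h1` is entered from levels `≥ 3k - 6`, and `h2` from the last inner layer, of level `2k - 3`.
  -- Together with the values of `colevel`, both hubs get the sum `5k - 7`.
  | .h1 => 3 * k - 5
  | .h2 => 2 * k - 2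

/-- A lower bound for the distance to the last layer. -/
def colevel (k : ℕ) : Vtx → ℕ
  | .h1 => 2 * k - 2
  | .h2 => 3 * k - 5
  | v => 3 * k - 4 - level k v

variable {I dd}

theorem level_le_of_arc (hk : 3 ≤ k) {u v : Vtx} (h : I.Arc dd u v) :
    level k v ≤ level k u + 1 := by
  obtain ⟨hu, hv, h⟩ := h
  cases h <;> simp only [level, InG] at * <;> (try split_ifs) <;> omega

theorem colevel_le_of_arc (hk : 3 ≤ k) {u v : Vtx} (h : I.Arc dd u v) :
    colevel k u ≤ colevel k v + 1 := by
  obtain ⟨hu, hv, h⟩ := h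
  cases h <;> simp only [colevel, level, InG] at * <;> (try split_ifs) <;> omega

theorem colevel_le_of_walk (hk : 3 ≤ k) {m : ℕ} {u v : Vtx} (h : RelWalk (I.Arc dd) m u v) :
    colevel k u ≤ colevel k v + m := by
  induction h with
  | nil u => omega
  | cons h _ ih => have := colevel_le_of_arc hk h; omega

/-- What is known about a vertex from which a walk without hubs of length `m` leads to the vertex
`t` of the last layer. -/
def Suffix (k n t m : ℕ) (v : Vtx) : Prop :=
  ∃ p, m = colevel k v + 2 * p ∧
    match v with
    | .blk g Q => k - 1 ≤ g → ∀ l < k - 1, p ≤ l → dig (n + 1) Q l = dig (n + 1) t l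
    | .mid i P _ => ∀ r < k - 2, p + k ≤ r + i + 1 → dig (n + 1) P r = dig (n + 1) t (r + 1)
    | .dead _ => True
    | _ => False

end OVInstance


/-! ### Counting backward steps along a short walk -/

namespace OVInstance

variable {k n d : ℕ} {I : OVInstance k n d} {dd : ℕ → Prop}

/-- Induction from the end of the walk. At the hubs `level` and `colevel` add up to `5k - 7`, so the
two bounds on `m₀` exclude them. All other arcs change `colevel` by exactly one, so `p` counts
backward steps. In inner layer `i` the digits `r ≥ p + k - 1 - i` are known. The digit `k - 2 - i`
exchanged between layers `i` and `i + 1` is always below this threshold, and a backward arc raises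
both `p` and the layer of its tail, which leaves the threshold unchanged. -/
theorem suffix_of_walk (hk : 3 ≤ k) {t m : ℕ} {u : Vtx}
    (h : RelWalk (I.Arc dd) m u (.blk (2 * (k - 1) - 1) t)) :
    ∀ m₀, level k u ≤ m₀ → m₀ + m ≤ 5 * k - 8 → Suffix k n t m u := by
  generalize he : Vtx.blk (2 * (k - 1) - 1) t = e at h
  induction h with
  | nil u =>
    subst he
    intro m₀ _ _
    refine ⟨0, ?_, fun _ l _ _ => rfl⟩
    simp only [colevel, level]
    split_ifs <;> omega
  | @cons m u v x h p ih =>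
    intro m₀ h₀ hm
    have hlev := level_le_of_arc hk h
    obtain ⟨q, hq, hv⟩ := ih he (m₀ + 1) (by omega) (by omega)
    have hco := colevel_le_of_walk hk (RelWalk.cons h p)
    have hce : colevel k x = 0 := by
      subst he; simp only [colevel, level]; split_ifs <;> omega
    clear ih p
    obtain ⟨hu, hv', h⟩ := h
    cases h with
    | chain g Q hg =>
      simp only [colevel, level, InG] at *
      refine ⟨q, ?_, fun hg' l hl hql => hv (by omega) l hl hql⟩
      split_ifs at * <;> simp only [colevel, level] <;> (try split_ifs) <;> omega
    -- An arc out of a hub makes the walk too long; for an arc into a hub, `Suffix` is already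
    -- false.
    | low g Q h h' => simp only [colevel, level] at *; omega
    | high g Q h h' => exact hv.elim
    | deadIn e => simp only [colevel, level] at *; omega
    | deadOut e =>
      refine ⟨q, ?_, trivial⟩
      simp only [colevel, level] at *
      split_ifs at * <;> omega
    | lowMid P X h => simp only [colevel, level] at *; omega
    | midH2 P X => exact hv.elim
    | midH1 P X h => exact hv.elim
    | h1Mid P X => simp only [colevel, level] at *; omega
    | sDown Q X h =>
      refine ⟨q, ?_, fun hg => by omega⟩
      simp only [colevel, level] at *
      split_ifs at * <;> omega
    | sUp Q X h =>
      refine ⟨q + 1, ?_, fun r hr hr' => by omega⟩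
      simp only [colevel, level] at *
      split_ifs at * <;> omega
    | mDown i P X c hi hc =>
      refine ⟨q, ?_, fun r hr hr' => ?_⟩
      · simp only [colevel, level] at *; omega
      · have := hv r hr (by omega)
        rwa [dig_setDigit (by omega), if_neg (by omega)] at this
    | mUp i P X c hi hc =>
      refine ⟨q + 1, ?_, fun r hr hr' => ?_⟩
      · simp only [colevel, level, InG] at *; omega
      · rw [dig_setDigit (by omega), if_neg (by omega)]
        exact hv r hr (by omega)
    | tDown Q X h =>
      refine ⟨q, ?_, fun r hr hr' => ?_⟩
      · simp only [colevel, level] at *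
        split_ifs at * <;> omega
      · rw [dig_div]
        exact hv le_rfl (r + 1) (by omega) (by omega)
    | tUp Q X h =>
      refine ⟨q + 1, ?_, fun _ l hl hl' => ?_⟩
      · simp only [colevel, level] at *
        split_ifs at * <;> omega
      · obtain ⟨r, rfl⟩ : ∃ r, l = r + 1 := ⟨l - 1, by omega⟩
        rw [← dig_div]
        exact hv r (by omega) (by omega)

/-- What is known about a vertex that is reached by a walk of length `m` from the vertex `s` of
the first layer, as long as the walk visits neither a hub nor the second half of the layers of
`(k - 1)`-tuples. -/
def Prefix (I : OVInstance k n d) (s m : ℕ) (v : Vtx) : Prop :=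
  ∃ p, m = level k v + 2 * p ∧
    match v with
    | .blk g Q => g ≤ k - 2 ∧ ∀ l < k - 1, l + p ≤ k - 2 → dig (n + 1) Q l = dig (n + 1) s l
    | .mid i P X => (∀ r < k - 2, r + i + p ≤ k - 2 → dig (n + 1) P r = dig (n + 1) s r) ∧
        ∃ p₁ ≤ p, ∀ j < k - 1, j + p₁ ≤ k - 2 → ∀ l ≤ j, I.Wok l (dig (n + 1) s l) (dig d X j)
    | _ => False

/-- Follow the walk up to its first arc into the second half, maintaining `Prefix`. At that arc,
compare what survives of `s` with what `Suffix` says about `t`. -/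
theorem no_short_walk (hk : 3 ≤ k) {s t : ℕ} {v : ℕ → ℕ} (hd : 0 < d)
    (hs : ∀ l < k - 1, dig (n + 1) s l = v l) (ht : ∀ l < k - 1, dig (n + 1) t l = v (l + 1))
    (hvn : ∀ l < k, v l < n) (hsol : ∀ x < d, ∃ l < k, I.bit l (v l) x ≠ 1) {m : ℕ} {u : Vtx}
    (h : RelWalk (I.Arc dd) m u (.blk (2 * (k - 1) - 1) t)) :
    ∀ m₀, Prefix I s m₀ u → m₀ + m ≤ 5 * k - 8 → False := by
  generalize he : Vtx.blk (2 * (k - 1) - 1) t = e at h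
  induction h with
  | nil u =>
    subst he
    rintro m₀ ⟨p, -, h, -⟩ -
    omega
  | @cons m u v' x h p ih =>
    rintro m₀ ⟨q, hq, hu'⟩ hm
    have ih' := ih he (m₀ + 1)
    have hlev := level_le_of_arc hk h
    have hsuf := suffix_of_walk hk (he ▸ p) (m₀ + 1) (by omega) (by omega)
    clear ih
    suffices hP : Prefix I s (m₀ + 1) v' by exact ih' hP (by omega)
    clear ih'
    obtain ⟨hu, hv', h⟩ := h
    cases h with
    | chain g Q hg =>
      refine ⟨q, ?_, ?_, hu'.2⟩
      · have := hu'.1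
        simp only [level] at *
        split_ifs at * <;> omega
      · have := hu'.1
        omega
    | low g Q h h' => exact hu'.elim
    | high g Q h h' => have := hu'.1; omega
    | deadIn e => exact hu'.elim
    | deadOut e => exact hu'.elim
    | lowMid P X h => exact hu'.elim
    | midH2 P X => exact (hsuf.choose_spec.2).elim
    | midH1 P X h => exact (hsuf.choose_spec.2).elim
    | h1Mid P X => exact hu'.elim
    | sDown Q X h =>
      -- Here `X` is chosen; it stays fixed in the inner layers. So `p₁` records the backward steps
      -- made up to the latest entry, and later ones cannot spoil what is known about `X`.
      refine ⟨q, ?_, fun r hr hr' => ?_, q, le_rfl, fun j hj hj' l hl => ?_⟩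
      · simp only [level] at *
        split_ifs at * <;> omega
      · rw [dig_mod hr]
        exact hu'.2 r (by omega) (by omega)
      · rw [← hu'.2 l (by omega) (by omega)]
        -- The vector of set `k - 2` is not part of the inner vertex; its bit was tested by the arc.
        by_cases hl2 : l = k - 2
        · obtain rfl : j = k - 2 := by omega
          subst hl2
          exact h
        · have := (hv'.2.2.2.2 l (by omega) j hj).1 (by omega) hl
          rwa [dig_mod (by omega)] at this
    | sUp Q X h =>
      refine ⟨q + 1, ?_, le_rfl, fun l hl hl' => ?_⟩
      · simp only [level] at *
        split_ifs at * <;> omega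
      · rw [← hu'.1 l (by omega) (by omega), dig_mod (by omega)]
    | mDown i P X c hi hc =>
      refine ⟨q, ?_, fun r hr hr' => ?_, hu'.2⟩
      · simp only [level] at *; omega
      · rw [dig_setDigit (by omega), if_neg (by omega)]
        exact hu'.1 r hr (by omega)
    | mUp i P X c hi hc =>
      obtain ⟨p₁, hp₁, hJ⟩ := hu'.2
      refine ⟨q + 1, ?_, fun r hr hr' => ?_, p₁, by omega, hJ⟩
      · simp only [level, InG] at *; omega
      · rw [← hu'.1 r hr (by omega), dig_setDigit (by omega), if_neg (by omega)]
    | tDown Q X h =>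
      exfalso
      obtain ⟨p₁, hp₁, hJ⟩ := hu'.2
      obtain ⟨p₂, hp₂, hT⟩ := hsuf
      simp only [level, colevel] at hq hp₂
      rw [if_neg (by omega)] at hp₂
      -- The walk has made `2k - 3 + 2q` steps, makes one now, and `k - 2 + 2p₂` follow, at most `5k
      -- - 8` in all.
      have hpp : q + p₂ ≤ k - 2 := by omega
      -- The decisive coordinate is `X_{p₂}`. For sets `l ≤ p₂` it is `1` by the information on `s`,
      -- as `p₂ + p₁ ≤ k - 2`; for `l > p₂` by that on `t`. Both tuples come from `v`.
      obtain ⟨l, hl, hbit⟩ := hsol (dig d X p₂) (dig_lt hd _ _)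
      apply hbit
      have hok : I.Wok l (v l) (dig d X p₂) := by
        by_cases hlp : l ≤ p₂
        · rw [← hs l (by omega)]
          exact hJ p₂ (by omega) (by omega) l hlp
        · obtain ⟨r, rfl⟩ : ∃ r, l = r + 1 := ⟨l - 1, by omega⟩
          rw [← ht r (by omega), ← hT le_rfl r (by omega) (by omega)]
          by_cases hr0 : r = 0
          · subst hr0
            obtain rfl : p₂ = 0 := by omega
            exact h
          · obtain ⟨r', rfl⟩ : ∃ r', r = r' + 1 := ⟨r - 1, by omega⟩
            have := (hu.2.2.2.2 r' (by omega) p₂ (by omega)).2 (by omega) (by omega)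
            rwa [dig_div] at this
      rcases hok with hok | hok
      · have := hvn l hl; omega
      · exact hok
    | tUp Q X h => have := hu'.1; omega

/-- For a solvable instance there are two vertices at distance at least `5 * k - 7`. -/
theorem exists_long (hk : 3 ≤ k) (hd : 0 < d) (hI : I.HasSolution) :
    ∃ u v, I.InG dd u ∧ I.InG dd v ∧ ∀ m, RelWalk (I.Arc dd) m u v → 5 * k - 7 ≤ m := by
  obtain ⟨a, ha⟩ := hI
  set v : ℕ → ℕ := fun l => if h : l < k then (a ⟨l, h⟩ : ℕ) else 0 with hv
  have hvn : ∀ l < k, v l < n := fun l hl => by simp only [hv, dif_pos hl]; exact (a _).2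
  have hsol : ∀ x < d, ∃ l < k, I.bit l (v l) x ≠ 1 := by
    intro x hx
    have h0 := (Finset.sum_eq_zero_iff.1 ha) ⟨x, hx⟩ (Finset.mem_univ _)
    obtain ⟨i, -, hi⟩ := Finset.prod_eq_zero_iff.1 h0
    refine ⟨i, i.2, ?_⟩
    have : v i = a i := by simp [hv]
    rw [this, bit, dif_pos ⟨i.2, (a i).2, hx⟩]
    simp only [Fin.eta]
    omega
  obtain ⟨s, hs, hs'⟩ := exists_dig_eq (β := n + 1) (k - 1) v
    fun r hr => (hvn r (by omega)).trans (Nat.lt_succ_self n)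
  obtain ⟨t, ht, ht'⟩ := exists_dig_eq (β := n + 1) (k - 1) (fun l => v (l + 1))
    fun r hr => (hvn (r + 1) (by omega)).trans (Nat.lt_succ_self n)
  refine ⟨.blk 0 s, .blk (2 * (k - 1) - 1) t, ⟨by omega, hs⟩, ⟨by omega, ht⟩, fun m hm => ?_⟩
  by_contra hlt
  refine no_short_walk hk hd hs' ht' hvn hsol hm 0 ⟨0, ?_, by omega, fun _ _ _ => rfl⟩ (by omega)
  simp [level]

end OVInstance


namespace OVInstance

variable {k n d : ℕ} {I : OVInstance k n d} {dd : ℕ → Prop}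

/-! #### Short distances for unsolvable instances -/

/-- Digit `n` passes every test, and no other digit changes the set that it belongs to between the
two layers. -/
theorem valid_succ {i P X : ℕ} (h : I.Valid i P X) (hi : i ≤ k - 2) :
    I.Valid (i + 1) (setDigit (n + 1) P (k - 2 - i) n) X := by
  intro r hr j hj
  obtain ⟨h1, h2⟩ := h r hr j hj
  rw [dig_setDigit (Nat.lt_succ_self n)]
  by_cases hri : r = k - 2 - i
  · rw [if_pos hri]
    exact ⟨fun _ _ => .inl rfl, fun _ _ => .inl rfl⟩
  · rw [if_neg hri]
    exact ⟨fun h3 h4 => h1 (by omega) h4, fun h3 h4 => h2 (by omega) h4⟩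

theorem valid_pred {i P X : ℕ} (h : I.Valid (i + 1) P X) (hi : i ≤ k - 2) :
    I.Valid i (setDigit (n + 1) P (k - 2 - i) n) X := by
  intro r hr j hj
  obtain ⟨h1, h2⟩ := h r hr j hj
  rw [dig_setDigit (Nat.lt_succ_self n)]
  by_cases hri : r = k - 2 - i
  · rw [if_pos hri]
    exact ⟨fun _ _ => .inl rfl, fun _ _ => .inl rfl⟩
  · rw [if_neg hri]
    exact ⟨fun h3 h4 => h1 (by omega) h4, fun h3 h4 => h2 (by omega) h4⟩

theorem setDigit_setDigit_dig {β c P r m : ℕ} (hc : c < β) (hP : P < β ^ m) (hr : r < m) :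
    setDigit β (setDigit β P r c) r (dig β P r) = P := by
  have hd : dig β P r < β := dig_lt (by omega) _ _
  refine eq_of_dig_eq (setDigit_lt hd hr (setDigit_lt hc hr hP)) hP fun s _ => ?_
  rw [dig_setDigit hd, dig_setDigit hc]
  split_ifs with h
  · rw [h]
  · rfl

theorem within_chain {g Q j : ℕ} (hQ : Q < (n + 1) ^ (k - 1)) (hg : g + j < 2 * (k - 1))
    (h : g + j ≤ k - 2 ∨ k - 1 ≤ g) : Within (I.Arc dd) j (.blk g Q) (.blk (g + j) Q) := by
  induction j with
  | zero => exact .refl _ _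
  | succ j ih =>
    exact (ih (by omega) (by omega)).trans
      (.single ⟨⟨by omega, hQ⟩, ⟨by omega, hQ⟩, .chain _ _ (by omega)⟩)

/-- Exchange always for the all-ones vector: the vertices on the way are valid for the same `X`, so
no information on the instance is needed. -/
theorem mid_up {i P X j : ℕ} (hu : I.InG dd (.mid i P X)) (hj : i + j ≤ k - 1) :
    ∃ P', I.InG dd (.mid (i + j) P' X) ∧
      Within (I.Arc dd) j (.mid i P X) (.mid (i + j) P' X) ∧
      Within (I.Arc dd) j (.mid (i + j) P' X) (.mid i P X) := by
  induction j with
  | zero => exact ⟨P, hu, .refl _ _, .refl _ _⟩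
  | succ j ih =>
    obtain ⟨P', hP', h1, h2⟩ := ih (by omega)
    have hv : I.InG dd (.mid (i + j + 1) (setDigit (n + 1) P' (k - 2 - (i + j)) n) X) :=
      ⟨by omega, by omega, setDigit_lt (Nat.lt_succ_self n) (by have := hu.1; omega) hP'.2.2.1,
        hP'.2.2.2.1, valid_succ hP'.2.2.2.2 (by omega)⟩
    refine ⟨_, hv, h1.trans (.single ⟨hP', hv, .mDown _ _ _ _ (by omega) le_rfl⟩), ?_⟩
    exact ((Within.single (r := I.Arc dd)
      ⟨hv, hP', .mUp _ _ _ _ (by omega) le_rfl⟩).trans h2).mono (by omega)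

theorem mid_down {i P X j : ℕ} (hi : 1 ≤ i) (hu : I.InG dd (.mid (i + j) P X)) :
    ∃ P', I.InG dd (.mid i P' X) ∧
      Within (I.Arc dd) j (.mid i P' X) (.mid (i + j) P X) ∧
      Within (I.Arc dd) j (.mid (i + j) P X) (.mid i P' X) := by
  induction j generalizing P with
  | zero => exact ⟨P, hu, .refl _ _, .refl _ _⟩
  | succ j ih =>
    have hij := hu.2.1
    have hP := hu.2.2.1
    have hv : I.InG dd (.mid (i + j) (setDigit (n + 1) P (k - 2 - (i + j)) n) X) :=
      ⟨by omega, by omega, setDigit_lt (Nat.lt_succ_self n) (by omega) hP,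
        hu.2.2.2.1, valid_pred hu.2.2.2.2 (by omega)⟩
    obtain ⟨P', hP', h1, h2⟩ := ih hv
    have hc : dig (n + 1) P (k - 2 - (i + j)) ≤ n := Nat.lt_succ_iff.1 (dig_lt (by omega) _ _)
    -- Both kinds of arcs describe the head layer as an overwriting of the tuple of layer `i + j`;
    -- restoring the old digit exhibits `P` in this form.
    have hE : setDigit (n + 1) (setDigit (n + 1) P (k - 2 - (i + j)) n) (k - 2 - (i + j))
        (dig (n + 1) P (k - 2 - (i + j))) = P :=
      setDigit_setDigit_dig (Nat.lt_succ_self n) hP (by omega)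
    have a1 : I.Arc₀ (.mid (i + j) (setDigit (n + 1) P (k - 2 - (i + j)) n) X)
        (.mid (i + j + 1) P X) := by
      have := Arc₀.mDown (I := I) (i + j) (setDigit (n + 1) P (k - 2 - (i + j)) n) X _
        (by omega) hc
      rwa [hE] at this
    have a2 : I.Arc₀ (.mid (i + j + 1) P X)
        (.mid (i + j) (setDigit (n + 1) P (k - 2 - (i + j)) n) X) := by
      have := Arc₀.mUp (I := I) (i + j) (setDigit (n + 1) P (k - 2 - (i + j)) n) X _
        (by omega) hc
      rwa [hE] at this
    refine ⟨P', hP', h1.trans (.single ⟨hv, hu, a1⟩), ?_⟩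
    exact ((Within.single (r := I.Arc dd) ⟨hu, hv, a2⟩).trans h2).mono (by omega)

/-- Complete the tuple by the all-ones vector for set `k - 2`. The other end is treated alike, with
set `1`. -/
theorem mid_one_first (hk : 3 ≤ k) {P X : ℕ} (hu : I.InG dd (.mid 1 P X)) :
    ∃ Q, I.InG dd (.blk (k - 2) Q) ∧ I.Arc dd (.mid 1 P X) (.blk (k - 2) Q) ∧
      I.Arc dd (.blk (k - 2) Q) (.mid 1 P X) := by
  have hP := hu.2.2.1
  have hp : 0 < (n + 1) ^ (k - 2) := Nat.pow_pos (by omega)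
  have hmod : (P + n * (n + 1) ^ (k - 2)) % (n + 1) ^ (k - 2) = P := by
    rw [Nat.add_mul_mod_self_right, Nat.mod_eq_of_lt hP]
  have hdig : dig (n + 1) (P + n * (n + 1) ^ (k - 2)) (k - 2) = n := by
    rw [dig, Nat.add_mul_div_right _ _ hp, Nat.div_eq_of_lt hP, zero_add,
      Nat.mod_eq_of_lt (Nat.lt_succ_self n)]
  have hlt : P + n * (n + 1) ^ (k - 2) < (n + 1) ^ (k - 1) := by
    rw [show k - 1 = k - 2 + 1 by omega, pow_succ]
    linarith
  have hv : I.InG dd (.blk (k - 2) (P + n * (n + 1) ^ (k - 2))) := ⟨by omega, hlt⟩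
  have a1 := Arc₀.sUp (I := I) (P + n * (n + 1) ^ (k - 2)) X (by rw [hdig]; exact .inl rfl)
  have a2 := Arc₀.sDown (I := I) (P + n * (n + 1) ^ (k - 2)) X (by rw [hdig]; exact .inl rfl)
  rw [hmod] at a1 a2
  exact ⟨_, hv, ⟨hu, hv, a1⟩, ⟨hv, hu, a2⟩⟩

theorem mid_last_second (hk : 3 ≤ k) {P X : ℕ} (hu : I.InG dd (.mid (k - 1) P X)) :
    ∃ Q, I.InG dd (.blk (k - 1) Q) ∧ I.Arc dd (.mid (k - 1) P X) (.blk (k - 1) Q) ∧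
      I.Arc dd (.blk (k - 1) Q) (.mid (k - 1) P X) := by
  have hP := hu.2.2.1
  have hdiv : (n + P * (n + 1)) / (n + 1) = P := by
    rw [Nat.add_mul_div_right _ _ (by omega), Nat.div_eq_of_lt (Nat.lt_succ_self n), zero_add]
  have hdig : dig (n + 1) (n + P * (n + 1)) 0 = n := by
    rw [dig, pow_zero, Nat.div_one, Nat.add_mul_mod_self_right,
      Nat.mod_eq_of_lt (Nat.lt_succ_self n)]
  have hlt : n + P * (n + 1) < (n + 1) ^ (k - 1) := by
    have h2 : (P + 1) * (n + 1) ≤ (n + 1) ^ (k - 2) * (n + 1) := Nat.mul_le_mul_right _ hP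
    rw [show k - 1 = k - 2 + 1 by omega, pow_succ]
    linarith
  have hv : I.InG dd (.blk (k - 1) (n + P * (n + 1))) := ⟨by omega, hlt⟩
  have a1 := Arc₀.tDown (I := I) (n + P * (n + 1)) X (by rw [hdig]; exact .inl rfl)
  have a2 := Arc₀.tUp (I := I) (n + P * (n + 1)) X (by rw [hdig]; exact .inl rfl)
  rw [hdiv] at a1 a2
  exact ⟨_, hv, ⟨hu, hv, a1⟩, ⟨hv, hu, a2⟩⟩

/-- If there is no solution, then any `k` vectors have a common `1`. -/
theorem exists_common_one (hn : 0 < n) (hI : ¬ I.HasSolution) (v : ℕ → ℕ) (hv : ∀ l < k, v l ≤ n) :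
    ∃ x < d, ∀ l < k, I.Wok l (v l) x := by
  by_contra hc
  push Not at hc
  apply hI
  -- An all-ones entry may be replaced by vector `0`: at each coordinate, `hc` provides a zero at
  -- one of the genuine vectors.
  refine ⟨fun l => if h : v l < n then ⟨v l, h⟩ else ⟨0, hn⟩, Finset.sum_eq_zero fun x _ => ?_⟩
  obtain ⟨l, hl, hx⟩ := hc x x.2
  unfold Wok at hx
  push Not at hx
  have hln : v l < n := lt_of_le_of_ne (hv l hl) hx.1
  refine Finset.prod_eq_zero (Finset.mem_univ (⟨l, hl⟩ : Fin k)) ?_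
  have h2 := hx.2
  rw [bit, dif_pos ⟨hl, hln, x.2⟩] at h2
  simp only [hln, dif_pos, Fin.eta] at h2 ⊢
  revert h2
  cases I.vec ⟨l, hl⟩ ⟨v l, hln⟩ x <;> simp

/-- If there is no solution, then the two middle layers of tuples have distance `k`. -/
theorem first_second (hk : 3 ≤ k) (hn : 0 < n) (hI : ¬ I.HasSolution) {Q Q' : ℕ}
    (hQ : Q < (n + 1) ^ (k - 1)) (hQ' : Q' < (n + 1) ^ (k - 1)) :
    ∃ P X, I.InG dd (.mid (k - 1) P X) ∧
      Within (I.Arc dd) (k - 1) (.blk (k - 2) Q) (.mid (k - 1) P X) ∧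
      I.Arc dd (.mid (k - 1) P X) (.blk (k - 1) Q') := by
  have hb : 0 < n + 1 := by omega
  have hle : ∀ x r, dig (n + 1) x r ≤ n := fun x r => Nat.lt_succ_iff.1 (dig_lt hb x r)
  -- The coordinate for the split at `j`: sets up to `j` from `Q`, later ones from `Q'`, whose digit
  -- `l - 1` belongs to set `l`.
  have hx : ∀ j, ∃ x < d, ∀ l < k,
      I.Wok l (if l ≤ j then dig (n + 1) Q l else dig (n + 1) Q' (l - 1)) x := fun j =>
    exists_common_one hn hI _ fun l _ => by split_ifs <;> exact hle _ _
  choose x hxd hx using hx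
  obtain ⟨X, hX, hXd⟩ := exists_dig_eq (k - 1) x fun r _ => hxd r
  -- The tuple of layer `i` on the straight path; an exchanged digit `r` stands for set `r + 2`,
  -- which is digit `r + 1` of `Q'`.
  have hP : ∀ i, ∃ P < (n + 1) ^ (k - 2), ∀ r < k - 2, dig (n + 1) P r =
      if r + i ≤ k - 2 then dig (n + 1) Q r else dig (n + 1) Q' (r + 1) := fun i =>
    exists_dig_eq (k - 2) _ fun r _ => by split_ifs <;> exact dig_lt hb _ _
  choose P hPlt hP using hP
  have hval : ∀ i, 1 ≤ i → i ≤ k - 1 → I.InG dd (.mid i (P i) X) := by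
    refine fun i h1 h2 => ⟨h1, h2, hPlt i, hX, fun r hr j hj => ⟨fun h3 h4 => ?_, fun h3 h4 => ?_⟩⟩
    · have := hx j r (by omega)
      rw [if_pos h4] at this
      rwa [hP i r hr, if_pos h3, hXd j hj]
    · have := hx j (r + 2) (by omega)
      rw [if_neg (by omega)] at this
      rwa [hP i r hr, if_neg (by omega), hXd j hj]
  have hP1 : Q % (n + 1) ^ (k - 2) = P 1 := by
    refine eq_of_dig_eq (Nat.mod_lt _ (Nat.pow_pos hb)) (hPlt 1) fun r hr => ?_
    rw [dig_mod hr, hP 1 r hr, if_pos (by omega)]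
  have hPk : Q' / (n + 1) = P (k - 1) := by
    refine eq_of_dig_eq (m := k - 2) ?_ (hPlt _) fun r hr => ?_
    · rw [Nat.div_lt_iff_lt_mul hb, ← pow_succ, show k - 2 + 1 = k - 1 by omega]; exact hQ'
    · rw [dig_div, hP _ r hr, if_neg (by omega)]
  have hstep : ∀ i, 1 ≤ i → i ≤ k - 2 →
      setDigit (n + 1) (P i) (k - 2 - i) (dig (n + 1) Q' (k - 2 - i + 1)) = P (i + 1) := by
    intro i h1 h2
    refine eq_of_dig_eq (setDigit_lt (dig_lt hb _ _) (by omega) (hPlt i)) (hPlt _) fun r hr => ?_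
    rw [dig_setDigit (dig_lt hb _ _), hP i r hr, hP (i + 1) r hr]
    by_cases h : r = k - 2 - i
    · rw [if_pos h, if_neg (by omega), h]
    · rw [if_neg h]
      by_cases h' : r + i ≤ k - 2
      · rw [if_pos h', if_pos (by omega)]
      · rw [if_neg h', if_neg (by omega)]
  have hwalk : ∀ j, j + 1 ≤ k - 1 →
      Within (I.Arc dd) j (.mid 1 (P 1) X) (.mid (j + 1) (P (j + 1)) X) := by
    intro j
    induction j with
    | zero => exact fun _ => .refl _ _
    | succ j ih =>
      intro hj
      refine (ih (by omega)).trans (.single ⟨hval _ (by omega) (by omega),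
        hval _ (by omega) hj, ?_⟩)
      have := Arc₀.mDown (I := I) (j + 1) (P (j + 1)) X _ (by omega)
        (hle Q' (k - 2 - (j + 1) + 1))
      rwa [hstep (j + 1) (by omega) (by omega)] at this
  refine ⟨P (k - 1), X, hval _ (by omega) le_rfl, ?_, hval _ (by omega) le_rfl,
    ⟨by omega, hQ'⟩, ?_⟩
  · have a := Arc₀.sDown (I := I) Q X (by
      have := hx (k - 2) (k - 2) (by omega)
      rw [if_pos le_rfl] at this
      rwa [hXd _ (by omega)])
    rw [hP1] at a
    have h2 := hwalk (k - 2) (by omega)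
    rw [show k - 2 + 1 = k - 1 by omega] at h2
    have hQv : I.InG dd (.blk (k - 2) Q) := ⟨by omega, hQ⟩
    exact ((Within.single (r := I.Arc dd) ⟨hQv, hval 1 le_rfl (by omega), a⟩).trans h2).mono
      (by omega)
  · have a := Arc₀.tDown (I := I) Q' X (by
      have := hx 0 1 (by omega)
      rw [if_neg (by omega)] at this
      rwa [hXd _ (by omega)])
    rwa [hPk] at a

end OVInstance


/-! ### Routes through the hubs and the bound `3k - 4` -/

namespace OVInstance

variable {k n d : ℕ} {I : OVInstance k n d} {dd : ℕ → Prop}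

theorem inG_h1 : I.InG dd .h1 := trivial

theorem inG_h2 : I.InG dd .h2 := trivial

theorem mid_h2 {i P X : ℕ} (hu : I.InG dd (.mid i P X)) :
    Within (I.Arc dd) (k - i) (.mid i P X) .h2 := by
  obtain ⟨h1, h2, -⟩ := id hu
  obtain ⟨P', hP', h, -⟩ := mid_up (j := k - 1 - i) hu (by omega)
  rw [show i + (k - 1 - i) = k - 1 by omega] at hP' h
  exact (h.trans (.single ⟨hP', inG_h2, .midH2 _ _⟩)).mono (by omega)

theorem second_h1 (hk : 3 ≤ k) {g Q : ℕ} (hu : I.InG dd (.blk g Q)) (hg : k - 1 ≤ g) :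
    Within (I.Arc dd) (max (2 * k - 4 - g) 1) (.blk g Q) .h1 := by
  by_cases h : 2 * (k - 1) ≤ g + 3
  · exact (Within.single ⟨hu, inG_h1, .high _ _ hg h⟩).mono (by omega)
  · have hc := within_chain (I := I) (dd := dd) (g := g) (j := 2 * k - 5 - g) hu.2 (by omega)
      (.inr hg)
    have hv : I.InG dd (.blk (g + (2 * k - 5 - g)) Q) := ⟨by omega, hu.2⟩
    exact (hc.trans (.single ⟨hv, inG_h1, .high _ _ (by omega) (by omega)⟩)).mono (by omega)

/-- For `k = 3` the way through the second half would take two steps, which is why the arc `midH1`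
exists; `lowMid` plays this part for `h2`. -/
theorem last_h1 (hk : 3 ≤ k) {P X : ℕ} (hu : I.InG dd (.mid (k - 1) P X)) :
    Within (I.Arc dd) (k - 2) (.mid (k - 1) P X) .h1 := by
  by_cases h3 : k = 3
  · exact (Within.single ⟨hu, inG_h1, .midH1 _ _ h3⟩).mono (by omega)
  · obtain ⟨Q, hQ, h, -⟩ := mid_last_second hk hu
    exact ((Within.single h).trans (second_h1 hk hQ le_rfl)).mono (by omega)

theorem mid_h1 (hk : 3 ≤ k) {i P X : ℕ} (hu : I.InG dd (.mid i P X)) :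
    Within (I.Arc dd) (2 * k - 3 - i) (.mid i P X) .h1 := by
  obtain ⟨h1, h2, -⟩ := id hu
  obtain ⟨P', hP', h, -⟩ := mid_up (j := k - 1 - i) hu (by omega)
  rw [show i + (k - 1 - i) = k - 1 by omega] at hP' h
  exact (h.trans (last_h1 hk hP')).mono (by omega)

theorem h2_first (hk : 3 ≤ k) {g Q : ℕ} (hu : I.InG dd (.blk g Q)) (hg : g ≤ k - 2) :
    Within (I.Arc dd) (max 1 (g - 1)) .h2 (.blk g Q) := by
  by_cases h : g ≤ 2
  · exact (Within.single ⟨inG_h2, hu, .low _ _ h hg⟩).mono (by omega)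
  · have hv : I.InG dd (.blk 2 Q) := ⟨by omega, hu.2⟩
    have hc := within_chain (I := I) (dd := dd) (g := 2) (j := g - 2) hu.2 (by omega)
      (.inl (by omega))
    rw [show 2 + (g - 2) = g by omega] at hc
    exact ((Within.single (r := I.Arc dd) ⟨inG_h2, hv, .low _ _ le_rfl (by omega)⟩).trans hc).mono
      (by omega)

theorem h2_mid (hk : 3 ≤ k) {i P X : ℕ} (hu : I.InG dd (.mid i P X)) :
    Within (I.Arc dd) (k - 3 + i) .h2 (.mid i P X) := by
  obtain ⟨h1, h2, -⟩ := id hu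
  obtain ⟨j, rfl⟩ : ∃ j, i = 1 + j := ⟨i - 1, by omega⟩
  obtain ⟨P', hP', h, -⟩ := mid_down le_rfl hu
  by_cases h3 : k = 3
  · exact ((Within.single (r := I.Arc dd) ⟨inG_h2, hP', .lowMid _ _ h3⟩).trans h).mono (by omega)
  · obtain ⟨Q, hQ, -, h'⟩ := mid_one_first hk hP'
    exact (((h2_first hk hQ le_rfl).trans (.single h')).trans h).mono (by omega)

theorem h1_mid {i P X : ℕ} (hu : I.InG dd (.mid i P X)) :
    Within (I.Arc dd) i .h1 (.mid i P X) := by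
  obtain ⟨h1, h2, -⟩ := id hu
  obtain ⟨j, rfl⟩ : ∃ j, i = 1 + j := ⟨i - 1, by omega⟩
  obtain ⟨P', hP', h, -⟩ := mid_down le_rfl hu
  exact (Within.single (r := I.Arc dd) ⟨inG_h1, hP', .h1Mid _ _⟩).trans h

theorem mid_first (hk : 3 ≤ k) {i P X : ℕ} (hu : I.InG dd (.mid i P X)) :
    ∃ Q, I.InG dd (.blk (k - 2) Q) ∧ Within (I.Arc dd) i (.mid i P X) (.blk (k - 2) Q) := by
  obtain ⟨h1, h2, -⟩ := id hu
  obtain ⟨j, rfl⟩ : ∃ j, i = 1 + j := ⟨i - 1, by omega⟩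
  obtain ⟨P', hP', -, h⟩ := mid_down le_rfl hu
  obtain ⟨Q, hQ, h', -⟩ := mid_one_first hk hP'
  exact ⟨Q, hQ, (h.trans (.single h')).mono (by omega)⟩

theorem second_mid (hk : 3 ≤ k) {i P X : ℕ} (hu : I.InG dd (.mid i P X)) :
    ∃ Q, I.InG dd (.blk (k - 1) Q) ∧
      Within (I.Arc dd) (k - i) (.blk (k - 1) Q) (.mid i P X) := by
  obtain ⟨h1, h2, -⟩ := id hu
  obtain ⟨P', hP', -, h⟩ := mid_up (j := k - 1 - i) hu (by omega)
  rw [show i + (k - 1 - i) = k - 1 by omega] at hP' h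
  obtain ⟨Q, hQ, -, h'⟩ := mid_last_second hk hP'
  exact ⟨Q, hQ, ((Within.single h').trans h).mono (by omega)⟩

theorem first_last (hk : 3 ≤ k) (hn : 0 < n) (hI : ¬ I.HasSolution) {g Q : ℕ}
    (hu : I.InG dd (.blk g Q)) (hg : g ≤ k - 2) :
    ∃ P X, I.InG dd (.mid (k - 1) P X) ∧
      Within (I.Arc dd) (2 * k - 3 - g) (.blk g Q) (.mid (k - 1) P X) := by
  have hc := within_chain (I := I) (dd := dd) (g := g) (j := k - 2 - g) hu.2 (by omega)
    (.inl (by omega))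
  rw [show g + (k - 2 - g) = k - 2 by omega] at hc
  obtain ⟨P, X, hP, h, -⟩ := first_second hk hn hI hu.2 hu.2
  exact ⟨P, X, hP, (hc.trans h).mono (by omega)⟩

theorem first_to_second (hk : 3 ≤ k) (hn : 0 < n) (hI : ¬ I.HasSolution) {g Q g' Q' : ℕ}
    (hu : I.InG dd (.blk g Q)) (hg : g ≤ k - 2) (hv : I.InG dd (.blk g' Q')) (hg' : k - 1 ≤ g') :
    Within (I.Arc dd) (k - 1 + g' - g) (.blk g Q) (.blk g' Q') := by
  have hgl := hv.1
  have hc := within_chain (I := I) (dd := dd) (g := g) (j := k - 2 - g) hu.2 (by omega)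
    (.inl (by omega))
  rw [show g + (k - 2 - g) = k - 2 by omega] at hc
  have hc' := within_chain (I := I) (dd := dd) (g := k - 1) (j := g' - (k - 1)) hv.2 (by omega)
    (.inr (by omega))
  rw [show k - 1 + (g' - (k - 1)) = g' by omega] at hc'
  obtain ⟨P, X, hP, h, h'⟩ := first_second hk hn hI hu.2 hv.2
  exact (((hc.trans h).trans (.single h')).trans hc').mono (by omega)

theorem h1_second (hk : 3 ≤ k) (hn : 0 < n) (hI : ¬ I.HasSolution) {g Q : ℕ}
    (hv : I.InG dd (.blk g Q)) (hg : k - 1 ≤ g) : Within (I.Arc dd) (g + 1) .h1 (.blk g Q) := by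
  have hgl := hv.1
  have hc := within_chain (I := I) (dd := dd) (g := k - 1) (j := g - (k - 1)) hv.2 (by omega)
    (.inr (by omega))
  rw [show k - 1 + (g - (k - 1)) = g by omega] at hc
  -- Only the last arc is used: the given `Q` has a neighbour in the last inner layer, because its
  -- vectors have suitable common coordinates.
  obtain ⟨P, X, hP, -, h'⟩ := first_second hk hn hI hv.2 hv.2
  exact (((h1_mid hP).trans (.single h')).trans hc).mono (by omega)

theorem inG_blk_zero {g : ℕ} (hg : g < 2 * (k - 1)) : I.InG dd (.blk g 0) :=
  ⟨hg, Nat.pow_pos (by omega)⟩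

theorem h1_h2 (hk : 3 ≤ k) (hn : 0 < n) (hI : ¬ I.HasSolution) :
    Within (I.Arc dd) k .h1 .h2 := by
  obtain ⟨P, X, hP, -⟩ := first_last (dd := dd) hk hn hI
    (inG_blk_zero (I := I) (dd := dd) (g := 0) (by omega)) (Nat.zero_le _)
  exact ((h1_mid hP).trans (mid_h2 hP)).mono (by omega)

theorem h2_mem (hk : 3 ≤ k) (hn : 0 < n) (hI : ¬ I.HasSolution) {v : Vtx} (hv : I.InG dd v) :
    Within (I.Arc dd) (3 * k - 4) .h2 v := by
  cases v with
  | blk g Q =>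
    have hgl := hv.1
    by_cases hg : g ≤ k - 2
    · exact (h2_first hk hv hg).mono (by omega)
    · have hQ : I.InG dd (.blk (k - 2) Q) := ⟨by omega, hv.2⟩
      exact ((h2_first hk hQ le_rfl).trans
        (first_to_second hk hn hI hQ le_rfl hv (by omega))).mono (by omega)
  | mid i P X =>
    have := hv.2.1
    exact (h2_mid hk hv).mono (by omega)
  | dead e => exact (Within.single ⟨inG_h2, hv, .deadIn e⟩).mono (by omega)
  | h1 =>
    have hQ := inG_blk_zero (I := I) (dd := dd) (g := k - 2) (by omega)
    obtain ⟨P, X, hP, h⟩ := first_last hk hn hI hQ le_rfl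
    exact (((h2_first hk hQ le_rfl).trans h).trans (last_h1 hk hP)).mono (by omega)
  | h2 => exact .refl _ _

theorem h1_mem (hk : 3 ≤ k) (hn : 0 < n) (hI : ¬ I.HasSolution) {v : Vtx} (hv : I.InG dd v) :
    Within (I.Arc dd) (2 * k - 2) .h1 v := by
  cases v with
  | blk g Q =>
    have hgl := hv.1
    by_cases hg : g ≤ k - 2
    · exact ((h1_h2 hk hn hI).trans (h2_first hk hv hg)).mono (by omega)
    · exact (h1_second hk hn hI hv (by omega)).mono (by omega)
  | mid i P X =>
    have := hv.2.1
    exact (h1_mid hv).mono (by omega)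
  | dead e =>
    exact ((h1_h2 hk hn hI).trans (.single ⟨inG_h2, hv, .deadIn e⟩)).mono
      (by omega)
  | h1 => exact .refl _ _
  | h2 => exact (h1_h2 hk hn hI).mono (by omega)

/-- The term `min g 1` is the step saved by not starting in layer `0`. Dead vertices spend it on
their arc to layer `1`. -/
theorem first_mem (hk : 3 ≤ k) (hn : 0 < n) (hI : ¬ I.HasSolution) {g Q : ℕ}
    (hu : I.InG dd (.blk g Q)) (hg : g ≤ k - 2) {v : Vtx} (hv : I.InG dd v) :
    Within (I.Arc dd) (3 * k - 4 - min g 1) (.blk g Q) v := by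
  obtain ⟨P, X, hP, h⟩ := first_last hk hn hI hu hg
  have hh2 := h.trans (mid_h2 hP)
  cases v with
  | blk g' Q' =>
    have hgl := hv.1
    by_cases hg' : g' ≤ k - 2
    · exact (hh2.trans (h2_first hk hv hg')).mono (by omega)
    · exact (first_to_second hk hn hI hu hg hv (by omega)).mono (by omega)
  | mid i P' X' =>
    have h1 := hv.1
    have h2 := hv.2.1
    -- Coming back from the second half to inner layer `1` would be one step too long for `g ≤ 1`,
    -- so that layer is reached through `h2`.
    by_cases hi : i = 1
    · exact (hh2.trans (h2_mid hk hv)).mono (by omega)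
    · obtain ⟨Q', hQ', h'⟩ := second_mid hk hv
      exact ((first_to_second hk hn hI hu hg hQ' le_rfl).trans h').mono (by omega)
  | dead e => exact (hh2.trans (.single ⟨inG_h2, hv, .deadIn e⟩)).mono (by omega)
  | h1 => exact (h.trans (last_h1 hk hP)).mono (by omega)
  | h2 => exact hh2.mono (by omega)

/-- If there is no solution, then all distances are at most `3 * k - 4`. -/
theorem within_of_not_hasSolution (hk : 3 ≤ k) (hn : 0 < n) (hI : ¬ I.HasSolution) {u v : Vtx}
    (hu : I.InG dd u) (hv : I.InG dd v) : Within (I.Arc dd) (3 * k - 4) u v := by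
  cases u with
  | blk g Q =>
    have hgl := hu.1
    by_cases hg : g ≤ k - 2
    · exact (first_mem hk hn hI hu hg hv).mono (by omega)
    · exact ((second_h1 hk hu (by omega)).trans (h1_mem hk hn hI hv)).mono
        (by omega)
  | mid i P X =>
    have hi1 := hu.1
    have hi2 := hu.2.1
    have hh2 := mid_h2 hu
    cases v with
    | blk g' Q' =>
      have hgl := hv.1
      by_cases hg' : g' ≤ k - 2
      · exact (hh2.trans (h2_first hk hv hg')).mono (by omega)
      · by_cases hi : i = k - 1
        · subst hi
          exact ((last_h1 hk hu).trans (h1_second hk hn hI hv (by omega))).mono (by omega)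
        · obtain ⟨Q, hQ, h⟩ := mid_first hk hu
          exact (h.trans (first_to_second hk hn hI hQ le_rfl hv (by omega))).mono (by omega)
    | mid i' P' X' =>
      have := hv.2.1
      exact (hh2.trans (h2_mid hk hv)).mono (by omega)
    | dead e => exact (hh2.trans (.single ⟨inG_h2, hv, .deadIn e⟩)).mono (by omega)
    | h1 => exact (mid_h1 hk hu).mono (by omega)
    | h2 => exact hh2.mono (by omega)
  | dead e =>
    have hb := inG_blk_zero (I := I) (dd := dd) (g := 1) (by omega)
    exact ((Within.single (r := I.Arc dd) ⟨hu, hb, .deadOut e⟩).trans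
      (first_mem hk hn hI hb (by omega) hv)).mono (by omega)
  | h1 => exact (h1_mem hk hn hI hv).mono (by omega)
  | h2 => exact h2_mem hk hn hI hv

end OVInstance


/-! ### Numbering the vertices -/

theorem pair_lt {g G q x : ℕ} (hg : g < G) (hx : x < q) : g * q + x < G * q := by
  have := Nat.mul_le_mul_right q (Nat.succ_le_of_lt hg)
  rw [Nat.succ_mul] at this
  omega

theorem pair_div {g q x : ℕ} (hx : x < q) : (g * q + x) / q = g := by
  rw [add_comm, Nat.add_mul_div_right _ _ (by omega), Nat.div_eq_of_lt hx, zero_add]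

theorem pair_mod {g q x : ℕ} (hx : x < q) : (g * q + x) % q = x := by
  rw [add_comm, Nat.add_mul_mod_self_right, Nat.mod_eq_of_lt hx]

theorem div_lt_of_lt_mul_right {e a b : ℕ} (h : e < a * b) : e / b < a :=
  Nat.div_lt_of_lt_mul (by rw [mul_comm]; exact h)

/-- The number of `(k - 1)`-tuples. -/
def nQ (k n : ℕ) : ℕ := (n + 1) ^ (k - 1)

/-- The number of `(k - 2)`-tuples. -/
def nB (k n : ℕ) : ℕ := (n + 1) ^ (k - 2)

/-- The number of tuples of coordinates. -/
def nX (k d : ℕ) : ℕ := d ^ (k - 1)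

/-- The size of an inner layer. -/
def nP (k n d : ℕ) : ℕ := nB k n * nX k d

/-- The number of the first inner vertex. -/
def zV (k n : ℕ) : ℕ := 2 * (k - 1) * nQ k n + 2

/-- The number of inner and padding vertices. -/
def cM (k n d pd : ℕ) : ℕ := (k - 1) * nP k n d + pd * (nQ k n * nX k d)

/-- The number of a possible inner vertex, counted from the first one. -/
def rel (k n d i P X : ℕ) : ℕ := (i - 1) * nP k n d + (P * nX k d + X)

/-- The number of a vertex. -/
def enc (k n d : ℕ) : Vtx → ℕ
  | .blk g Q => g * nQ k n + Q
  | .mid i P X => zV k n + rel k n d i P X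
  -- Dead and inner vertices share one range of numbers: slot `e` is an inner vertex if it is valid
  -- and dead otherwise, and the slots from `(k - 1) * nP k n d` on are padding.
  | .dead e => zV k n + e
  | .h1 => zV k n - 2
  | .h2 => zV k n - 1

theorem nQ_pos (k n : ℕ) : 0 < nQ k n := Nat.pow_pos (by omega)

theorem nB_pos (k n : ℕ) : 0 < nB k n := Nat.pow_pos (by omega)

theorem nX_pos (k : ℕ) {d : ℕ} (hd : 0 < d) : 0 < nX k d := Nat.pow_pos hd

theorem nP_pos (k n : ℕ) {d : ℕ} (hd : 0 < d) : 0 < nP k n d :=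
  Nat.mul_pos (nB_pos k n) (nX_pos k hd)

theorem nQ_eq {k : ℕ} (hk : 3 ≤ k) (n : ℕ) : nQ k n = nB k n * (n + 1) := by
  unfold nQ nB; rw [← pow_succ]; congr 1; omega

section rel

variable {k n d i P X : ℕ}

theorem inner_lt (hP : P < nB k n) (hX : X < nX k d) : P * nX k d + X < nP k n d := pair_lt hP hX

theorem rel_lt (hi : 1 ≤ i) (hi' : i ≤ k - 1) (hP : P < nB k n) (hX : X < nX k d) :
    rel k n d i P X < (k - 1) * nP k n d := pair_lt (by omega) (inner_lt hP hX)

theorem rel_div (hP : P < nB k n) (hX : X < nX k d) : rel k n d i P X / nP k n d = i - 1 :=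
  pair_div (inner_lt hP hX)

theorem rel_mod_div (hP : P < nB k n) (hX : X < nX k d) :
    rel k n d i P X % nP k n d / nX k d = P := by
  rw [rel, pair_mod (inner_lt hP hX), pair_div hX]

theorem rel_mod (hX : X < nX k d) : rel k n d i P X % nX k d = X := by
  rw [rel, show (i - 1) * nP k n d + (P * nX k d + X) = ((i - 1) * nB k n + P) * nX k d + X by
    rw [nP]; ring, pair_mod hX]

theorem rel_of_mod (e : ℕ) : rel k n d (1 + e / nP k n d) (e % nP k n d / nX k d) (e % nX k d) = e := by
  have h : e % nX k d = e % nP k n d % nX k d := by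
    rw [nP, mul_comm, Nat.mod_mul_right_mod]
  rw [rel, h, Nat.div_add_mod', Nat.add_sub_cancel_left, Nat.div_add_mod']

end rel

namespace OVInstance

variable {k n d : ℕ} (I : OVInstance k n d)

/-- Inner vertex number `e` is valid. -/
def Alive (e : ℕ) : Prop :=
  e < (k - 1) * nP k n d ∧
    I.Valid (1 + e / nP k n d) (e % nP k n d / nX k d) (e % nX k d)

/-- The vertices outside of the layers. -/
def Pad (pd e : ℕ) : Prop := e < cM k n d pd ∧ ¬ I.Alive e

open Classical in
/-- Inner or padding vertex number `e`. -/
noncomputable def inner (e : ℕ) : Vtx :=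
  if I.Alive e then .mid (1 + e / nP k n d) (e % nP k n d / nX k d) (e % nX k d) else .dead e

open Classical in
/-- The vertex with a given number. -/
noncomputable def dec (x : ℕ) : Vtx :=
  if x < 2 * (k - 1) * nQ k n then .blk (x / nQ k n) (x % nQ k n)
  else if x = zV k n - 2 then .h1 else if x = zV k n - 1 then .h2 else I.inner (x - zV k n)

variable {I}

theorem alive_rel {i P X : ℕ} (hi : 1 ≤ i) (hi' : i ≤ k - 1) (hP : P < nB k n) (hX : X < nX k d) :
    I.Alive (rel k n d i P X) ↔ I.Valid i P X := by
  rw [Alive, rel_div hP hX, rel_mod_div hP hX, rel_mod hX, show 1 + (i - 1) = i by omega]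
  exact ⟨fun h => h.2, fun h => ⟨rel_lt hi hi' hP hX, h⟩⟩

theorem inner_rel {pd i P X : ℕ} (h : I.InG (I.Pad pd) (.mid i P X)) :
    I.inner (rel k n d i P X) = .mid i P X := by
  obtain ⟨hi, hi', hP, hX, hv⟩ := h
  rw [inner, if_pos ((alive_rel hi hi' hP hX).2 hv), rel_div hP hX, rel_mod_div hP hX, rel_mod hX,
    show 1 + (i - 1) = i by omega]

theorem inner_of_alive {e : ℕ} (h : I.Alive e) :
    I.inner e = .mid (1 + e / nP k n d) (e % nP k n d / nX k d) (e % nX k d) := if_pos h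

theorem inner_of_not_alive {e : ℕ} (h : ¬ I.Alive e) : I.inner e = .dead e := if_neg h

theorem inG_inner (hd : 0 < d) {pd e : ℕ} (he : e < cM k n d pd) :
    I.InG (I.Pad pd) (I.inner e) := by
  by_cases h : I.Alive e
  · rw [inner_of_alive h]
    refine ⟨Nat.le_add_right _ _, ?_, ?_, Nat.mod_lt _ (nX_pos k hd), h.2⟩
    · have := div_lt_of_lt_mul_right h.1
      omega
    · exact div_lt_of_lt_mul_right (Nat.mod_lt _ (nP_pos k n hd))
  · rw [inner_of_not_alive h]
    exact ⟨he, h⟩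

theorem enc_inner (e : ℕ) : enc k n d (I.inner e) = zV k n + e := by
  by_cases h : I.Alive e
  · rw [inner_of_alive h, enc, rel_of_mod]
  · rw [inner_of_not_alive h, enc]

/-- The shared range is unambiguous because `Alive` decides which kind of vertex a slot holds.
Injectivity of `enc` on the graph follows. -/
theorem dec_enc {pd : ℕ} {u : Vtx} (hu : I.InG (I.Pad pd) u) : I.dec (enc k n d u) = u := by
  have hz : zV k n = 2 * (k - 1) * nQ k n + 2 := rfl
  cases u with
  | blk g Q =>
    have hQ : Q < nQ k n := hu.2
    have h := pair_lt hu.1 hQ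
    rw [enc, dec, if_pos h, pair_div hQ, pair_mod hQ]
  | mid i P X =>
    rw [enc, dec, if_neg (by omega), if_neg (by omega), if_neg (by omega),
      Nat.add_sub_cancel_left, inner_rel hu]
  | dead e =>
    rw [enc, dec, if_neg (by omega), if_neg (by omega), if_neg (by omega),
      Nat.add_sub_cancel_left, inner_of_not_alive hu.2]
  | h1 => rw [enc, dec, if_neg (by omega), if_pos rfl]
  | h2 => rw [enc, dec, if_neg (by omega), if_neg (by omega), if_pos rfl]

theorem enc_inj {pd : ℕ} {u v : Vtx} (hu : I.InG (I.Pad pd) u) (hv : I.InG (I.Pad pd) v)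
    (h : enc k n d u = enc k n d v) : u = v := by
  rw [← dec_enc hu, h, dec_enc hv]

theorem enc_lt {pd : ℕ} {u : Vtx} (hu : I.InG (I.Pad pd) u) :
    enc k n d u < zV k n + cM k n d pd := by
  have hz : zV k n = 2 * (k - 1) * nQ k n + 2 := rfl
  cases u with
  | blk g Q =>
    have := pair_lt hu.1 hu.2
    rw [enc]
    unfold nQ at *
    omega
  | mid i P X =>
    have := rel_lt (d := d) hu.1 hu.2.1 hu.2.2.1 hu.2.2.2.1
    rw [enc, cM]
    omega
  | dead e => have := hu.1; rw [enc]; omega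
  | h1 => rw [enc]; omega
  | h2 => rw [enc]; omega

theorem exists_enc (hd : 0 < d) {pd x : ℕ} (hx : x < zV k n + cM k n d pd) :
    ∃ u, I.InG (I.Pad pd) u ∧ enc k n d u = x := by
  have hz : zV k n = 2 * (k - 1) * nQ k n + 2 := rfl
  by_cases h : x < 2 * (k - 1) * nQ k n
  · refine ⟨.blk (x / nQ k n) (x % nQ k n), ⟨div_lt_of_lt_mul_right (by assumption),
      Nat.mod_lt _ (nQ_pos k n)⟩, Nat.div_add_mod' _ _⟩
  by_cases h1 : x = zV k n - 2
  · exact ⟨.h1, trivial, h1.symm⟩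
  by_cases h2 : x = zV k n - 1
  · exact ⟨.h2, trivial, h2.symm⟩
  · refine ⟨I.inner (x - zV k n), inG_inner hd (by omega), ?_⟩
    rw [enc_inner]
    omega

end OVInstance

/-! ### The list of edges -/

/-- A family of arcs. -/
structure VFam where
  cnt : ℕ
  flag : ℕ → Prop
  src : ℕ → Vtx
  dst : ℕ → Vtx

/-- The family of the reverse arcs. -/
def VFam.swap (F : VFam) : VFam := ⟨F.cnt, F.flag, F.dst, F.src⟩

open Classical in
/-- The edges of a family of arcs. -/
noncomputable def VFam.list (k n d : ℕ) (F : VFam) : List (ℕ × ℕ) :=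
  ((List.range F.cnt).filter fun e => F.flag e).map fun e =>
    (enc k n d (F.src e), enc k n d (F.dst e))

theorem VFam.mem_list {k n d : ℕ} {F : VFam} {p : ℕ × ℕ} : p ∈ F.list k n d ↔
    ∃ e < F.cnt, F.flag e ∧ (enc k n d (F.src e), enc k n d (F.dst e)) = p := by
  simp only [VFam.list, List.mem_map, List.mem_filter, List.mem_range, decide_eq_true_eq, and_assoc]

namespace OVInstance

variable {k n d : ℕ} (I : OVInstance k n d)

/-- The arcs from the first half of the layers of tuples. -/
def famS : VFam where
  cnt := nQ k n * nX k d
  flag e := I.Alive (rel k n d 1 (e / nX k d % nB k n) (e % nX k d)) ∧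
    I.Wok (k - 2) (dig (n + 1) (e / nX k d) (k - 2)) (dig d (e % nX k d) (k - 2))
  src e := .blk (k - 2) (e / nX k d)
  dst e := .mid 1 (e / nX k d % nB k n) (e % nX k d)

/-- The arcs to the second half of the layers of tuples. -/
def famT : VFam where
  cnt := nQ k n * nX k d
  flag e := I.Alive (rel k n d (k - 1) (e / nX k d / (n + 1)) (e % nX k d)) ∧
    I.Wok 1 (dig (n + 1) (e / nX k d) 0) (dig d (e % nX k d) 0)
  src e := .mid (k - 1) (e / nX k d / (n + 1)) (e % nX k d)
  dst e := .blk (k - 1) (e / nX k d)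

/-- The layer of the tail of an arc between inner layers. -/
def mi (k n d e : ℕ) : ℕ := 1 + e / (nQ k n * nX k d)

/-- The tuple of the tail of an arc between inner layers. -/
def mP (k n d e : ℕ) : ℕ := e % (nQ k n * nX k d) / nX k d % nB k n

/-- The new vector in the tuple of the head of an arc between inner layers. -/
def mC (k n d e : ℕ) : ℕ := e % (nQ k n * nX k d) / nX k d / nB k n

/-- The tuple of the head of an arc between inner layers. -/
def mP' (k n d e : ℕ) : ℕ := setDigit (n + 1) (mP k n d e) (k - 2 - mi k n d e) (mC k n d e)

/-- The arcs between inner layers. -/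
def famM : VFam where
  cnt := (k - 2) * (nQ k n * nX k d)
  flag e := I.Alive (rel k n d (mi k n d e) (mP k n d e) (e % nX k d)) ∧
    I.Alive (rel k n d (mi k n d e + 1) (mP' k n d e) (e % nX k d))
  src e := .mid (mi k n d e) (mP k n d e) (e % nX k d)
  dst e := .mid (mi k n d e + 1) (mP' k n d e) (e % nX k d)

/-- All families of arcs. -/
noncomputable def vfam (pd : ℕ) : ℕ → VFam
  | 0 => ⟨2 * (k - 1) * nQ k n, fun e => e / nQ k n ≠ k - 2 ∧ e / nQ k n ≠ 2 * k - 3,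
      fun e => .blk (e / nQ k n) (e % nQ k n), fun e => .blk (e / nQ k n + 1) (e % nQ k n)⟩
  | 1 => ⟨min 3 (k - 1) * nQ k n, fun _ => True, fun _ => .h2,
      fun e => .blk (e / nQ k n) (e % nQ k n)⟩
  | 2 => ⟨min 3 (k - 1) * nQ k n, fun _ => True,
      fun e => .blk (2 * (k - 1) - min 3 (k - 1) + e / nQ k n) (e % nQ k n), fun _ => .h1⟩
  | 3 => ⟨cM k n d pd, fun e => ¬ I.Alive e ∨ k = 3 ∧ e < nP k n d, fun _ => .h2, I.inner⟩
  | 4 => ⟨cM k n d pd, fun e => I.Alive e ∧ e / nP k n d = k - 2, I.inner, fun _ => .h2⟩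
  | 5 => ⟨cM k n d pd, fun e => k = 3 ∧ I.Alive e ∧ e / nP k n d = k - 2, I.inner, fun _ => .h1⟩
  | 6 => ⟨cM k n d pd, fun e => I.Alive e ∧ e < nP k n d, fun _ => .h1, I.inner⟩
  | 7 => ⟨cM k n d pd, fun e => ¬ I.Alive e, I.inner, fun _ => .blk 1 0⟩
  | 8 => I.famS
  | 9 => I.famS.swap
  | 10 => I.famM
  | 11 => I.famM.swap
  | 12 => I.famT
  | _ => I.famT.swap

/-- A number for the kind of an arc. -/
def color (k : ℕ) : Vtx → Vtx → ℕ
  | .blk _ _, .blk _ _ => 0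
  | .h2, .blk _ _ => 1
  | .blk _ _, .h1 => 2
  | .h2, .mid _ _ _ => 3
  | .h2, .dead _ => 3
  | .mid _ _ _, .h2 => 4
  | .mid _ _ _, .h1 => 5
  | .h1, .mid _ _ _ => 6
  | .dead _, .blk _ _ => 7
  | .blk g _, .mid _ _ _ => if g = k - 2 then 8 else 13
  | .mid _ _ _, .blk g _ => if g = k - 2 then 9 else 12
  | .mid i _ _, .mid j _ _ => if i < j then 10 else 11
  | _, _ => 0

/-- The members of a family are different arcs of the graph of one color. -/
def _root_.VFam.Fine (F : VFam) (pd c : ℕ) : Prop :=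
  (∀ e < F.cnt, F.flag e → I.Arc (I.Pad pd) (F.src e) (F.dst e) ∧
    color k (F.src e) (F.dst e) = c) ∧
  ∀ e < F.cnt, ∀ e' < F.cnt, F.flag e → F.flag e' → F.src e = F.src e' → F.dst e = F.dst e' → e = e'

variable {I}

theorem eq_of_div_mod {q e e' : ℕ} (h : e / q = e' / q) (h' : e % q = e' % q) : e = e' := by
  rw [← Nat.div_add_mod e q, ← Nat.div_add_mod e' q, h, h']

theorem fine_famS (hk : 3 ≤ k) (hd : 0 < d) (pd : ℕ) :
    I.famS.Fine I pd 8 ∧ I.famS.swap.Fine I pd 9 := by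
  have hin : ∀ e < nQ k n * nX k d, I.famS.flag e → I.InG (I.Pad pd) (I.famS.src e) ∧
      I.InG (I.Pad pd) (I.famS.dst e) := by
    intro e he hf
    have hQ : e / nX k d < nQ k n := div_lt_of_lt_mul_right (by assumption)
    have hX : e % nX k d < nX k d := Nat.mod_lt _ (nX_pos k hd)
    have hP : e / nX k d % nB k n < nB k n := Nat.mod_lt _ (nB_pos k n)
    exact ⟨⟨by omega, hQ⟩, le_rfl, by omega, hP, hX,
      (alive_rel le_rfl (by omega) hP hX).1 hf.1⟩
  have hinj : ∀ e e', I.famS.src e = I.famS.src e' → I.famS.dst e = I.famS.dst e' → e = e' := by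
    intro e e' h h'
    simp only [famS, Vtx.blk.injEq, Vtx.mid.injEq] at h h'
    exact eq_of_div_mod h.2 h'.2.2
  refine ⟨⟨fun e he hf => ?_, fun e _ e' _ _ _ => hinj e e'⟩,
    ⟨fun e he hf => ?_, fun e _ e' _ _ _ h h' => hinj e e' h' h⟩⟩
  · obtain ⟨h1, h2⟩ := hin e he hf
    exact ⟨⟨h1, h2, .sDown _ _ hf.2⟩, by simp [famS, color]⟩
  · obtain ⟨h1, h2⟩ := hin e he hf
    exact ⟨⟨h2, h1, .sUp _ _ hf.2⟩, by simp [famS, VFam.swap, color]⟩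

theorem fine_famT (hk : 3 ≤ k) (hd : 0 < d) (pd : ℕ) :
    I.famT.Fine I pd 12 ∧ I.famT.swap.Fine I pd 13 := by
  have hin : ∀ e < nQ k n * nX k d, I.famT.flag e → I.InG (I.Pad pd) (I.famT.src e) ∧
      I.InG (I.Pad pd) (I.famT.dst e) := by
    intro e he hf
    have hQ : e / nX k d < nQ k n := div_lt_of_lt_mul_right (by assumption)
    have hX : e % nX k d < nX k d := Nat.mod_lt _ (nX_pos k hd)
    have hP : e / nX k d / (n + 1) < nB k n :=
      Nat.div_lt_of_lt_mul (by rw [mul_comm, ← nQ_eq hk]; exact hQ)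
    exact ⟨⟨by omega, le_rfl, hP, hX, (alive_rel (by omega) le_rfl hP hX).1 hf.1⟩, by omega, hQ⟩
  have hinj : ∀ e e', I.famT.src e = I.famT.src e' → I.famT.dst e = I.famT.dst e' → e = e' := by
    intro e e' h h'
    simp only [famT, Vtx.blk.injEq, Vtx.mid.injEq] at h h'
    exact eq_of_div_mod h'.2 h.2.2
  have hne : k - 1 ≠ k - 2 := by omega
  refine ⟨⟨fun e he hf => ?_, fun e _ e' _ _ _ => hinj e e'⟩,
    ⟨fun e he hf => ?_, fun e _ e' _ _ _ h h' => hinj e e' h' h⟩⟩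
  · obtain ⟨h1, h2⟩ := hin e he hf
    exact ⟨⟨h1, h2, .tDown _ _ hf.2⟩, by simp [famT, color, hne]⟩
  · obtain ⟨h1, h2⟩ := hin e he hf
    exact ⟨⟨h2, h1, .tUp _ _ hf.2⟩, by simp [famT, VFam.swap, color, hne]⟩

theorem mC_le (hk : 3 ≤ k) (hd : 0 < d) (e : ℕ) : mC k n d e ≤ n := by
  have h : e % (nQ k n * nX k d) < nQ k n * nX k d :=
    Nat.mod_lt _ (Nat.mul_pos (nQ_pos k n) (nX_pos k hd))
  have hQ : e % (nQ k n * nX k d) / nX k d < nQ k n := div_lt_of_lt_mul_right (by assumption)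
  exact Nat.lt_succ_iff.1 (Nat.div_lt_of_lt_mul (hQ.trans_eq (nQ_eq hk n)))

/-- The index can be recovered from the arc: layer, tuple and coordinates from the tail, the new
vector from the overwritten digit of the head. -/
theorem fine_famM (hk : 3 ≤ k) (hd : 0 < d) (pd : ℕ) :
    I.famM.Fine I pd 10 ∧ I.famM.swap.Fine I pd 11 := by
  have hi : ∀ e < (k - 2) * (nQ k n * nX k d), mi k n d e ≤ k - 2 := by
    intro e he
    have := div_lt_of_lt_mul_right he
    rw [mi]
    omega
  have hX : ∀ e, e % nX k d < nX k d := fun e => Nat.mod_lt _ (nX_pos k hd)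
  have hP : ∀ e, mP k n d e < nB k n := fun e => Nat.mod_lt _ (nB_pos k n)
  have hi1 : ∀ e, 1 ≤ mi k n d e := fun e => Nat.le_add_right _ _
  have hP' : ∀ e < (k - 2) * (nQ k n * nX k d), mP' k n d e < nB k n := fun e he =>
    setDigit_lt (Nat.lt_succ_of_le (mC_le hk hd e)) (by have := hi1 e; omega) (hP e)
  have hin : ∀ e < (k - 2) * (nQ k n * nX k d), I.famM.flag e →
      I.InG (I.Pad pd) (I.famM.src e) ∧ I.InG (I.Pad pd) (I.famM.dst e) := by
    intro e he hf
    have := hi e he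
    have := hi1 e
    exact ⟨⟨hi1 e, by omega, hP e, hX e, (alive_rel (hi1 e) (by omega) (hP e) (hX e)).1 hf.1⟩,
      by omega, by omega, hP' e he, hX e,
      (alive_rel (by omega) (by omega) (hP' e he) (hX e)).1 hf.2⟩
  have hinj : ∀ e e', I.famM.src e = I.famM.src e' → I.famM.dst e = I.famM.dst e' → e = e' := by
    intro e e' h h'
    simp only [famM, Vtx.mid.injEq, mP'] at h h'
    obtain ⟨h1, h2, h3⟩ := h
    have hc : mC k n d e = mC k n d e' := by
      have := congrArg (fun x => dig (n + 1) x (k - 2 - mi k n d e)) h'.2.1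
      rwa [dig_setDigit (Nat.lt_succ_of_le (mC_le hk hd e)), if_pos rfl, h1,
        dig_setDigit (Nat.lt_succ_of_le (mC_le hk hd e')), if_pos rfl] at this
    refine eq_of_div_mod (q := nQ k n * nX k d) (Nat.add_left_cancel h1)
      (eq_of_div_mod (q := nX k d) (eq_of_div_mod hc h2) ?_)
    rwa [mul_comm, Nat.mod_mul_right_mod, Nat.mod_mul_right_mod]
  refine ⟨⟨fun e he hf => ?_, fun e _ e' _ _ _ => hinj e e'⟩,
    ⟨fun e he hf => ?_, fun e _ e' _ _ _ h h' => hinj e e' h' h⟩⟩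
  · obtain ⟨h1, h2⟩ := hin e he hf
    exact ⟨⟨h1, h2, .mDown _ _ _ _ (hi e he) (mC_le hk hd e)⟩, by simp [famM, color]⟩
  · obtain ⟨h1, h2⟩ := hin e he hf
    exact ⟨⟨h2, h1, .mUp _ _ _ _ (hi e he) (mC_le hk hd e)⟩, by simp [famM, VFam.swap, color]⟩

end OVInstance


/-! ### The families contain every arc exactly once -/

namespace OVInstance

variable {k n d : ℕ} {I : OVInstance k n d}

theorem inG_blk {pd g e : ℕ} (hg : g < 2 * (k - 1)) :
    I.InG (I.Pad pd) (.blk g (e % nQ k n)) := ⟨hg, Nat.mod_lt _ (nQ_pos k n)⟩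

theorem inner_inj {e e' : ℕ} (h : I.inner e = I.inner e') : e = e' := by
  have := congrArg (enc k n d) h
  rw [enc_inner, enc_inner] at this
  omega

theorem inner_mid_last {e : ℕ} (h : I.Alive e) (hk : 3 ≤ k) (he : e / nP k n d = k - 2) :
    I.inner e = .mid (k - 1) (e % nP k n d / nX k d) (e % nX k d) := by
  rw [inner_of_alive h, he]; congr 1; omega

theorem inner_mid_one {e : ℕ} (h : I.Alive e) (he : e < nP k n d) :
    I.inner e = .mid 1 (e % nP k n d / nX k d) (e % nX k d) := by
  rw [inner_of_alive h, Nat.div_eq_of_lt he]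

theorem fine_vfam (hk : 3 ≤ k) (hd : 0 < d) (pd : ℕ) : ∀ i < 14, (I.vfam pd i).Fine I pd i := by
  intro i hi
  interval_cases i
  · refine ⟨fun e he hf => ?_, fun e _ e' _ _ _ h _ => ?_⟩
    · have h1 : e / nQ k n < 2 * (k - 1) := div_lt_of_lt_mul_right he
      obtain ⟨h2, h3⟩ := hf
      exact ⟨⟨inG_blk h1, inG_blk (by omega), .chain _ _ h2⟩, rfl⟩
    · simp only [vfam, Vtx.blk.injEq] at h
      exact eq_of_div_mod h.1 h.2
  · refine ⟨fun e he hf => ?_, fun e _ e' _ _ _ _ h => ?_⟩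
    · have h1 : e / nQ k n < min 3 (k - 1) := div_lt_of_lt_mul_right he
      exact ⟨⟨trivial, inG_blk (by omega), .low _ _ (by omega) (by omega)⟩, rfl⟩
    · simp only [vfam, Vtx.blk.injEq] at h
      exact eq_of_div_mod h.1 h.2
  · refine ⟨fun e he hf => ?_, fun e _ e' _ _ _ h _ => ?_⟩
    · have h1 : e / nQ k n < min 3 (k - 1) := div_lt_of_lt_mul_right he
      simp only [vfam]
      generalize e / nQ k n = g at h1 ⊢
      exact ⟨⟨inG_blk (by omega), trivial, .high _ _ (by omega) (by omega)⟩, rfl⟩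
    · simp only [vfam, Vtx.blk.injEq] at h
      exact eq_of_div_mod (Nat.add_left_cancel h.1) h.2
  · refine ⟨fun e he hf => ?_, fun e _ e' _ _ _ _ h => inner_inj h⟩
    have hG := inG_inner (I := I) hd he
    by_cases ha : I.Alive e
    · obtain ⟨h3, hp⟩ := hf.resolve_left (not_not.2 ha)
      have hE := inner_mid_one ha hp
      simp only [vfam]
      rw [hE] at hG ⊢
      exact ⟨⟨trivial, hG, .lowMid _ _ h3⟩, rfl⟩
    · have hE := inner_of_not_alive ha
      simp only [vfam]
      rw [hE] at hG ⊢
      exact ⟨⟨trivial, hG, .deadIn _⟩, rfl⟩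
  · refine ⟨fun e he hf => ?_, fun e _ e' _ _ _ h _ => inner_inj h⟩
    have hG := inG_inner (I := I) hd he
    have hE := inner_mid_last hf.1 hk hf.2
    simp only [vfam]
    rw [hE] at hG ⊢
    exact ⟨⟨hG, trivial, .midH2 _ _⟩, rfl⟩
  · refine ⟨fun e he hf => ?_, fun e _ e' _ _ _ h _ => inner_inj h⟩
    have hG := inG_inner (I := I) hd he
    have hE := inner_mid_last hf.2.1 hk hf.2.2
    simp only [vfam]
    rw [hE] at hG ⊢
    exact ⟨⟨hG, trivial, .midH1 _ _ hf.1⟩, rfl⟩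
  · refine ⟨fun e he hf => ?_, fun e _ e' _ _ _ _ h => inner_inj h⟩
    have hG := inG_inner (I := I) hd he
    have hE := inner_mid_one hf.1 hf.2
    simp only [vfam]
    rw [hE] at hG ⊢
    exact ⟨⟨trivial, hG, .h1Mid _ _⟩, rfl⟩
  · refine ⟨fun e he hf => ?_, fun e _ e' _ _ _ h _ => inner_inj h⟩
    have hG := inG_inner (I := I) hd he
    have hE := inner_of_not_alive hf
    simp only [vfam]
    rw [hE] at hG ⊢
    exact ⟨⟨hG, inG_blk_zero (by omega), .deadOut _⟩, rfl⟩
  · exact (fine_famS hk hd pd).1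
  · exact (fine_famS hk hd pd).2
  · exact (fine_famM hk hd pd).1
  · exact (fine_famM hk hd pd).2
  · exact (fine_famT hk hd pd).1
  · exact (fine_famT hk hd pd).2

theorem cM_le {pd e : ℕ} (h : e < (k - 1) * nP k n d) : e < cM k n d pd := by unfold cM; omega

theorem famS_cover {Q X : ℕ} (hQ : Q < nQ k n)
    (hv : ∃ pd, I.InG (I.Pad pd) (.mid 1 (Q % nB k n) X))
    (h : I.Wok (k - 2) (dig (n + 1) Q (k - 2)) (dig d X (k - 2))) :
    ∃ e < I.famS.cnt, I.famS.flag e ∧ I.famS.src e = .blk (k - 2) Q ∧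
      I.famS.dst e = .mid 1 (Q % nB k n) X := by
  obtain ⟨pd, hi, hi', hP, hX, hv⟩ := hv
  have hX' : X < nX k d := hX
  refine ⟨Q * nX k d + X, pair_lt hQ hX, ?_⟩
  simp only [famS, pair_div hX', pair_mod hX']
  exact ⟨⟨(alive_rel hi hi' hP hX).2 hv, h⟩, trivial, trivial⟩

theorem famT_cover {Q X : ℕ} (hQ : Q < nQ k n)
    (hv : ∃ pd, I.InG (I.Pad pd) (.mid (k - 1) (Q / (n + 1)) X))
    (h : I.Wok 1 (dig (n + 1) Q 0) (dig d X 0)) :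
    ∃ e < I.famT.cnt, I.famT.flag e ∧ I.famT.src e = .mid (k - 1) (Q / (n + 1)) X ∧
      I.famT.dst e = .blk (k - 1) Q := by
  obtain ⟨pd, hi, hi', hP, hX, hv⟩ := hv
  have hX' : X < nX k d := hX
  refine ⟨Q * nX k d + X, pair_lt hQ hX, ?_⟩
  simp only [famT, pair_div hX', pair_mod hX']
  exact ⟨⟨(alive_rel hi hi' hP hX).2 hv, h⟩, trivial, trivial⟩

theorem famM_cover (hk : 3 ≤ k) {pd i P X c : ℕ} (hi : i ≤ k - 2) (hc : c ≤ n)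
    (hu : I.InG (I.Pad pd) (.mid i P X))
    (hv : I.InG (I.Pad pd) (.mid (i + 1) (setDigit (n + 1) P (k - 2 - i) c) X)) :
    ∃ e < I.famM.cnt, I.famM.flag e ∧ I.famM.src e = .mid i P X ∧
      I.famM.dst e = .mid (i + 1) (setDigit (n + 1) P (k - 2 - i) c) X := by
  obtain ⟨hi1, hi2, hP, hX, hV⟩ := hu
  obtain ⟨hj1, hj2, hP', -, hV'⟩ := hv
  have hX' : X < nX k d := hX
  have hPB : P < nB k n := hP
  have hQ : c * nB k n + P < nQ k n := by
    rw [nQ_eq hk, mul_comm (nB k n)]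
    exact pair_lt (by omega) hPB
  have hQX : (c * nB k n + P) * nX k d + X < nQ k n * nX k d := pair_lt hQ hX'
  -- Mixed radix code of `(i - 1, c, P, X)`; the pair `(c, P)` ranges over as many values as there
  -- are `(k - 1)`-tuples.
  set e := (i - 1) * (nQ k n * nX k d) + ((c * nB k n + P) * nX k d + X) with he
  have e1 : mi k n d e = i := by rw [mi, he, pair_div hQX]; omega
  have e2 : mP k n d e = P := by rw [mP, he, pair_mod hQX, pair_div hX', pair_mod hPB]
  have e3 : mC k n d e = c := by rw [mC, he, pair_mod hQX, pair_div hX', pair_div hPB]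
  have e4 : e % nX k d = X := by
    rw [he, show (i - 1) * (nQ k n * nX k d) + ((c * nB k n + P) * nX k d + X) =
      ((i - 1) * nQ k n + (c * nB k n + P)) * nX k d + X by ring, pair_mod hX']
  refine ⟨e, pair_lt (by omega) hQX, ?_⟩
  simp only [famM, mP', e1, e2, e3, e4]
  exact ⟨⟨(alive_rel hi1 hi2 hP hX).2 hV, (alive_rel hj1 hj2 hP' hX).2 hV'⟩, trivial, trivial⟩

theorem vfam_cover (hk : 3 ≤ k) {pd : ℕ} {u v : Vtx} (h : I.Arc (I.Pad pd) u v) :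
    ∃ i < 14, ∃ e < (I.vfam pd i).cnt, (I.vfam pd i).flag e ∧ (I.vfam pd i).src e = u ∧
      (I.vfam pd i).dst e = v := by
  obtain ⟨hu, hv, h⟩ := h
  have hmid : ∀ {i P X : ℕ}, I.InG (I.Pad pd) (.mid i P X) → P < nB k n ∧ X < nX k d ∧
      I.Alive (rel k n d i P X) ∧ rel k n d i P X < cM k n d pd ∧
      rel k n d i P X / nP k n d = i - 1 := fun h =>
    ⟨h.2.2.1, h.2.2.2.1, (alive_rel h.1 h.2.1 h.2.2.1 h.2.2.2.1).2 h.2.2.2.2,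
      cM_le (rel_lt h.1 h.2.1 h.2.2.1 h.2.2.2.1), rel_div h.2.2.1 h.2.2.2.1⟩
  have hone : ∀ {P X : ℕ}, I.InG (I.Pad pd) (.mid 1 P X) → rel k n d 1 P X < nP k n d := by
    intro P X h
    have := inner_lt (hmid h).1 (hmid h).2.1
    rw [rel]
    omega
  cases h with
  | chain g Q hg =>
    have hQ : Q < nQ k n := hu.2
    refine ⟨0, by norm_num, g * nQ k n + Q, pair_lt hu.1 hQ, ?_⟩
    have := hv.1
    simp only [vfam, pair_div hQ, pair_mod hQ]
    exact ⟨⟨hg, by omega⟩, trivial, trivial⟩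
  | low g Q h h' =>
    have hQ : Q < nQ k n := hv.2
    refine ⟨1, by norm_num, g * nQ k n + Q, pair_lt (by omega) hQ, ?_⟩
    simp only [vfam, pair_div hQ, pair_mod hQ]
    exact ⟨trivial, trivial, trivial⟩
  | high g Q h h' =>
    have hQ : Q < nQ k n := hu.2
    have hg := hu.1
    refine ⟨2, by norm_num, (g - (2 * (k - 1) - min 3 (k - 1))) * nQ k n + Q,
      pair_lt (by omega) hQ, ?_⟩
    simp only [vfam, pair_div hQ, pair_mod hQ]
    exact ⟨trivial, by congr 1; omega, trivial⟩
  | deadIn e => exact ⟨3, by norm_num, e, hv.1, .inl hv.2, rfl, inner_of_not_alive hv.2⟩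
  | deadOut e => exact ⟨7, by norm_num, e, hu.1, hu.2, inner_of_not_alive hu.2, rfl⟩
  | lowMid P X h =>
    exact ⟨3, by norm_num, _, (hmid hv).2.2.2.1, .inr ⟨h, hone hv⟩, rfl, inner_rel hv⟩
  | midH2 P X =>
    exact ⟨4, by norm_num, _, (hmid hu).2.2.2.1,
      ⟨(hmid hu).2.2.1, by rw [(hmid hu).2.2.2.2]; omega⟩, inner_rel hu, rfl⟩
  | midH1 P X h =>
    exact ⟨5, by norm_num, _, (hmid hu).2.2.2.1,
      ⟨h, (hmid hu).2.2.1, by rw [(hmid hu).2.2.2.2]; omega⟩, inner_rel hu, rfl⟩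
  | h1Mid P X =>
    exact ⟨6, by norm_num, _, (hmid hv).2.2.2.1, ⟨(hmid hv).2.2.1, hone hv⟩, rfl, inner_rel hv⟩
  | sDown Q X h => exact ⟨8, by norm_num, famS_cover hu.2 ⟨pd, hv⟩ h⟩
  | sUp Q X h =>
    obtain ⟨e, h1, h2, h3, h4⟩ := famS_cover hv.2 ⟨pd, hu⟩ h
    exact ⟨9, by norm_num, e, h1, h2, h4, h3⟩
  | mDown i P X c hi hc => exact ⟨10, by norm_num, famM_cover hk hi hc hu hv⟩
  | mUp i P X c hi hc =>
    obtain ⟨e, h1, h2, h3, h4⟩ := famM_cover hk hi hc hv hu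
    exact ⟨11, by norm_num, e, h1, h2, h4, h3⟩
  | tDown Q X h => exact ⟨12, by norm_num, famT_cover hv.2 ⟨pd, hu⟩ h⟩
  | tUp Q X h =>
    obtain ⟨e, h1, h2, h3, h4⟩ := famT_cover hu.2 ⟨pd, hv⟩ h
    exact ⟨13, by norm_num, e, h1, h2, h4, h3⟩

/-! ### The graph as a list of edges, and its distances -/

/-- The edges of the graph of an instance. -/
noncomputable def edgeList (I : OVInstance k n d) (pd : ℕ) : List (ℕ × ℕ) :=
  (List.range 14).flatMap fun i => (I.vfam pd i).list k n d

theorem mem_edgeList (hk : 3 ≤ k) (hd : 0 < d) {pd : ℕ} {p : ℕ × ℕ} : p ∈ I.edgeList pd ↔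
    ∃ u v, I.Arc (I.Pad pd) u v ∧ (enc k n d u, enc k n d v) = p := by
  simp only [edgeList, List.mem_flatMap, List.mem_range, VFam.mem_list]
  constructor
  · rintro ⟨i, hi, e, he, hf, h⟩
    exact ⟨_, _, ((fine_vfam hk hd pd i hi).1 e he hf).1, h⟩
  · rintro ⟨u, v, h, hp⟩
    obtain ⟨i, hi, e, he, hf, rfl, rfl⟩ := vfam_cover hk h
    exact ⟨i, hi, e, he, hf, hp⟩

/-- Inside a family the arcs differ by the second half of `Fine`; different families have different
colors. -/
theorem nodup_edgeList (hk : 3 ≤ k) (hd : 0 < d) (pd : ℕ) : (I.edgeList pd).Nodup := by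
  rw [edgeList, List.nodup_flatMap]
  constructor
  · intro i hi
    obtain ⟨h1, h2⟩ := fine_vfam (I := I) hk hd pd i (List.mem_range.1 hi)
    refine List.Nodup.map_on ?_ (List.nodup_range.filter _)
    simp only [List.mem_filter, List.mem_range, decide_eq_true_eq, Prod.mk.injEq]
    rintro e ⟨he, hf⟩ e' ⟨he', hf'⟩ ⟨hs, ht⟩
    obtain ⟨⟨a1, a2, -⟩, -⟩ := h1 e he hf
    obtain ⟨⟨b1, b2, -⟩, -⟩ := h1 e' he' hf'
    exact h2 e he e' he' hf hf' (enc_inj a1 b1 hs) (enc_inj a2 b2 ht)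
  · refine List.nodup_range.pairwise_of_forall_ne fun i hi j hj hij p hpi hpj => ?_
    rw [List.mem_range] at hi hj
    rw [VFam.mem_list] at hpi hpj
    obtain ⟨e, he, hf, h⟩ := hpi
    obtain ⟨e', he', hf', h'⟩ := hpj
    obtain ⟨⟨a1, a2, -⟩, hc⟩ := (fine_vfam (I := I) hk hd pd i hi).1 e he hf
    obtain ⟨⟨b1, b2, -⟩, hc'⟩ := (fine_vfam (I := I) hk hd pd j hj).1 e' he' hf'
    rw [← h', Prod.mk.injEq] at h
    rw [enc_inj a1 b1 h.1, enc_inj a2 b2 h.2, hc'] at hc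
    exact hij hc.symm

theorem arc₀_ne {u v : Vtx} (h : I.Arc₀ u v) : u ≠ v := by
  rintro rfl
  cases h

/-- The number of vertices of the graph. -/
def numV (k n d pd : ℕ) : ℕ := zV k n + cM k n d pd

theorem edgeList_lt (hk : 3 ≤ k) (hd : 0 < d) {pd : ℕ} :
    ∀ p ∈ I.edgeList pd, p.1 < numV k n d pd ∧ p.2 < numV k n d pd := by
  intro p hp
  obtain ⟨u, v, h, rfl⟩ := (mem_edgeList hk hd).1 hp
  exact ⟨enc_lt h.1, enc_lt h.2.1⟩

/-- The graph of an instance. -/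
noncomputable def graph (I : OVInstance k n d) (hk : 3 ≤ k) (hd : 0 < d) (pd : ℕ) :
    EdgeListGraph (numV k n d pd) where
  edges := (I.edgeList pd).pmap (fun p h => (⟨p.1, h.1⟩, ⟨p.2, h.2⟩)) (edgeList_lt hk hd)
  nodup := by
    refine List.Nodup.pmap ?_ (nodup_edgeList hk hd pd)
    rintro ⟨a, b⟩ _ ⟨a', b'⟩ _ h
    simp only [Prod.mk.injEq, Fin.mk.injEq] at h ⊢
    exact h
  loopless := by
    intro e he
    rw [List.mem_pmap] at he
    obtain ⟨p, hp, rfl⟩ := he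
    obtain ⟨u, v, h, rfl⟩ := (mem_edgeList hk hd).1 hp
    intro h'
    rw [Fin.mk.injEq] at h'
    exact arc₀_ne h.2.2 (enc_inj h.1 h.2.1 h')

theorem mem_graph_edges (hk : 3 ≤ k) (hd : 0 < d) {pd : ℕ} {x y : Fin (numV k n d pd)} :
    (x, y) ∈ (I.graph hk hd pd).edges ↔
      ∃ u v, I.Arc (I.Pad pd) u v ∧ enc k n d u = x ∧ enc k n d v = y := by
  simp only [graph, List.mem_pmap]
  constructor
  · rintro ⟨p, hp, h⟩
    obtain ⟨u, v, ha, rfl⟩ := (mem_edgeList hk hd).1 hp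
    rw [Prod.mk.injEq] at h
    exact ⟨u, v, ha, by rw [← h.1], by rw [← h.2]⟩
  · rintro ⟨u, v, ha, hx, hy⟩
    exact ⟨(x, y), (mem_edgeList hk hd).2 ⟨u, v, ha, by rw [hx, hy]⟩, rfl⟩

theorem relWalk_of_hasWalk (hk : 3 ≤ k) (hd : 0 < d) {pd m : ℕ} {x y : Fin (numV k n d pd)}
    (h : (I.graph hk hd pd).HasWalk m x y) : ∀ u, I.InG (I.Pad pd) u → enc k n d u = x →
      ∃ v, I.InG (I.Pad pd) v ∧ enc k n d v = y ∧ RelWalk (I.Arc (I.Pad pd)) m u v := by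
  induction h with
  | nil x => exact fun u hu hx => ⟨u, hu, hx, .nil u⟩
  | cons h _ ih =>
    intro u hu hx
    obtain ⟨u', v', ha, hu', hv'⟩ := (mem_graph_edges hk hd).1 h
    obtain rfl := enc_inj hu ha.1 (hx.trans hu'.symm)
    obtain ⟨v, hv, hy, hw⟩ := ih v' ha.2.1 hv'
    exact ⟨v, hv, hy, .cons ha hw⟩

theorem hasWalk_of_relWalk (hk : 3 ≤ k) (hd : 0 < d) {pd m : ℕ} {u v : Vtx}
    (h : RelWalk (I.Arc (I.Pad pd)) m u v) : ∀ x y : Fin (numV k n d pd),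
      enc k n d u = x → enc k n d v = y → (I.graph hk hd pd).HasWalk m x y := by
  induction h with
  | nil u =>
    intro x y hx hy
    obtain rfl : x = y := Fin.ext (hx.symm.trans hy)
    exact .nil x
  | cons ha _ ih =>
    intro x y hx hy
    exact .cons ((mem_graph_edges hk hd (y := ⟨_, enc_lt ha.2.1⟩)).2 ⟨_, _, ha, hx, rfl⟩)
      (ih _ y rfl hy)

theorem dist_graph_le (hk : 3 ≤ k) (hn : 0 < n) (hd : 0 < d) (pd : ℕ) (hI : ¬ I.HasSolution)
    (x y : Fin (numV k n d pd)) : (I.graph hk hd pd).dist x y ≤ ((3 * k - 4 : ℕ) : ℕ∞) := by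
  obtain ⟨u, hu, hx⟩ := exists_enc (I := I) hd x.2
  obtain ⟨v, hv, hy⟩ := exists_enc (I := I) hd y.2
  obtain ⟨m, hm, h⟩ := within_of_not_hasSolution hk hn hI hu hv
  exact (iInf₂_le m (hasWalk_of_relWalk hk hd h x y hx hy)).trans (by exact_mod_cast hm)

theorem le_dist_graph (hk : 3 ≤ k) (hd : 0 < d) (pd : ℕ) (hI : I.HasSolution) :
    ∃ x y : Fin (numV k n d pd), ((5 * k - 7 : ℕ) : ℕ∞) ≤ (I.graph hk hd pd).dist x y := by
  obtain ⟨u, v, hu, hv, h⟩ := exists_long (dd := I.Pad pd) hk hd hI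
  refine ⟨⟨_, enc_lt hu⟩, ⟨_, enc_lt hv⟩, le_iInf₂ fun m hm => ?_⟩
  obtain ⟨v', hv', he, hw⟩ := relWalk_of_hasWalk hk hd hm u hu rfl
  obtain rfl := enc_inj hv' hv he
  exact_mod_cast h m hw

end OVInstance


namespace WordRAM

infixl:65 " +ₑ " => Ex.bin BinOp.add
infixl:65 " -ₑ " => Ex.bin BinOp.sub
infixl:70 " *ₑ " => Ex.bin BinOp.mul
infixl:70 " /ₑ " => Ex.bin BinOp.div
infixl:70 " %ₑ " => Ex.bin BinOp.mod
infix:50 " <ₑ " => Ex.bin BinOp.lt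
infix:50 " =ₑ " => Ex.bin BinOp.eq

open Ex

/-! ### The program for large instances

Registers `0`, `1`, `8`, …, `14` hold `n`, `d`, `n + 1`, `nB`, `nQ`, `nX`, `nP`, `zV` and `cM`;
arrays `3` and `4` hold the powers of `n + 1` and `d`, and array `5` tells which inner vertices are
valid. -/

/-- The test `I.Wok l q x`. -/
def wokE (l q x : Ex) : Ex :=
  lit 0 <ₑ (q =ₑ var 0) +ₑ ld 0 ((l *ₑ var 0 +ₑ q) *ₑ var 1 +ₑ x)

/-- One step of the test for validity of inner vertex number `var 2`. -/
def validE (k : ℕ) : Ex :=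
  let r := var 4 /ₑ lit (k - 1)
  let j := var 4 %ₑ lit (k - 1)
  let q := var 2 %ₑ var 12 /ₑ var 11 /ₑ ld 3 r %ₑ var 8
  let x := var 2 %ₑ var 11 /ₑ ld 4 j %ₑ var 1
  let a := r +ₑ (lit 1 +ₑ var 2 /ₑ var 12) <ₑ lit (k - 1)
  var 6 *ₑ (lit 0 <ₑ
    a *ₑ (lit 0 <ₑ (lit 1 -ₑ (r <ₑ j +ₑ lit 1)) +ₑ wokE r q x) +ₑ
    (lit 1 -ₑ a) *ₑ (lit 0 <ₑ (lit 1 -ₑ (j <ₑ r +ₑ lit 2)) +ₑ wokE (r +ₑ lit 2) q x))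

/-- The families of edges in the same order as `OVInstance.vfam`. -/
def fam (k : ℕ) : ℕ → Fam
  | 0 => ⟨lit (2 * (k - 1)) *ₑ var 10,
      (lit 1 -ₑ (var 2 /ₑ var 10 =ₑ lit (k - 2))) *ₑ
        (lit 1 -ₑ (var 2 /ₑ var 10 =ₑ lit (2 * k - 3))), var 2, var 2 +ₑ var 10⟩
  | 1 => ⟨lit (min 3 (k - 1)) *ₑ var 10, lit 1, var 13 -ₑ lit 1, var 2⟩
  | 2 => ⟨lit (min 3 (k - 1)) *ₑ var 10, lit 1,
      lit (2 * (k - 1) - min 3 (k - 1)) *ₑ var 10 +ₑ var 2, var 13 -ₑ lit 2⟩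
  | 3 => ⟨var 14, (lit 1 -ₑ ld 5 (var 2)) +ₑ (lit k =ₑ lit 3) *ₑ (var 2 <ₑ var 12),
      var 13 -ₑ lit 1, var 13 +ₑ var 2⟩
  | 4 => ⟨var 14, ld 5 (var 2) *ₑ (var 2 /ₑ var 12 =ₑ lit (k - 2)),
      var 13 +ₑ var 2, var 13 -ₑ lit 1⟩
  | 5 => ⟨var 14, (lit k =ₑ lit 3) *ₑ (ld 5 (var 2) *ₑ (var 2 /ₑ var 12 =ₑ lit (k - 2))),
      var 13 +ₑ var 2, var 13 -ₑ lit 2⟩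
  | 6 => ⟨var 14, ld 5 (var 2) *ₑ (var 2 <ₑ var 12), var 13 -ₑ lit 2, var 13 +ₑ var 2⟩
  | 7 => ⟨var 14, lit 1 -ₑ ld 5 (var 2), var 13 +ₑ var 2, var 10⟩
  | 8 => sF
  | 9 => ⟨sF.cnt, sF.flag, sF.dst, sF.src⟩
  | 10 => mF
  | 11 => ⟨mF.cnt, mF.flag, mF.dst, mF.src⟩
  | 12 => tF
  | _ => ⟨tF.cnt, tF.flag, tF.dst, tF.src⟩
where
  sF : Fam :=
    let Q := var 2 /ₑ var 11
    let X := var 2 %ₑ var 11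
    let r := Q %ₑ var 9 *ₑ var 11 +ₑ X
    ⟨var 10 *ₑ var 11,
      ld 5 r *ₑ wokE (lit (k - 2)) (Q /ₑ var 9 %ₑ var 8) (X /ₑ ld 4 (lit (k - 2)) %ₑ var 1),
      lit (k - 2) *ₑ var 10 +ₑ Q, var 13 +ₑ r⟩
  tF : Fam :=
    let Q := var 2 /ₑ var 11
    let X := var 2 %ₑ var 11
    let r := lit (k - 2) *ₑ var 12 +ₑ (Q /ₑ var 8 *ₑ var 11 +ₑ X)
    ⟨var 10 *ₑ var 11, ld 5 r *ₑ wokE (lit 1) (Q %ₑ var 8) (X %ₑ var 1),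
      var 13 +ₑ r, lit (k - 1) *ₑ var 10 +ₑ Q⟩
  mF : Fam :=
    let i := var 2 /ₑ (var 10 *ₑ var 11)
    let Q := var 2 %ₑ (var 10 *ₑ var 11) /ₑ var 11
    let X := var 2 %ₑ var 11
    let P := Q %ₑ var 9
    let p := ld 3 (lit (k - 3) -ₑ i)
    let P' := P %ₑ p +ₑ Q /ₑ var 9 *ₑ p +ₑ P /ₑ (p *ₑ var 8) *ₑ (p *ₑ var 8)
    let r := i *ₑ var 12 +ₑ (P *ₑ var 11 +ₑ X)
    let r' := (i +ₑ lit 1) *ₑ var 12 +ₑ (P' *ₑ var 11 +ₑ X)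
    ⟨lit (k - 2) *ₑ (var 10 *ₑ var 11), ld 5 r *ₑ ld 5 r', var 13 +ₑ r, var 13 +ₑ r'⟩

/-- The condition on `o` keeps the output arrays apart from the arrays `0`, `3`, `4`, `5` that are
read. The degree bound `60` is the one used for the word length. -/
theorem fam_good {k o M : ℕ} (hk : 3 ≤ k) (hM : 3 * k ≤ M) (ho : o = 0 ∨ 20 ≤ o) :
    ∀ i, (fam k i).Good o M 60 := by
  have h1 : 1 ≤ M := by omega
  have h2 : 2 ≤ M := by omega
  have h3 : 3 ≤ M := by omega
  have hk1 : k ≤ M := by omega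
  have hk2 : k - 1 ≤ M := by omega
  have hk3 : k - 2 ≤ M := by omega
  have hk4 : k - 3 ≤ M := by omega
  have hk5 : 2 * k - 3 ≤ M := by omega
  have hk6 : 2 * (k - 1) ≤ M := by omega
  have hk7 : min 3 (k - 1) ≤ M := by omega
  have hk8 : 2 * (k - 1) - min 3 (k - 1) ≤ M := by omega
  have r0 : 0 ≠ o + 1 ∧ 0 ≠ o + 2 := by omega
  have r3 : 3 ≠ o + 1 ∧ 3 ≠ o + 2 := by omega
  have r4 : 4 ≠ o + 1 ∧ 4 ≠ o + 2 := by omega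
  have r5 : 5 ≠ o + 1 ∧ 5 ≠ o + 2 := by omega
  intro i
  unfold fam
  split <;> constructor <;> (try constructor) <;>
    simp only [fam.sF, fam.mF, fam.tF, wokE, Ex.Vars, Ex.Tame, Ex.deg, Ex.Reads, Glob, GlobE,
      h1, h2, h3, hk1, hk2, hk3, hk4, hk5, hk6, hk7, hk8, and_true, true_and,
      Nat.zero_le, and_self] <;> trivial

theorem fam_cost (k : ℕ) : ∀ i, (fam k i).flag.cost + (fam k i).src.cost +
    (fam k i).dst.cost + (fam k i).cnt.cost + 15 ≤ 300 := by
  intro i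
  unfold fam
  split <;> simp [fam.sF, fam.mF, fam.tF, wokE, Ex.cost]

end WordRAM


/-! ### The expressions of the program compute the families -/

namespace OVInstance

open WordRAM Ex

variable {k n d : ℕ} (I : OVInstance k n d)

open Classical in
/-- The registers and arrays hold what the families of edges need. -/
structure EnvOK (pd : ℕ) (ρ : ℕ → ℕ) (μ : ℕ → ℕ → ℕ) : Prop where
  r0 : ρ 0 = n
  r1 : ρ 1 = d
  r8 : ρ 8 = n + 1
  r9 : ρ 9 = nB k n
  r10 : ρ 10 = nQ k n
  r11 : ρ 11 = nX k d
  r12 : ρ 12 = nP k n d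
  r13 : ρ 13 = zV k n
  r14 : ρ 14 = cM k n d pd
  m0 : ∀ l < k, ∀ q < n, ∀ x < d, μ 0 ((l * n + q) * d + x) = I.bit l q x
  m3 : ∀ r < k, μ 3 r = (n + 1) ^ r
  m4 : ∀ r < k, μ 4 r = d ^ r
  m5 : ∀ e, μ 5 e = if I.Alive e then 1 else 0

variable {I}

theorem bit_le_one (l q x : ℕ) : I.bit l q x ≤ 1 := by
  unfold bit
  split_ifs
  · exact Bool.toNat_le _
  · exact Nat.zero_le _

-- For `q = n` the array access hits an unrelated cell, which does no harm: the equality test alone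
-- makes the sum positive.
open Classical in
theorem ev_wokE {ρ : ℕ → ℕ} {μ : ℕ → ℕ → ℕ} (r0 : ρ 0 = n) (r1 : ρ 1 = d)
    (m0 : ∀ l < k, ∀ q < n, ∀ x < d, μ 0 ((l * n + q) * d + x) = I.bit l q x) {L q x : Ex}
    (hl : L.ev ρ μ < k) (hq : q.ev ρ μ ≤ n) (hx : x.ev ρ μ < d) :
    (wokE L q x).ev ρ μ = if I.Wok (L.ev ρ μ) (q.ev ρ μ) (x.ev ρ μ) then 1 else 0 := by
  simp only [wokE, Ex.ev, BinOp.eval, r0, r1, Wok]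
  generalize L.ev ρ μ = l at *
  generalize q.ev ρ μ = q at *
  generalize x.ev ρ μ = x at *
  by_cases h : q = n
  · simp [h]
  · rw [m0 l hl q (by omega) x hx]
    have := bit_le_one (I := I) l q x
    by_cases h' : I.bit l q x = 1
    · simp [h']
    · have h0 : I.bit l q x = 0 := by omega
      simp [h, h0]

theorem list_eq_of_spec {F : Fam} {V : VFam} {ρ : ℕ → ℕ} {μ : ℕ → ℕ → ℕ}
    (hc : F.cnt.ev ρ μ = V.cnt)
    (h : ∀ e < V.cnt, (F.flag.ev (Function.update ρ 2 e) μ ≠ 0 ↔ V.flag e) ∧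
      F.src.ev (Function.update ρ 2 e) μ = enc k n d (V.src e) ∧
      F.dst.ev (Function.update ρ 2 e) μ = enc k n d (V.dst e)) :
    F.list ρ μ = V.list k n d := by
  classical
  rw [Fam.list, VFam.list, hc]
  have hf : (List.range V.cnt).filter (fun i => decide (F.flag.ev (Function.update ρ 2 i) μ ≠ 0)) =
      (List.range V.cnt).filter fun e => decide (V.flag e) := by
    refine List.filter_congr fun e he => ?_
    rw [List.mem_range] at he
    exact decide_eq_decide.2 (h e he).1
  rw [hf]
  refine List.map_congr_left fun e he => ?_
  rw [List.mem_filter, List.mem_range] at he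
  rw [(h e he.1).2.1, (h e he.1).2.2]

theorem fam_list_eq_low {pd : ℕ} {ρ : ℕ → ℕ} {μ : ℕ → ℕ → ℕ}
    (h : I.EnvOK pd ρ μ) : ∀ i < 8, (fam k i).list ρ μ = (I.vfam pd i).list k n d := by
  intro i hi
  interval_cases i
  · refine list_eq_of_spec (by simp [fam, vfam, Ex.ev, BinOp.eval, h.r10]) fun e he => ⟨?_, ?_, ?_⟩
    · by_cases h1 : e / nQ k n = k - 2 <;> by_cases h2 : e / nQ k n = 2 * k - 3 <;>
        simp [fam, vfam, Ex.ev, BinOp.eval, h.r10, h1, h2]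
    · simp [fam, vfam, Ex.ev, enc, Nat.div_add_mod']
    · simp only [fam, vfam, Ex.ev, BinOp.eval, enc, Function.update_apply, h.r10, add_mul, one_mul]
      have := Nat.div_add_mod' e (nQ k n)
      simp
      omega
  · refine list_eq_of_spec (by simp [fam, vfam, Ex.ev, BinOp.eval, h.r10]) fun e he => ⟨?_, ?_, ?_⟩
    · simp [fam, vfam, Ex.ev]
    · simp [fam, vfam, Ex.ev, BinOp.eval, enc, h.r13]
    · simp [fam, vfam, Ex.ev, enc, Nat.div_add_mod']
  · refine list_eq_of_spec (by simp [fam, vfam, Ex.ev, BinOp.eval, h.r10]) fun e he => ⟨?_, ?_, ?_⟩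
    · simp [fam, vfam, Ex.ev]
    · simp only [fam, vfam, Ex.ev, BinOp.eval, enc, Function.update_apply, h.r10, add_mul]
      have := Nat.div_add_mod' e (nQ k n)
      simp
      omega
    · simp [fam, vfam, Ex.ev, BinOp.eval, enc, h.r13]
  · refine list_eq_of_spec (by simp [fam, vfam, Ex.ev, h.r14]) fun e he => ⟨?_, ?_, ?_⟩
    · simp only [fam, vfam, Ex.ev, BinOp.eval, Function.update_apply, h.m5, h.r12]
      by_cases ha : I.Alive e <;> by_cases h3 : k = 3 <;> by_cases hp : e < nP k n d <;>
        simp [ha, h3, hp]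
    · simp [fam, vfam, Ex.ev, BinOp.eval, enc, h.r13]
    · simp [fam, vfam, Ex.ev, BinOp.eval, enc_inner, h.r13]
  · refine list_eq_of_spec (by simp [fam, vfam, Ex.ev, h.r14]) fun e he => ⟨?_, ?_, ?_⟩
    · simp [fam, vfam, Ex.ev, BinOp.eval, h.m5, h.r12, and_comm]
    · simp [fam, vfam, Ex.ev, BinOp.eval, enc_inner, h.r13]
    · simp [fam, vfam, Ex.ev, BinOp.eval, enc, h.r13]
  · refine list_eq_of_spec (by simp [fam, vfam, Ex.ev, h.r14]) fun e he => ⟨?_, ?_, ?_⟩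
    · by_cases ha : I.Alive e <;> by_cases h3 : k = 3 <;> by_cases hp : e / nP k n d = k - 2 <;>
        simp [fam, vfam, Ex.ev, BinOp.eval, h.m5, h.r12, ha, h3, hp]
    · simp [fam, vfam, Ex.ev, BinOp.eval, enc_inner, h.r13]
    · simp [fam, vfam, Ex.ev, BinOp.eval, enc, h.r13]
  · refine list_eq_of_spec (by simp [fam, vfam, Ex.ev, h.r14]) fun e he => ⟨?_, ?_, ?_⟩
    · simp [fam, vfam, Ex.ev, BinOp.eval, h.m5, h.r12, and_comm]
    · simp [fam, vfam, Ex.ev, BinOp.eval, enc, h.r13]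
    · simp [fam, vfam, Ex.ev, BinOp.eval, enc_inner, h.r13]
  · refine list_eq_of_spec (by simp [fam, vfam, Ex.ev, h.r14]) fun e he => ⟨?_, ?_, ?_⟩
    · by_cases ha : I.Alive e <;> simp [fam, vfam, Ex.ev, BinOp.eval, h.m5, ha]
    · simp [fam, vfam, Ex.ev, BinOp.eval, enc_inner, h.r13]
    · simp [fam, vfam, Ex.ev, enc, h.r10]

theorem spec_famS (hk : 3 ≤ k) (hd : 0 < d) {pd : ℕ} {ρ : ℕ → ℕ} {μ : ℕ → ℕ → ℕ}
    (h : I.EnvOK pd ρ μ) : (fam.sF k).cnt.ev ρ μ = I.famS.cnt ∧ ∀ e,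
      ((fam.sF k).flag.ev (Function.update ρ 2 e) μ ≠ 0 ↔ I.famS.flag e) ∧
      (fam.sF k).src.ev (Function.update ρ 2 e) μ = enc k n d (I.famS.src e) ∧
      (fam.sF k).dst.ev (Function.update ρ 2 e) μ = enc k n d (I.famS.dst e) := by
  classical
  refine ⟨by simp [fam.sF, famS, Ex.ev, BinOp.eval, h.r10, h.r11], fun e => ⟨?_, ?_, ?_⟩⟩
  · simp only [fam.sF, famS]
    set ρ' := Function.update ρ 2 e with hρ'
    have h0 : ρ' 0 = n := by simp [hρ', h.r0]
    have h1 : ρ' 1 = d := by simp [hρ', h.r1]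
    have hw := ev_wokE (I := I) (ρ := ρ') (μ := μ) h0 h1 h.m0 (L := lit (k - 2))
      (q := var 2 /ₑ var 11 /ₑ var 9 %ₑ var 8)
      (x := var 2 %ₑ var 11 /ₑ ld 4 (lit (k - 2)) %ₑ var 1)
      (by simp only [Ex.ev]; omega)
      (by
        simp only [Ex.ev, BinOp.eval]
        rw [show ρ' 8 = n + 1 from by simp [hρ', h.r8]]
        exact Nat.lt_succ_iff.1 (Nat.mod_lt _ (by omega)))
      (by simp only [Ex.ev, BinOp.eval, h1]; exact Nat.mod_lt _ hd)
    rw [Ex.ev, hw]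
    simp only [Ex.ev, BinOp.eval, hρ', Function.update_apply, h.r8, h.r9, h.r11, h.r1, h.m5,
      h.m4 (k - 2) (by omega)]
    simp [rel, dig, nB, and_comm]
  · simp [fam.sF, famS, Ex.ev, BinOp.eval, enc, h.r10, h.r11]
  · simp [fam.sF, famS, Ex.ev, BinOp.eval, enc, rel, h.r9, h.r11, h.r13]

theorem spec_famT (hk : 3 ≤ k) (hd : 0 < d) {pd : ℕ} {ρ : ℕ → ℕ} {μ : ℕ → ℕ → ℕ}
    (h : I.EnvOK pd ρ μ) : (fam.tF k).cnt.ev ρ μ = I.famT.cnt ∧ ∀ e,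
      ((fam.tF k).flag.ev (Function.update ρ 2 e) μ ≠ 0 ↔ I.famT.flag e) ∧
      (fam.tF k).src.ev (Function.update ρ 2 e) μ = enc k n d (I.famT.src e) ∧
      (fam.tF k).dst.ev (Function.update ρ 2 e) μ = enc k n d (I.famT.dst e) := by
  classical
  have hk2 : k - 1 - 1 = k - 2 := by omega
  refine ⟨by simp [fam.tF, famT, Ex.ev, BinOp.eval, h.r10, h.r11], fun e => ⟨?_, ?_, ?_⟩⟩
  · simp only [fam.tF, famT]
    set ρ' := Function.update ρ 2 e with hρ'
    have h0 : ρ' 0 = n := by simp [hρ', h.r0]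
    have h1 : ρ' 1 = d := by simp [hρ', h.r1]
    have hw := ev_wokE (I := I) (ρ := ρ') (μ := μ) h0 h1 h.m0 (L := lit 1)
      (q := var 2 /ₑ var 11 %ₑ var 8)
      (x := var 2 %ₑ var 11 %ₑ var 1)
      (by simp only [Ex.ev]; omega)
      (by
        simp only [Ex.ev, BinOp.eval]
        rw [show ρ' 8 = n + 1 from by simp [hρ', h.r8]]
        exact Nat.lt_succ_iff.1 (Nat.mod_lt _ (by omega)))
      (by simp only [Ex.ev, BinOp.eval, h1]; exact Nat.mod_lt _ hd)
    rw [Ex.ev, hw]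
    simp only [Ex.ev, BinOp.eval, hρ', Function.update_apply, h.r8, h.r12, h.r11, h.r1, h.m5]
    simp [rel, dig, hk2, and_comm]
  · simp [fam.tF, famT, Ex.ev, BinOp.eval, enc, rel, h.r8, h.r11, h.r12,
      h.r13, hk2]
  · simp [fam.tF, famT, Ex.ev, BinOp.eval, enc, h.r10, h.r11]

theorem spec_famM (hk : 3 ≤ k) {pd : ℕ} {ρ : ℕ → ℕ} {μ : ℕ → ℕ → ℕ}
    (h : I.EnvOK pd ρ μ) : (fam.mF k).cnt.ev ρ μ = I.famM.cnt ∧ ∀ e < I.famM.cnt,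
      ((fam.mF k).flag.ev (Function.update ρ 2 e) μ ≠ 0 ↔ I.famM.flag e) ∧
      (fam.mF k).src.ev (Function.update ρ 2 e) μ = enc k n d (I.famM.src e) ∧
      (fam.mF k).dst.ev (Function.update ρ 2 e) μ = enc k n d (I.famM.dst e) := by
  classical
  -- The program counts the inner layers from `0`, while `mi` counts them from `1`.
  have hk2 : ∀ e, k - 2 - (e / (nQ k n * nX k d) + 1) = k - 3 - e / (nQ k n * nX k d) := by
    intro e; omega
  refine ⟨by simp [fam.mF, famM, Ex.ev, BinOp.eval, h.r10, h.r11], fun e he => ?_⟩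
  have h3 := h.m3 (k - 3 - e / (nQ k n * nX k d))
    (lt_of_le_of_lt (Nat.sub_le _ _) (by omega))
  refine ⟨?_, ?_, ?_⟩
  · simp only [fam.mF, famM, Ex.ev, BinOp.eval, Function.update_apply, h.r8, h.r9, h.r10, h.r11,
      h.r12, h.m5]
    simp [rel, mi, mP, mP', mC, setDigit, hk2, h3, pow_succ, add_comm 1, and_comm]
  · simp [fam.mF, famM, Ex.ev, BinOp.eval, enc, rel, mi, mP, h.r9, h.r10,
      h.r11, h.r12, h.r13]
  · simp [fam.mF, famM, Ex.ev, BinOp.eval, enc, h.r8, h.r9, h.r10,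
      h.r11, h.r12, h.r13, rel, mi, mP, mP', mC, setDigit, hk2, h3, pow_succ, add_comm 1]

theorem fam_list_eq (hk : 3 ≤ k) (hd : 0 < d) {pd : ℕ} {ρ : ℕ → ℕ} {μ : ℕ → ℕ → ℕ}
    (h : I.EnvOK pd ρ μ) (i : ℕ) (hi : i < 14) :
    (fam k i).list ρ μ = (I.vfam pd i).list k n d := by
  obtain ⟨s0, s1⟩ := spec_famS hk hd h
  obtain ⟨t0, t1⟩ := spec_famT hk hd h
  obtain ⟨m0, m1⟩ := spec_famM hk h
  rcases Nat.lt_or_ge i 8 with hi' | hi'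
  · exact fam_list_eq_low h i hi'
  · interval_cases i
    · exact list_eq_of_spec s0 fun e _ => s1 e
    · exact list_eq_of_spec s0 fun e _ => ⟨(s1 e).1, (s1 e).2.2, (s1 e).2.1⟩
    · exact list_eq_of_spec m0 m1
    · exact list_eq_of_spec m0 fun e he => ⟨(m1 e he).1, (m1 e he).2.2, (m1 e he).2.1⟩
    · exact list_eq_of_spec t0 fun e _ => t1 e
    · exact list_eq_of_spec t0 fun e _ => ⟨(t1 e).1, (t1 e).2.2, (t1 e).2.1⟩

theorem fams_flatMap (hk : 3 ≤ k) (hd : 0 < d) {pd : ℕ} {ρ : ℕ → ℕ} {μ : ℕ → ℕ → ℕ}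
    (h : I.EnvOK pd ρ μ) :
    ((List.range 14).map (fam k)).flatMap (fun F => F.list ρ μ) = I.edgeList pd := by
  rw [List.flatMap_map, edgeList, List.flatMap_def, List.flatMap_def]
  congr 1
  exact List.map_congr_left fun i hi => fam_list_eq hk hd h i (List.mem_range.1 hi)

end OVInstance


/-! ### The validity test as a fold -/

namespace OVInstance

open WordRAM Ex

variable {k n d : ℕ} {I : OVInstance k n d}

-- The connectives are arithmetic on `0` and `1`: product for "and", positivity of a sum for "or",
-- `1 - a` for "not". The factor `a` is the conjunction accumulated so far.
open Classical in
theorem ev_validE (hk : 3 ≤ k) (hd : 0 < d) {ρ : ℕ → ℕ} {μ : ℕ → ℕ → ℕ} {e j a : ℕ}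
    (r0 : ρ 0 = n) (r1 : ρ 1 = d) (r8 : ρ 8 = n + 1) (r11 : ρ 11 = nX k d)
    (r12 : ρ 12 = nP k n d) (r2 : ρ 2 = e) (r4 : ρ 4 = j) (r6 : ρ 6 = a)
    (m0 : ∀ l < k, ∀ q < n, ∀ x < d, μ 0 ((l * n + q) * d + x) = I.bit l q x)
    (m3 : ∀ r < k, μ 3 r = (n + 1) ^ r) (m4 : ∀ r < k, μ 4 r = d ^ r)
    (hj : j < (k - 2) * (k - 1)) :
    (validE k).ev ρ μ = a * if
      (j / (k - 1) + (1 + e / nP k n d) ≤ k - 2 → j / (k - 1) ≤ j % (k - 1) →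
        I.Wok (j / (k - 1)) (dig (n + 1) (e % nP k n d / nX k d) (j / (k - 1)))
          (dig d (e % nX k d) (j % (k - 1)))) ∧
      (k - 2 < j / (k - 1) + (1 + e / nP k n d) → j % (k - 1) < j / (k - 1) + 2 →
        I.Wok (j / (k - 1) + 2) (dig (n + 1) (e % nP k n d / nX k d) (j / (k - 1)))
          (dig d (e % nX k d) (j % (k - 1)))) then 1 else 0 := by
  have hr : j / (k - 1) < k - 2 := div_lt_of_lt_mul_right hj
  have hc : j % (k - 1) < k - 1 := Nat.mod_lt _ (by omega)
  have hw : ∀ L : Ex, L.ev ρ μ < k → (wokE L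
      (var 2 %ₑ var 12 /ₑ var 11 /ₑ ld 3 (var 4 /ₑ lit (k - 1)) %ₑ var 8)
      (var 2 %ₑ var 11 /ₑ ld 4 (var 4 %ₑ lit (k - 1)) %ₑ var 1)).ev ρ μ =
      if I.Wok (L.ev ρ μ) (dig (n + 1) (e % nP k n d / nX k d) (j / (k - 1)))
          (dig d (e % nX k d) (j % (k - 1))) then 1 else 0 := by
    intro L hL
    rw [ev_wokE r0 r1 m0 hL]
    · simp only [Ex.ev, BinOp.eval, r2, r4, r8, r11, r12, r1, m3 _ (show j / (k - 1) < k by omega),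
        m4 _ (show j % (k - 1) < k by omega), dig]
      exact if_congr Iff.rfl rfl rfl
    · simp only [Ex.ev, BinOp.eval, r8]
      exact Nat.lt_succ_iff.1 (Nat.mod_lt _ (by omega))
    · simp only [Ex.ev, BinOp.eval, r1]
      exact Nat.mod_lt _ hd
  have h1 := hw (var 4 /ₑ lit (k - 1)) (by simp only [Ex.ev, BinOp.eval, r4]; omega)
  have h2 := hw (var 4 /ₑ lit (k - 1) +ₑ lit 2) (by simp only [Ex.ev, BinOp.eval, r4]; omega)
  simp only [Ex.ev, BinOp.eval, r4] at h1 h2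
  simp only [validE, Ex.ev, BinOp.eval, h1, h2, r2, r4, r6, r12]
  clear hw h1 h2 m0 m3 m4
  generalize dig (n + 1) (e % nP k n d / nX k d) (j / (k - 1)) = q
  generalize dig d (e % nX k d) (j % (k - 1)) = x
  generalize j / (k - 1) = r at *
  generalize j % (k - 1) = c at *
  generalize e / nP k n d = i at *
  congr 1
  generalize I.Wok r q x = p₁
  generalize I.Wok (r + 2) q x = p₂
  have h1 : r + (1 + i) < k - 1 ↔ r + (1 + i) ≤ k - 2 := by omega
  have h2 : r < c + 1 ↔ r ≤ c := by omega
  have h3 : k - 2 < r + (1 + i) ↔ ¬ r + (1 + i) ≤ k - 2 := by omega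
  simp only [h1, h2, h3]
  by_cases a₁ : r + (1 + i) ≤ k - 2 <;> by_cases a₂ : r ≤ c <;> by_cases a₃ : c < r + 2 <;>
    by_cases a₄ : p₁ <;> by_cases a₅ : p₂ <;> simp [a₁, a₂, a₃, a₄, a₅]

/-- Pairs of a digit `r` and a coordinate index are coded as one counter, so that a single fold of
`(k - 2) * (k - 1)` steps tests a vertex. -/
theorem valid_iff (hk : 3 ≤ k) (i P X : ℕ) : I.Valid i P X ↔ ∀ j < (k - 2) * (k - 1),
    (j / (k - 1) + i ≤ k - 2 → j / (k - 1) ≤ j % (k - 1) →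
        I.Wok (j / (k - 1)) (dig (n + 1) P (j / (k - 1))) (dig d X (j % (k - 1)))) ∧
      (k - 2 < j / (k - 1) + i → j % (k - 1) < j / (k - 1) + 2 →
        I.Wok (j / (k - 1) + 2) (dig (n + 1) P (j / (k - 1))) (dig d X (j % (k - 1)))) := by
  constructor
  · exact fun h j hj => h _ (div_lt_of_lt_mul_right hj) _ (Nat.mod_lt _ (by omega))
  · intro h r hr j hj
    have := h (r * (k - 1) + j) (pair_lt hr hj)
    rwa [pair_div hj, pair_mod hj] at this

end OVInstance

namespace WordRAM

open Ex

/-- The value of a large number of variables, from the size of the input. -/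
def roomM (k n d : ℕ) : ℕ := 100 * k ^ 2 * ((n + 1) * (d + 1)) ^ k

/-- The commands that prepare the registers and arrays for the families of edges. -/
def setupProg (k pd : ℕ) : Prog :=
  .seq (setTo 8 (var 0 +ₑ lit 1)) <|
  .seq (tabFold 3 (lit k) (var 2) (lit 1) (var 6 *ₑ var 8)) <|
  .seq (tabFold 4 (lit k) (var 2) (lit 1) (var 6 *ₑ var 1)) <|
  .seq (setTo 9 (ld 3 (lit (k - 2)))) <|
  .seq (setTo 10 (ld 3 (lit (k - 1)))) <|
  .seq (setTo 11 (ld 4 (lit (k - 1)))) <|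
  .seq (setTo 12 (var 9 *ₑ var 11)) <|
  .seq (setTo 13 (lit (2 * (k - 1)) *ₑ var 10 +ₑ lit 2)) <|
  .seq (setTo 14 (lit (k - 1) *ₑ var 12 +ₑ lit pd *ₑ (var 10 *ₑ var 11))) <|
  tabFold 5 (lit (k - 1) *ₑ var 12) (lit ((k - 2) * (k - 1))) (lit 1) (validE k)

end WordRAM


/-! ### Word length and sizes -/

namespace WordRAM

open Ex

section room

variable {k n d : ℕ}

theorem le_roomM {v c : ℕ} (hc : c ≤ 100 * k ^ 2) (hv : v ≤ c * ((n + 1) * (d + 1)) ^ k) :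
    v ≤ roomM k n d :=
  hv.trans (Nat.mul_le_mul_right _ hc)

theorem const_le_roomM {v : ℕ} (hv : v ≤ 100 * k ^ 2) : v ≤ roomM k n d :=
  le_roomM hv (Nat.le_mul_of_pos_right _ (Nat.pow_pos (by positivity)))

theorem pow_mul_pow_le (a b : ℕ) (ha : a ≤ k) (hb : b ≤ k) :
    (n + 1) ^ a * d ^ b ≤ ((n + 1) * (d + 1)) ^ k := by
  rw [mul_pow]
  exact Nat.mul_le_mul (Nat.pow_le_pow_right (by omega) ha)
    ((Nat.pow_le_pow_left (by omega) b).trans (Nat.pow_le_pow_right (by omega) hb))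

/-- With `σ` the bit length of `n * d`, `(n + 1) * (d + 1) ≤ 4 * n * d ≤ 2 ^ (3 * σ)`, `k ^ 2 ≤ 2 ^
(2 * k)` and `100 < 2 ^ 7`. As `σ ≥ 1`, the exponents add up to at most `(5 * k + 7) * σ`. -/
theorem pow_roomM_lt (hn : 0 < n) (hd : 0 < d) :
    roomM k n d ^ 60 < 2 ^ (60 * (5 * k + 7) * Nat.size (n * d)) := by
  set s := Nat.size (n * d) with hs
  have hs1 : 1 ≤ s := Nat.size_pos.2 (Nat.mul_pos hn hd)
  have h1 : n * d < 2 ^ s := Nat.lt_size_self _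
  have h2 : (n + 1) * (d + 1) ≤ 4 * (n * d) := by nlinarith
  have h3 : (n + 1) * (d + 1) ≤ 2 ^ (3 * s) := calc
    (n + 1) * (d + 1) ≤ 2 ^ 2 * 2 ^ s := by omega
    _ = 2 ^ (2 + s) := (pow_add _ _ _).symm
    _ ≤ 2 ^ (3 * s) := Nat.pow_le_pow_right (by omega) (by omega)
  have hk : k ^ 2 ≤ 2 ^ (2 * k) := by
    rw [mul_comm, pow_mul]; exact Nat.pow_le_pow_left Nat.lt_two_pow_self.le 2
  have h4 : roomM k n d < 2 ^ ((5 * k + 7) * s) := calc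
    roomM k n d = 100 * k ^ 2 * ((n + 1) * (d + 1)) ^ k := rfl
    _ ≤ 100 * 2 ^ (2 * k) * (2 ^ (3 * s)) ^ k :=
      Nat.mul_le_mul (Nat.mul_le_mul_left _ hk) (Nat.pow_le_pow_left h3 k)
    _ < 2 ^ 7 * 2 ^ (2 * k) * (2 ^ (3 * s)) ^ k :=
      Nat.mul_lt_mul_of_pos_right (Nat.mul_lt_mul_of_pos_right (by norm_num) (by positivity))
        (by positivity)
    _ = 2 ^ (7 + 2 * k + 3 * s * k) := by rw [← pow_mul, ← pow_add, ← pow_add]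
    _ ≤ 2 ^ ((5 * k + 7) * s) := Nat.pow_le_pow_right (by omega) (by nlinarith)
  calc roomM k n d ^ 60 < (2 ^ ((5 * k + 7) * s)) ^ 60 := Nat.pow_lt_pow_left h4 (by norm_num)
    _ = _ := by rw [← pow_mul]; congr 1; ring

theorem room_init (hk : 3 ≤ k) (hn : 0 < n) (hd : 0 < d) (I : OVInstance k n d) :
    Room (60 * (5 * k + 7) * Nat.size (n * d)) (roomM k n d) 60 I.init.reg I.init.mem := by
  have hk2 : 3 ^ 2 ≤ k ^ 2 := Nat.pow_le_pow_left hk 2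
  have h1 : 1 ≤ roomM k n d := const_le_roomM (by omega)
  refine ⟨const_le_roomM (by omega), by norm_num, pow_roomM_lt hn hd, fun r => ?_, fun A x => ?_⟩
  · simp only [OVInstance.init]
    have hb := Nat.le_self_pow (n := k) (by omega) ((n + 1) * (d + 1))
    have : (n + 1) * (d + 1) ≤ roomM k n d := le_roomM (c := 1) (by omega) (by omega)
    split_ifs <;> nlinarith
  · simp only [OVInstance.init]
    split_ifs
    · exact (OVInstance.bit_le_one _ _ _).trans h1
    · omega

theorem nP_le : nP k n d ≤ ((n + 1) * (d + 1)) ^ k := pow_mul_pow_le _ _ (by omega) (by omega)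

theorem nQX_le : nQ k n * nX k d ≤ ((n + 1) * (d + 1)) ^ k :=
  pow_mul_pow_le _ _ (by omega) (by omega)

/-- Each of the `k - 1` inner layers has at most `nQ k n * nX k d` slots, and the padding counts as
one more layer. -/
theorem cM_le_mul (hk : 3 ≤ k) {pd : ℕ} (hpd : pd ≤ 1) :
    cM k n d pd ≤ k * (nQ k n * nX k d) := by
  have h1 : nP k n d ≤ nQ k n * nX k d := by
    rw [nQ_eq hk, nP]
    exact Nat.mul_le_mul_right _ (Nat.le_mul_of_pos_right _ (by omega))
  obtain ⟨m, rfl⟩ : ∃ m, k = m + 1 := ⟨k - 1, by omega⟩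
  rw [cM, Nat.add_sub_cancel]
  nlinarith

theorem numV_le (hk : 3 ≤ k) (hd : 0 < d) {pd : ℕ} (hpd : pd ≤ 1) :
    OVInstance.numV k n d pd ≤ 4 * k * (nQ k n * nX k d) := by
  have h1 := cM_le_mul (n := n) (d := d) hk hpd
  have h2 : nQ k n ≤ nQ k n * nX k d := Nat.le_mul_of_pos_right _ (nX_pos k hd)
  have h3 := nQ_pos k n
  have h4 : 2 * (k - 1) * nQ k n ≤ 2 * k * (nQ k n * nX k d) :=
    Nat.mul_le_mul (by omega) h2
  have h5 : 3 * 1 ≤ k * (nQ k n * nX k d) := Nat.mul_le_mul hk (by omega)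
  rw [OVInstance.numV, zV]
  linarith

end room

theorem Runs.setTo_eq {w M r v : ℕ} {e : Ex} {ρ : ℕ → ℕ} {μ : ℕ → ℕ → ℕ} (hR : Room w M 60 ρ μ)
    (he : e.Good M 60 Glob) (hv : e.ev ρ μ = v) :
    Runs w (setTo r e) (e.cost + 1) (St ρ μ) (St (Function.update ρ r v) μ) := by
  subst hv; exact runs_setTo hR he

/-- Fill an array with the powers of the content of a register. -/
theorem runs_powers {w M k b B r A : ℕ} {ρ : ℕ → ℕ} {μ : ℕ → ℕ → ℕ} (hR : Room w M 60 ρ μ)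
    (hr : Glob r) (hk : k ≤ M) (hb : ρ r = b) (hB : ∀ i < k, b ^ i ≤ M) (hkB : k ≤ B) :
    Runs w (tabFold A (lit k) (var 2) (lit 1) (var 6 *ₑ var r)) (B * (8 * B + 12) + 11) (St ρ μ)
      (St ρ (Function.update μ A fun x => if x < k then b ^ x else μ A x)) := by
  have h1 : 1 ≤ M := by have := hR.two_le; omega
  have hg : r ≠ 2 ∧ r ≠ 4 ∧ r ≠ 6 := by unfold Glob at hr; omega
  refine (runs_tabFold (A := A) (cnt := lit k) (m := var 2) (init := lit 1)
    (body := var 6 *ₑ var r) hR (fun _ j => b ^ j) id k B ⟨trivial, hk, by simp [Ex.deg]⟩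
    ⟨Or.inr rfl, trivial, by simp [Ex.deg]⟩ ⟨trivial, h1, by simp [Ex.deg]⟩
    ⟨⟨by simp [Ex.Vars, Glob₆], Or.inl hr⟩, ⟨trivial, trivial⟩, by simp [Ex.deg]⟩
    trivial trivial ⟨trivial, trivial⟩ rfl hk ?_ ?_ ?_ ?_ ?_ ?_).mono ?_
  · intro i _; simp [Ex.ev]
  · intro i hi; simp only [id]; omega
  · intro i hi; simp only [id]; omega
  · intro i _; simp [Ex.ev]
  · intro i _ j _; simp [Ex.ev, BinOp.eval, loopEnv, hg.1, hg.2.1, hg.2.2, hb, pow_succ]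
  · intro i hi j hj; exact hB j (by simp only [id] at hj; omega)
  · simp only [Ex.cost]
    have := Nat.mul_le_mul_right (8 * B + 12) hkB
    nlinarith

end WordRAM


/-! ### Running the setup -/

namespace OVInstance

open WordRAM Ex

variable {k n d : ℕ} {I : OVInstance k n d}

theorem init_mem_bit {l q x : ℕ} (hq : q < n) (hx : x < d) :
    I.init.mem 0 ((l * n + q) * d + x) = I.bit l q x := by
  have h1 : ((l * n + q) * d + x) / d = l * n + q := pair_div hx
  have h2 : ((l * n + q) * d + x) / (n * d) = l := by
    rw [mul_comm n d, ← Nat.div_div_eq_div_mul, h1, pair_div hq]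
  simp only [init, if_true]
  rw [h1, h2, pair_mod hq, pair_mod hx]

/-- The time is dominated by the validity table: fewer than `k` layers of `nP k n d` slots, with at
most `k ^ 2` tests of bounded cost each. -/
theorem runs_setup (hk : 3 ≤ k) (hd : 0 < d) {pd w : ℕ} (hpd : pd ≤ 1)
    (hR : Room w (roomM k n d) 60 I.init.reg I.init.mem) :
    ∃ ρ μ, I.EnvOK pd ρ μ ∧ Room w (roomM k n d) 60 ρ μ ∧ ρ 7 = 0 ∧
      (∀ A, A = 1 ∨ A = 2 ∨ 6 ≤ A → μ A = fun _ => 0) ∧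
      Runs w (setupProg k pd) (1000 * (k ^ 3 * nP k n d)) (St I.init.reg I.init.mem) (St ρ μ) := by
  classical
  have hk2 : 3 * k ≤ k ^ 2 := by rw [sq]; exact Nat.mul_le_mul_right k hk
  have i0 : I.init.reg 0 = n := rfl
  have i1 : I.init.reg 1 = d := rfl
  have ib : ∀ l < k, ∀ q < n, ∀ x < d, I.init.mem 0 ((l * n + q) * d + x) = I.bit l q x :=
    fun l _ q hq x hx => init_mem_bit hq hx
  have iz : ∀ A, A ≠ 0 → I.init.mem A = fun _ => 0 := fun A hA => by simp [init, hA]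
  have iz7 : I.init.reg 7 = 0 := rfl
  generalize I.init.reg = ρ₀ at *
  generalize I.init.mem = μ₀ at *
  set M := roomM k n d with hM
  have cl : ∀ v, v ≤ 100 * k ^ 2 → v ≤ M := fun v hv => const_le_roomM hv
  have bX := nQX_le (k := k) (n := n) (d := d)
  have bP := nP_le (k := k) (n := n) (d := d)
  have hX := nX_pos k hd
  have hQ := nQ_pos k n
  have hPp := nP_pos k n hd
  have hle : nQ k n ≤ nQ k n * nX k d := Nat.le_mul_of_pos_right _ hX
  have hle' : nX k d ≤ nQ k n * nX k d := Nat.le_mul_of_pos_left _ hQ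
  have hle'' : nB k n ≤ nP k n d := Nat.le_mul_of_pos_right _ hX
  have h99 : 1 ≤ 100 * k ^ 2 := by omega
  -- the base of the tuples
  have bn : n + 1 ≤ M := le_roomM h99 (by
    have := pow_mul_pow_le (n := n) (d := d) (k := k) 1 0 (by omega) (by omega)
    simpa using this)
  have r1 := Runs.setTo_eq (r := 8) (e := var 0 +ₑ lit 1) (v := n + 1) hR
    ⟨by simp [Ex.Vars, Glob], by simp [Ex.Tame]; exact cl 1 h99, by simp [Ex.deg]⟩
    (by simp [Ex.ev, BinOp.eval, i0])
  have hR1 := hR.update (r := 8) bn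
  set ρ₁ := Function.update ρ₀ 8 (n + 1) with hρ₁
  -- the powers
  have pn : ∀ i < k, (n + 1) ^ i ≤ M := fun i hi => le_roomM h99 (by
    simpa using pow_mul_pow_le (n := n) (d := d) (k := k) i 0 hi.le (by omega))
  have pd' : ∀ i < k, d ^ i ≤ M := fun i hi => le_roomM h99 (by
    simpa using pow_mul_pow_le (n := n) (d := d) (k := k) 0 i (by omega) hi.le)
  have r2 := runs_powers (A := 3) (r := 8) hR1 (by simp [Glob]) (cl k (by omega))
    (by simp [hρ₁]) pn le_rfl
  have hR2 := hR1.update_mem (A := 3) (f := fun x => if x < k then (n + 1) ^ x else μ₀ 3 x)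
    (fun x => by split_ifs with h; exacts [pn x h, hR.mem_le _ _])
  set μ₁ := Function.update μ₀ 3 (fun x => if x < k then (n + 1) ^ x else μ₀ 3 x) with hμ₁
  have r3 := runs_powers (A := 4) (r := 1) hR2 (by simp [Glob]) (cl k (by omega))
    (show ρ₁ 1 = d by simp [hρ₁, i1]) pd' le_rfl
  have hR3 := hR2.update_mem (A := 4) (f := fun x => if x < k then d ^ x else μ₁ 4 x)
    (fun x => by split_ifs with h; exacts [pd' x h, hR2.mem_le _ _])
  set μ₂ := Function.update μ₁ 4 (fun x => if x < k then d ^ x else μ₁ 4 x) with hμ₂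
  have m3 : ∀ r < k, μ₂ 3 r = (n + 1) ^ r := fun r hr => by simp [hμ₂, hμ₁, hr]
  have m4 : ∀ r < k, μ₂ 4 r = d ^ r := fun r hr => by simp [hμ₂, hr]
  -- the numbers
  have r4 := Runs.setTo_eq (r := 9) (e := ld 3 (lit (k - 2))) (v := nB k n) hR3
    ⟨by simp [Ex.Vars], by simp only [Ex.Tame]; exact cl _ (by omega), by simp [Ex.deg]⟩
    (by rw [Ex.ev, Ex.ev, m3 _ (by omega), nB])
  have hR4 := hR3.update (r := 9) (v := nB k n) (le_roomM h99 (by omega))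
  have r5 := Runs.setTo_eq (r := 10) (e := ld 3 (lit (k - 1))) (v := nQ k n) hR4
    ⟨by simp [Ex.Vars], by simp only [Ex.Tame]; exact cl _ (by omega), by simp [Ex.deg]⟩
    (by rw [Ex.ev, Ex.ev, m3 _ (by omega), nQ])
  have hR5 := hR4.update (r := 10) (v := nQ k n) (le_roomM h99 (by omega))
  have r6 := Runs.setTo_eq (r := 11) (e := ld 4 (lit (k - 1))) (v := nX k d) hR5
    ⟨by simp [Ex.Vars], by simp only [Ex.Tame]; exact cl _ (by omega), by simp [Ex.deg]⟩
    (by rw [Ex.ev, Ex.ev, m4 _ (by omega), nX])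
  have hR6 := hR5.update (r := 11) (v := nX k d) (le_roomM h99 (by omega))
  have r7 := Runs.setTo_eq (r := 12) (e := var 9 *ₑ var 11) (v := nP k n d) hR6
    ⟨by simp [Ex.Vars, Glob], by simp [Ex.Tame], by simp [Ex.deg]⟩
    (by simp [Ex.ev, BinOp.eval, nP])
  have hR7 := hR6.update (r := 12) (v := nP k n d) (le_roomM h99 (by omega))
  have r8 := Runs.setTo_eq (r := 13) (e := lit (2 * (k - 1)) *ₑ var 10 +ₑ lit 2) (v := zV k n) hR7
    ⟨by simp [Ex.Vars, Glob], by simp only [Ex.Tame]; exact ⟨⟨cl _ (by omega), trivial⟩,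
      cl _ (by omega)⟩, by simp [Ex.deg]⟩
    (by simp [Ex.ev, BinOp.eval, zV])
  have hnV := (numV_le (n := n) hk hd hpd).trans (Nat.mul_le_mul_left (4 * k) bX)
  have hR8 := hR7.update (r := 13) (v := zV k n) (le_roomM (c := 4 * k) (by omega)
    (le_trans (Nat.le_add_right _ _) hnV))
  have r9 := Runs.setTo_eq (r := 14)
    (e := lit (k - 1) *ₑ var 12 +ₑ lit pd *ₑ (var 10 *ₑ var 11)) (v := cM k n d pd) hR8
    ⟨by simp [Ex.Vars, Glob], by simp only [Ex.Tame]; exact ⟨⟨cl _ (by omega), trivial⟩,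
      cl _ (by omega), trivial, trivial⟩, by simp [Ex.deg]⟩
    (by simp [Ex.ev, BinOp.eval, cM])
  have hR9 := hR8.update (r := 14) (v := cM k n d pd) (le_roomM (c := 4 * k) (by omega)
    (le_trans (Nat.le_add_left _ _) hnV))
  set ρ := Function.update (Function.update (Function.update (Function.update (Function.update
    (Function.update ρ₁ 9 (nB k n)) 10 (nQ k n)) 11 (nX k d)) 12 (nP k n d)) 13 (zV k n)) 14
    (cM k n d pd) with hρ
  have e0 : ρ 0 = n := by simp [hρ, hρ₁, i0]
  have e1 : ρ 1 = d := by simp [hρ, hρ₁, i1]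
  have e8 : ρ 8 = n + 1 := by simp [hρ, hρ₁]
  have e11 : ρ 11 = nX k d := by simp [hρ]
  have e12 : ρ 12 = nP k n d := by simp [hρ]
  have m0 : ∀ l < k, ∀ q < n, ∀ x < d, μ₂ 0 ((l * n + q) * d + x) = I.bit l q x := by
    intro l hl q hq x hx
    rw [← ib l hl q hq x hx]
    simp [hμ₂, hμ₁]
  -- the valid inner vertices
  let ok : ℕ → ℕ → Prop := fun e j =>
    (j / (k - 1) + (1 + e / nP k n d) ≤ k - 2 → j / (k - 1) ≤ j % (k - 1) →
        I.Wok (j / (k - 1)) (dig (n + 1) (e % nP k n d / nX k d) (j / (k - 1)))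
          (dig d (e % nX k d) (j % (k - 1)))) ∧
      (k - 2 < j / (k - 1) + (1 + e / nP k n d) → j % (k - 1) < j / (k - 1) + 2 →
        I.Wok (j / (k - 1) + 2) (dig (n + 1) (e % nP k n d / nX k d) (j / (k - 1)))
          (dig d (e % nX k d) (j % (k - 1))))
  -- Whether the first `j` tests for slot `e` succeed.
  let val : ℕ → ℕ → ℕ := fun e j => if ∀ j' < j, ok e j' then 1 else 0
  have val1 : ∀ e j, val e j ≤ 1 := fun e j => by simp only [val]; split_ifs <;> omega
  have hmM : (k - 2) * (k - 1) ≤ k ^ 2 := by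
    rw [sq]; exact Nat.mul_le_mul (by omega) (by omega)
  have hcM : (k - 1) * nP k n d ≤ M := le_roomM (c := k) (by omega)
    (Nat.mul_le_mul (by omega) bP)
  have hcost : (validE k).cost ≤ 200 := by simp [validE, wokE, Ex.cost]
  have r10 := runs_tabFold (A := 5) (cnt := lit (k - 1) *ₑ var 12)
    (m := lit ((k - 2) * (k - 1))) (init := lit 1) (body := validE k) hR9 val
    (fun _ => (k - 2) * (k - 1)) ((k - 1) * nP k n d) (k ^ 2)
    ⟨by simp [Ex.Vars, Glob], by simp only [Ex.Tame]; exact ⟨cl _ (by omega), trivial⟩,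
      by simp [Ex.deg]⟩
    ⟨trivial, cl _ (by omega), by simp [Ex.deg]⟩ ⟨trivial, cl _ (by omega), by simp [Ex.deg]⟩
    ⟨by simp [validE, wokE, Ex.Vars, Glob, Glob₆], by
      have h0 := cl 0 (by omega)
      have h1 := cl 1 (by omega)
      have h2 := cl 2 (by omega)
      have h3 := cl (k - 1) (by omega)
      simp only [validE, wokE, Ex.Tame, h0, h1, h2, h3, and_self],
      by simp [validE, wokE, Ex.deg]⟩
    trivial trivial (by simp [validE, wokE, Ex.Reads])
    (by simp [Ex.ev, BinOp.eval, e12]) hcM (fun _ _ => rfl) (fun _ _ => hmM)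
    (fun _ _ => cl _ (by omega)) (fun i _ => by simp [val, Ex.ev])
    (by
      intro e he j hj
      rw [ev_validE (I := I) (e := e) (j := j) (a := val e j) hk hd (by simp [loopEnv, e0])
        (by simp [loopEnv, e1]) (by simp [loopEnv, e8]) (by simp [loopEnv, e11])
        (by simp [loopEnv, e12]) (by simp [loopEnv]) (by simp [loopEnv]) (by simp [loopEnv])
        m0 m3 m4 hj]
      change val e j * (if ok e j then 1 else 0) = val e (j + 1)
      simp only [val, Nat.forall_lt_succ_right]
      by_cases ha : ∀ j' < j, ok e j' <;> by_cases hb : ok e j <;> simp [ha, hb])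
    (fun e _ j _ => (val1 e j).trans (cl 1 h99))
  have hR10 := hR9.update_mem (A := 5) (f := fun x => if x < (k - 1) * nP k n d then
    val x ((k - 2) * (k - 1)) else μ₂ 5 x)
    (fun x => by split_ifs with h; exacts [(val1 _ _).trans (cl 1 h99), hR9.mem_le _ _])
  refine ⟨ρ, _, ?_, hR10, by simp [hρ, hρ₁, iz7], ?_, (r1.seq <| r2.seq <| r3.seq <| r4.seq <|
    r5.seq <| r6.seq <| r7.seq <| r8.seq <| r9.seq r10).mono ?_⟩
  · refine ⟨e0, e1, e8, by simp [hρ], by simp [hρ], e11, e12, by simp [hρ], by simp [hρ], ?_, ?_,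
      ?_, ?_⟩
    · intro l hl q hq x hx; rw [Function.update_of_ne (by norm_num)]; exact m0 l hl q hq x hx
    · intro r hr; rw [Function.update_of_ne (by norm_num)]; exact m3 r hr
    · intro r hr; rw [Function.update_of_ne (by norm_num)]; exact m4 r hr
    · intro e
      rw [Function.update_self]
      by_cases he : e < (k - 1) * nP k n d
      · exact (if_pos he).trans (if_congr
          ((valid_iff hk _ _ _).symm.trans ⟨fun h => ⟨he, h⟩, fun h => h.2⟩) rfl rfl)
      -- Padding slots lie beyond the table; the initial `0` correctly marks them as not alive.
      · have : μ₂ 5 e = 0 := by simp [hμ₂, hμ₁, iz]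
        simp [he, Alive, this]
  · intro A hA
    have h0 : A ≠ 0 ∧ A ≠ 3 ∧ A ≠ 4 ∧ A ≠ 5 := by omega
    rw [Function.update_of_ne h0.2.2.2, hμ₂, Function.update_of_ne h0.2.2.1, hμ₁,
      Function.update_of_ne h0.2.1, iz A h0.1]
  · have hk3 : k ^ 2 ≤ k ^ 3 * nP k n d := by
      rw [pow_succ k 2, mul_assoc]
      exact Nat.le_mul_of_pos_right _ (Nat.mul_pos (by omega) hPp)
    have h1 : (k - 1) * nP k n d * (k ^ 2 * ((validE k).cost + 5) + 1 + 1 + 10) ≤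
        217 * (k ^ 3 * nP k n d) := by
      have h3 : k ^ 2 * ((validE k).cost + 5) ≤ k ^ 2 * 205 := Nat.mul_le_mul_left _ (by omega)
      have h4 : k ^ 2 * ((validE k).cost + 5) + 1 + 1 + 10 ≤ 217 * k ^ 2 := by omega
      refine (Nat.mul_le_mul (Nat.mul_le_mul_right _ (Nat.sub_le k 1)) h4).trans_eq ?_
      ring
    have h2 : k * (8 * k + 12) = 8 * k ^ 2 + 12 * k := by ring
    simp only [Ex.cost]
    omega

end OVInstance


/-! ### The output of the program for large instances -/

/-- The state `s` stores the graph, with the lists of tails and heads in arrays `o + 1` and `o + 2`.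
The other arrays from `20` on are empty. -/
structure EdgeListGraph.Output {N : ℕ} (G : EdgeListGraph N) (o : ℕ) (s : WordRAM.State) :
    Prop where
  r0 : s.reg 0 = N
  r1 : s.reg 1 = G.edges.length
  m1 : s.mem (o + 1) = G.init.mem 1
  m2 : s.mem (o + 2) = G.init.mem 2
  mz : ∀ A, 20 ≤ A → A ≠ o + 1 → A ≠ o + 2 → s.mem A = fun _ => 0

theorem EdgeListGraph.Output.storedIn {N : ℕ} {G : EdgeListGraph N} {s : WordRAM.State}
    (h : G.Output 0 s) : G.StoredIn s := by
  refine ⟨h.r0, h.r1, fun e he => ?_⟩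
  rw [h.m1, h.m2]
  simp [init, he]

theorem EdgeListGraph.Output.shiftOf {N R : ℕ} {G : EdgeListGraph N} {s s' : WordRAM.State}
    (h : G.Output 20 s) (hm : s'.mem = s.mem) (hr : ∀ r, s'.reg (r + R) = G.init.reg r) :
    G.init.ShiftOf R 20 s' := by
  refine ⟨hr, fun A => ?_⟩
  rw [hm]
  by_cases h1 : A = 1
  · subst h1; exact h.m1
  by_cases h2 : A = 2
  · subst h2; exact h.m2
  rw [h.mz (A + 20) (by omega) (by omega) (by omega)]
  funext x
  simp [init, h1, h2]

namespace WordRAM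

open Ex

/-- The reduction for large instances. -/
def mainProg (k o pd : ℕ) : Prog :=
  .seq (setupProg k pd) (.seq (famsProg o ((List.range 14).map (fam k)))
    (.seq (setTo 0 (var 13 +ₑ var 14)) (setTo 1 (var 7))))

end WordRAM

namespace OVInstance

open WordRAM Ex

variable {k n d : ℕ} {I : OVInstance k n d}

theorem fam_cnt_le (hk : 3 ≤ k) (hd : 0 < d) {pd : ℕ} (hpd : pd ≤ 1) {ρ : ℕ → ℕ} {μ : ℕ → ℕ → ℕ}
    (h : I.EnvOK pd ρ μ) : ∀ i, (fam k i).cnt.ev ρ μ ≤ 2 * k * (nQ k n * nX k d) := by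
  have h1 := cM_le_mul (n := n) (d := d) hk hpd
  have h2 : nQ k n ≤ nQ k n * nX k d := Nat.le_mul_of_pos_right _ (nX_pos k hd)
  have h3 : ∀ a ≤ 2 * k, a * nQ k n ≤ 2 * k * (nQ k n * nX k d) := fun a ha =>
    Nat.mul_le_mul ha h2
  have h4 : ∀ a ≤ 2 * k, a * (nQ k n * nX k d) ≤ 2 * k * (nQ k n * nX k d) := fun a ha =>
    Nat.mul_le_mul_right _ ha
  have h5 : nQ k n * nX k d ≤ 2 * k * (nQ k n * nX k d) := Nat.le_mul_of_pos_left _ (by omega)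
  have h6 := h4 k (by omega)
  intro i
  unfold fam
  split <;> simp only [fam.sF, fam.mF, fam.tF, Ex.ev, BinOp.eval, h.r10, h.r11, h.r14] <;>
    first
    | exact h3 _ (by omega)
    | exact h4 _ (by omega)
    | omega

theorem edgeList_length_le (hk : 3 ≤ k) (hd : 0 < d) {pd : ℕ} (hpd : pd ≤ 1) {ρ : ℕ → ℕ}
    {μ : ℕ → ℕ → ℕ} (h : I.EnvOK pd ρ μ) :
    (I.edgeList pd).length ≤ 28 * k * (nQ k n * nX k d) := by
  rw [← fams_flatMap hk hd h, List.length_flatMap]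
  refine (List.sum_le_card_nsmul _ (2 * k * (nQ k n * nX k d)) ?_).trans ?_
  · intro x hx
    simp only [List.map_map, List.mem_map, List.mem_range, Function.comp] at hx
    obtain ⟨i, -, rfl⟩ := hx
    rw [Fam.list, List.length_map]
    refine (List.length_filter_le _ _).trans ?_
    rw [List.length_range]
    exact fam_cnt_le hk hd hpd h i
  · simp only [List.length_map, List.length_range, smul_eq_mul]
    exact le_of_eq (by ring)

theorem graph_edges_length (hk : 3 ≤ k) (hd : 0 < d) (pd : ℕ) :
    (I.graph hk hd pd).edges.length = (I.edgeList pd).length := by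
  simp [graph]

theorem graph_init_mem (hk : 3 ≤ k) (hd : 0 < d) (pd x : ℕ) :
    (I.graph hk hd pd).init.mem 1 x = ((I.edgeList pd).getD x (0, 0)).1 ∧
      (I.graph hk hd pd).init.mem 2 x = ((I.edgeList pd).getD x (0, 0)).2 := by
  by_cases h : x < (I.edgeList pd).length
  · have h' : x < (I.graph hk hd pd).edges.length := by rwa [graph_edges_length]
    simp only [EdgeListGraph.init, dif_pos h']
    rw [List.getD_eq_getElem _ _ h]
    simp [graph]
  · have h' : ¬ x < (I.graph hk hd pd).edges.length := by rwa [graph_edges_length]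
    simp only [EdgeListGraph.init, dif_neg h']
    rw [List.getD_eq_default _ _ (by omega)]
    simp

theorem runs_main (hk : 3 ≤ k) (hd : 0 < d) {o pd w : ℕ} (hpd : pd ≤ 1) (ho : o = 0 ∨ 20 ≤ o)
    (hR : Room w (roomM k n d) 60 I.init.reg I.init.mem) (hn : k ^ 3 ≤ n) :
    (I.graph hk hd pd).edges.length ≤ 28 * k * (nQ k n * nX k d) ∧
    Runs w (mainProg k o pd) (12000 * k * (nQ k n * nX k d)) (St I.init.reg I.init.mem)
      ((I.graph hk hd pd).Output o) := by
  obtain ⟨ρ, μ, hE, hR', h7, hz, hrun⟩ := runs_setup hk hd hpd hR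
  rw [graph_edges_length]
  have hlen := edgeList_length_le hk hd hpd hE
  refine ⟨hlen, fun s₀ hs₀ => ?_⟩
  set M := roomM k n d with hM
  set L := I.edgeList pd with hL
  set U := nQ k n * nX k d with hU
  have hk2 : 3 * k ≤ k ^ 2 := by rw [sq]; exact Nat.mul_le_mul_right k hk
  have bX := nQX_le (k := k) (n := n) (d := d)
  have hUp : 0 < U := Nat.mul_pos (nQ_pos k n) (nX_pos k hd)
  have hkU : k * 1 ≤ k * U := Nat.mul_le_mul_left k hUp
  have hkM : 28 * k * U ≤ M := le_roomM (c := 28 * k) (by omega) (Nat.mul_le_mul_left _ bX)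
  have hfam := runs_famsProg (o := o) (κ := 300) (cb := 2 * k * U) hR'
    ((List.range 14).map (fam k)) []
    (by
      intro F hF
      obtain ⟨i, -, rfl⟩ := List.mem_map.1 hF
      exact ⟨fam_good hk (const_le_roomM (by omega)) ho i, fam_cnt_le hk hd hpd hE i,
        fam_cost k i⟩)
    (by
      simp only [List.length_nil, List.length_map, List.length_range, zero_add]
      exact le_trans (le_of_eq (by ring)) hkM)
  rw [fams_flatMap hk hd hE, List.nil_append, ← hL] at hfam
  have hout : ∀ A x, outMem o μ L A x ≤ M := by
    have hV := (numV_le (n := n) hk hd hpd).trans (Nat.mul_le_mul_left (4 * k) bX)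
    have hV' : numV k n d pd ≤ M := le_roomM (c := 4 * k) (by omega) hV
    have : ∀ x, (L.getD x (0, 0)).1 ≤ M ∧ (L.getD x (0, 0)).2 ≤ M := by
      intro x
      by_cases hx : x < L.length
      · rw [List.getD_eq_getElem _ _ hx]
        have := edgeList_lt (I := I) hk hd (pd := pd) _ (List.getElem_mem hx)
        omega
      · rw [List.getD_eq_default _ _ (by omega)]
        simp
    intro A x
    unfold outMem
    split_ifs
    exacts [(this x).1, (this x).2, hR'.mem_le _ _]
  have hR2 : Room w M 60 (Function.update ρ 7 L.length) (outMem o μ L) := by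
    have := hR'.update (r := 7) (hlen.trans hkM)
    exact ⟨this.two_le, this.one_le, this.pow_lt, this.reg_le, hout⟩
  have hN : numV k n d pd ≤ M :=
    le_roomM (c := 4 * k) (by omega) ((numV_le hk hd hpd).trans (Nat.mul_le_mul_left _ bX))
  have q1 := Runs.setTo_eq (r := 0) (e := var 13 +ₑ var 14) (v := numV k n d pd) hR2
    ⟨by simp [Ex.Vars, Glob], by simp [Ex.Tame], by simp [Ex.deg]⟩
    (by simp [Ex.ev, BinOp.eval, hE.r13, hE.r14, numV])
  have hR3 := hR2.update (r := 0) hN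
  have q2 := Runs.setTo_eq (r := 1) (e := var 7) (v := L.length) hR3
    ⟨by simp [Ex.Vars, Glob], by simp [Ex.Tame], by simp [Ex.deg]⟩ (by simp [Ex.ev])
  obtain ⟨s₁, t₁, x₁, ht₁, hs₁⟩ := hrun s₀ hs₀
  have hz' : outMem o μ [] = μ := by
    funext A x
    unfold outMem
    split_ifs with h1 h2
    · rw [hz A (by omega)]; simp
    · rw [hz A (by omega)]; simp
    · rfl
  obtain ⟨s₂, t₂, x₂, ht₂, hs₂⟩ := hfam s₁ ⟨hs₁.1.trans hz'.symm, fun r hr => hs₁.2 r hr.1, by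
    rw [hs₁.2 7 (by simp [Glob]), h7]; rfl⟩
  obtain ⟨s₃, t₃, x₃, ht₃, hs₃⟩ := (q1.seq q2) s₂ ⟨hs₂.1, fun r hr => by
    by_cases h : r = 7
    · subst h; rw [Function.update_self]; exact hs₂.2.2
    · rw [Function.update_of_ne h]; exact hs₂.2.1 r ⟨hr, h⟩⟩
  refine ⟨s₃, _, .seq x₁ (.seq x₂ x₃), ?_, ?_, ?_, ?_, ?_, ?_⟩
  -- Here `k ^ 3 ≤ n` pays for the validity table, since `nQ k n` is `n + 1` times `nB k n`.
  · have h1 : k ^ 3 * nP k n d ≤ U := by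
      rw [hU, nQ_eq hk, nP, mul_comm (k ^ 3), mul_right_comm]
      exact Nat.mul_le_mul_right _ (Nat.mul_le_mul_left _ (by omega))
    have h2 : U ≤ k * U := Nat.le_mul_of_pos_left _ (by omega)
    have h3 : 12000 * k * U = 12000 * (k * U) := by ring
    have h4 : 2 * k * U * 300 = 600 * (k * U) := by ring
    simp only [List.length_map, List.length_range, h4, Ex.cost] at ht₂ ht₃
    omega
  · rw [hs₃.2 0 (by simp [Glob])]; simp
  · rw [hs₃.2 1 (by simp [Glob]), graph_edges_length]; simp [hL]
  · rw [hs₃.1]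
    funext x
    rw [(graph_init_mem hk hd pd x).1]
    simp [outMem, hL]
  · rw [hs₃.1]
    funext x
    rw [(graph_init_mem hk hd pd x).2]
    simp [outMem, hL]
  · intro A hA h1 h2
    rw [hs₃.1, outMem_of_ne ⟨h1, h2⟩, hz A (by omega)]

end OVInstance


/-! ### Instances solved directly -/

/-- The graph without edges. -/
def EdgeListGraph.empty (N : ℕ) : EdgeListGraph N := ⟨[], List.nodup_nil, by simp⟩

theorem EdgeListGraph.dist_self {N : ℕ} (G : EdgeListGraph N) (u : Fin N) : G.dist u u = 0 :=
  le_antisymm (iInf₂_le 0 (.nil u)) bot_le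

theorem EdgeListGraph.dist_empty {N : ℕ} {u v : Fin N} (h : u ≠ v) :
    (EdgeListGraph.empty N).dist u v = ⊤ := by
  refine top_le_iff.1 (le_iInf₂ fun m hm => ?_)
  cases hm with
  | nil => exact absurd rfl h
  | cons h' _ => simp [empty] at h'

namespace OVInstance

open Classical in
/-- The number of vertices of the graph for instances that are solved directly. -/
noncomputable def answer {k n d : ℕ} (I : OVInstance k n d) : ℕ := if I.HasSolution then 1 else 0

variable {k n d : ℕ} {I : OVInstance k n d}

theorem bit_eq (i : Fin k) (j : Fin n) (x : Fin d) : I.bit i j x = (I.vec i j x).toNat := by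
  simp [bit]

/-- A choice is a `k`-digit number, now in base `n` without the all-ones vector. The sum vanishes
when every coordinate has a vanishing factor. -/
theorem hasSolution_iff (hn : 0 < n) : I.HasSolution ↔ ∃ i < n ^ k, ∀ x < d, ∃ l < k,
    I.bit l (dig n i l) x = 0 := by
  constructor
  · rintro ⟨v, hv⟩
    obtain ⟨i, hi, h⟩ := exists_dig_eq (β := n) k
      (fun l => if h : l < k then v ⟨l, h⟩ else 0) (fun l hl => by simp [hl])
    refine ⟨i, hi, fun x hx => ?_⟩
    have h0 := Finset.sum_eq_zero_iff.1 hv ⟨x, hx⟩ (Finset.mem_univ _)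
    obtain ⟨l, -, hl⟩ := Finset.prod_eq_zero_iff.1 h0
    refine ⟨l, l.2, ?_⟩
    rw [h l l.2, dif_pos l.2, ← hl]
    exact bit_eq l (v l) ⟨x, hx⟩
  · rintro ⟨i, -, h⟩
    refine ⟨fun l => ⟨dig n i l, dig_lt hn i l⟩, Finset.sum_eq_zero fun x _ => ?_⟩
    obtain ⟨l, hl, h0⟩ := h x x.2
    refine Finset.prod_eq_zero (Finset.mem_univ ⟨l, hl⟩) ?_
    rw [← h0]
    exact (bit_eq ⟨l, hl⟩ ⟨dig n i l, dig_lt hn i l⟩ x).symm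

end OVInstance

namespace WordRAM

open Ex

/-- Output a graph without edges that has a second vertex if cell `0` of array `8` is `1`. -/
def answerProg : Prog := .seq (setTo 0 (lit 1 +ₑ ld 8 (lit 0))) (setTo 1 (lit 0))

/-- The reduction for instances with one vector per set and one coordinate. -/
def tinyProg (k : ℕ) : Prog :=
  .seq (tabFold 8 (lit 1) (lit k) (lit 0) (lit 0 <ₑ var 6 +ₑ (lit 1 -ₑ ld 0 (var 4)))) answerProg

/-- The reduction for instances with few vectors per set. -/
def smallProg (k : ℕ) : Prog :=
  .seq (tabFold 3 (lit (k + 1)) (var 2) (lit 1) (var 6 *ₑ var 0)) <|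
  .seq (setTo 9 (ld 3 (lit k))) <|
  .seq (tabFold 6 (var 9 *ₑ var 1) (lit k) (lit 0) (lit 0 <ₑ var 6 +ₑ (lit 1 -ₑ
    ld 0 ((var 4 *ₑ var 0 +ₑ (var 2 /ₑ var 1 /ₑ ld 3 (var 4) %ₑ var 0)) *ₑ var 1 +ₑ
      var 2 %ₑ var 1)))) <|
  .seq (tabFold 7 (var 9) (var 1) (lit 1) (var 6 *ₑ ld 6 (var 2 *ₑ var 1 +ₑ var 4))) <|
  .seq (tabFold 8 (lit 1) (var 9) (lit 0) (lit 0 <ₑ var 6 +ₑ ld 7 (var 4))) answerProg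

theorem runs_answer {w M o v : ℕ} {ρ : ℕ → ℕ} {μ : ℕ → ℕ → ℕ} (hR : Room w M 60 ρ μ)
    (hv : μ 8 0 = v) (hv1 : v ≤ 1) (ho : o = 0 ∨ 20 ≤ o)
    (hz : ∀ A, A = 1 ∨ A = 2 ∨ 20 ≤ A → μ A = fun _ => 0) :
    Runs w answerProg 7 (St ρ μ) ((EdgeListGraph.empty (1 + v)).Output o) := by
  have hM := hR.two_le
  have r1 := Runs.setTo_eq (r := 0) (e := lit 1 +ₑ ld 8 (lit 0)) (v := 1 + v) hR
    ⟨by simp [Ex.Vars], by simp only [Ex.Tame]; omega, by simp [Ex.deg]⟩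
    (by simp [Ex.ev, BinOp.eval, hv])
  have r2 := Runs.setTo_eq (r := 1) (e := lit 0) (v := 0) (hR.update (r := 0) (v := 1 + v)
    (by omega)) ⟨by simp [Ex.Vars], by simp [Ex.Tame], by simp [Ex.deg]⟩ rfl
  intro s hs
  obtain ⟨s', t, e, ht, hs'⟩ := (r1.seq r2) s hs
  refine ⟨s', t, e, ht, ?_, ?_, ?_, ?_, ?_⟩
  · rw [hs'.2 0 (by simp [Glob])]; simp
  · rw [hs'.2 1 (by simp [Glob])]; simp [EdgeListGraph.empty]
  · rw [hs'.1, hz _ (by omega)]; funext x; simp [EdgeListGraph.empty, EdgeListGraph.init]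
  · rw [hs'.1, hz _ (by omega)]; funext x; simp [EdgeListGraph.empty, EdgeListGraph.init]
  · intro A hA _ _
    rw [hs'.1, hz _ (by omega)]

end WordRAM

namespace OVInstance

open WordRAM Ex

variable {k n d : ℕ} {I : OVInstance k n d}

theorem init_mem_eq (A : ℕ) (h : A ≠ 0) : I.init.mem A = fun _ => 0 := by simp [init, h]

theorem answer_le : I.answer ≤ 1 := by unfold answer; split_ifs <;> omega

/-- For `n = d = 1` only time linear in `k` is allowed, too little for the powers that `smallProg`
tabulates; one scan of the `k` bits suffices. -/
theorem runs_tiny (hk : 3 ≤ k) {I : OVInstance k 1 1} {o w : ℕ} (ho : o = 0 ∨ 20 ≤ o)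
    (hR : Room w (roomM k 1 1) 60 I.init.reg I.init.mem) :
    Runs w (tinyProg k) (100 * k) (St I.init.reg I.init.mem)
      ((EdgeListGraph.empty (1 + I.answer)).Output o) := by
  classical
  have hk2 : 3 * k ≤ k ^ 2 := by rw [sq]; exact Nat.mul_le_mul_right k hk
  have ib : ∀ l < k, I.init.mem 0 l = I.bit l 0 0 := fun l hl => by
    have := init_mem_bit (I := I) (l := l) (q := 0) (x := 0) (by omega) (by omega)
    simpa using this
  have iz := init_mem_eq (I := I)
  generalize I.init.reg = ρ₀ at *
  generalize I.init.mem = μ₀ at *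
  set M := roomM k 1 1 with hM
  have cl : ∀ v, v ≤ 100 * k ^ 2 → v ≤ M := fun v hv => const_le_roomM hv
  let val : ℕ → ℕ → ℕ := fun _ j => if ∃ l < j, I.bit l 0 0 = 0 then 1 else 0
  have val1 : ∀ e j, val e j ≤ 1 := fun e j => by simp only [val]; split_ifs <;> omega
  have r1 := runs_tabFold (A := 8) (cnt := lit 1) (m := lit k) (init := lit 0)
    (body := lit 0 <ₑ var 6 +ₑ (lit 1 -ₑ ld 0 (var 4))) hR val (fun _ => k) 1 k
    ⟨trivial, cl _ (by omega), by simp [Ex.deg]⟩ ⟨trivial, cl _ (by omega), by simp [Ex.deg]⟩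
    ⟨trivial, cl _ (by omega), by simp [Ex.deg]⟩
    ⟨by simp [Ex.Vars, Glob₆], by simp [Ex.Tame]; exact cl _ (by omega), by simp [Ex.deg]⟩
    trivial trivial (by simp [Ex.Reads]) rfl (cl _ (by omega)) (fun _ _ => rfl)
    (fun _ _ => le_rfl) (fun _ _ => cl _ (by omega)) (fun i _ => by simp [val, Ex.ev])
    (by
      intro e _ j hj
      simp only [Ex.ev, BinOp.eval, loopEnv, Function.update_self, 
        Function.update_of_ne (show (4 : ℕ) ≠ 6 by norm_num), ib j hj, val,
        Nat.exists_lt_succ_right]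
      by_cases ha : ∃ l < j, I.bit l 0 0 = 0 <;> by_cases hb : I.bit j 0 0 = 0
      · simp [ha, hb]
      · simp [ha, hb]
      · simp [ha, hb]
      · have : I.bit j 0 0 = 1 := by have := bit_le_one (I := I) j 0 0; omega
        simp [ha, this])
    (fun e _ j _ => (val1 e j).trans (cl 1 (by omega)))
  have hv : val 0 k = I.answer := by
    simp only [val, answer]
    refine if_congr ((hasSolution_iff (I := I) (by omega)).trans ?_).symm rfl rfl
    simp [dig, Nat.mod_one]
  have hR1 := hR.update_mem (A := 8) (f := fun x => if x < 1 then val x k else μ₀ 8 x)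
    (fun x => by split_ifs with h; exacts [(val1 x k).trans (cl 1 (by omega)), hR.mem_le _ _])
  have r2 := runs_answer (o := o) (v := I.answer) hR1 (by simp [hv]) answer_le ho (fun A hA => by
    rw [Function.update_of_ne (by omega), iz A (by omega)])
  refine (r1.seq r2).mono ?_
  simp only [Ex.cost]
  omega

/-- Brute force in three tables: array `6` says whether a choice has a vanishing factor at a
coordinate, array `7` takes the conjunction over the coordinates, array `8` the disjunction over the
choices. -/
theorem runs_small (hk : 3 ≤ k) (hn : 0 < n) (hd : 0 < d) {o w : ℕ} (ho : o = 0 ∨ 20 ≤ o)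
    (hR : Room w (roomM k n d) 60 I.init.reg I.init.mem) :
    Runs w (smallProg k) (100 * (k * n ^ k * d + k ^ 2)) (St I.init.reg I.init.mem)
      ((EdgeListGraph.empty (1 + I.answer)).Output o) := by
  classical
  have hk2 : 3 * k ≤ k ^ 2 := by rw [sq]; exact Nat.mul_le_mul_right k hk
  have ib : ∀ l < k, ∀ q < n, ∀ x < d, I.init.mem 0 ((l * n + q) * d + x) = I.bit l q x :=
    fun l _ q hq x hx => init_mem_bit hq hx
  have i0 : I.init.reg 0 = n := rfl
  have i1 : I.init.reg 1 = d := rfl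
  have iz := init_mem_eq (I := I)
  generalize I.init.reg = ρ₀ at *
  generalize I.init.mem = μ₀ at *
  set M := roomM k n d with hM
  have cl : ∀ v, v ≤ 100 * k ^ 2 → v ≤ M := fun v hv => const_le_roomM hv
  have h99 : 1 ≤ 100 * k ^ 2 := by omega
  have bd : d ≤ M := le_roomM h99 (by
    simpa using pow_mul_pow_le (n := n) (d := d) (k := k) 0 1 (by omega) (by omega))
  have hpn : ∀ i, n ^ i ≤ (n + 1) ^ i := fun i => Nat.pow_le_pow_left (by omega) i
  have pn : ∀ i < k + 1, n ^ i ≤ M := fun i hi => (hpn i).trans (le_roomM h99 (by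
    simpa using pow_mul_pow_le (n := n) (d := d) (k := k) i 0 (by omega) (by omega)))
  have bnd : n ^ k * d ≤ M := (Nat.mul_le_mul_right d (hpn k)).trans (le_roomM h99 (by
    simpa using pow_mul_pow_le (n := n) (d := d) (k := k) k 1 (by omega) (by omega)))
  have hnk : 0 < n ^ k := Nat.pow_pos hn
  -- the powers
  have r1 := runs_powers (A := 3) (r := 0) hR (by simp [Glob]) (cl (k + 1) (by omega)) i0 pn le_rfl
  have hR1 := hR.update_mem (A := 3) (f := fun x => if x < k + 1 then n ^ x else μ₀ 3 x)
    (fun x => by split_ifs with h; exacts [pn x h, hR.mem_le _ _])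
  set μ₁ := Function.update μ₀ 3 (fun x => if x < k + 1 then n ^ x else μ₀ 3 x) with hμ₁
  have m3 : ∀ r < k + 1, μ₁ 3 r = n ^ r := fun r hr => by
    simp only [hμ₁, Function.update_self, if_pos hr]
  have m0 : μ₁ 0 = μ₀ 0 := Function.update_of_ne (by norm_num) _ _
  have r2 := Runs.setTo_eq (r := 9) (e := ld 3 (lit k)) (v := n ^ k) hR1
    ⟨by simp [Ex.Vars], by simp only [Ex.Tame]; exact cl _ (by omega), by simp [Ex.deg]⟩
    (by rw [Ex.ev, Ex.ev, m3 _ (by omega)])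
  have hR2 := hR1.update (r := 9) (v := n ^ k) (pn k (by omega))
  set ρ := Function.update ρ₀ 9 (n ^ k) with hρ
  have e0 : ρ 0 = n := by simp [hρ, i0]
  have e1 : ρ 1 = d := by simp [hρ, i1]
  have e9 : ρ 9 = n ^ k := by simp [hρ]
  -- the coordinates of the choices
  let b : ℕ → ℕ → ℕ := fun e l => I.bit l (dig n (e / d) l) (e % d)
  have b1 : ∀ e l, b e l ≤ 1 := fun e l => bit_le_one _ _ _
  let v6 : ℕ → ℕ → ℕ := fun e j => if ∃ l < j, b e l = 0 then 1 else 0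
  have v61 : ∀ e j, v6 e j ≤ 1 := fun e j => by simp only [v6]; split_ifs <;> omega
  have r3 := runs_tabFold (A := 6) (cnt := var 9 *ₑ var 1) (m := lit k) (init := lit 0)
    (body := lit 0 <ₑ var 6 +ₑ (lit 1 -ₑ
      ld 0 ((var 4 *ₑ var 0 +ₑ (var 2 /ₑ var 1 /ₑ ld 3 (var 4) %ₑ var 0)) *ₑ var 1 +ₑ
        var 2 %ₑ var 1))) hR2 v6 (fun _ => k) (n ^ k * d) k
    ⟨by simp [Ex.Vars, Glob], by simp [Ex.Tame], by simp [Ex.deg]⟩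
    ⟨trivial, cl _ (by omega), by simp [Ex.deg]⟩
    ⟨trivial, cl _ (by omega), by simp [Ex.deg]⟩
    ⟨by simp [Ex.Vars, Glob₆, Glob], by simp [Ex.Tame]; exact cl _ (by omega), by simp [Ex.deg]⟩
    trivial trivial (by simp [Ex.Reads]) (by simp [Ex.ev, BinOp.eval, e9, e1]) bnd (fun _ _ => rfl)
    (fun _ _ => le_rfl) (fun _ _ => cl _ (by omega)) (fun i _ => by simp [v6, Ex.ev])
    (by
      intro e _ j hj
      have hb : μ₀ 0 ((j * n + e / d / n ^ j % n) * d + e % d) = b e j :=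
        ib j hj _ (Nat.mod_lt _ hn) _ (Nat.mod_lt _ hd)
      simp only [Ex.ev, BinOp.eval]
      simp only [show loopEnv ρ e j (v6 e j) 0 = n by simp [loopEnv, e0],
        show loopEnv ρ e j (v6 e j) 1 = d by simp [loopEnv, e1],
        show loopEnv ρ e j (v6 e j) 2 = e by simp [loopEnv],
        show loopEnv ρ e j (v6 e j) 4 = j by simp [loopEnv],
        show loopEnv ρ e j (v6 e j) 6 = v6 e j by simp [loopEnv], m3 j (by omega), m0, hb]
      simp only [v6, Nat.exists_lt_succ_right]
      have := b1 e j
      by_cases ha : ∃ l < j, b e l = 0 <;> by_cases hb : b e j = 0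
      · simp [ha, hb]
      · simp [ha, hb]
      · simp [ha, hb]
      · have : b e j = 1 := by omega
        simp [ha, this])
    (fun e _ j _ => (v61 e j).trans (cl 1 h99))
  have hR3 := hR2.update_mem (A := 6) (f := fun x => if x < n ^ k * d then v6 x k else μ₁ 6 x)
    (fun x => by split_ifs with h; exacts [(v61 x k).trans (cl 1 h99), hR2.mem_le _ _])
  set μ₂ := Function.update μ₁ 6 (fun x => if x < n ^ k * d then v6 x k else μ₁ 6 x) with hμ₂
  have m6 : ∀ x < n ^ k * d, μ₂ 6 x = v6 x k := fun x hx => by simp [hμ₂, hx]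
  -- the choices
  let v7 : ℕ → ℕ → ℕ := fun i j => if ∀ x < j, ∃ l < k, I.bit l (dig n i l) x = 0 then 1 else 0
  have v71 : ∀ e j, v7 e j ≤ 1 := fun e j => by simp only [v7]; split_ifs <;> omega
  have r4 := runs_tabFold (A := 7) (cnt := var 9) (m := var 1) (init := lit 1)
    (body := var 6 *ₑ ld 6 (var 2 *ₑ var 1 +ₑ var 4)) hR3 v7 (fun _ => d) (n ^ k) d
    ⟨by simp [Ex.Vars, Glob], by simp [Ex.Tame], by simp [Ex.deg]⟩
    ⟨by simp [Ex.Vars, Glob₂, Glob], by simp [Ex.Tame], by simp [Ex.deg]⟩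
    ⟨trivial, cl _ (by omega), by simp [Ex.deg]⟩
    ⟨by simp [Ex.Vars, Glob₆, Glob], by simp [Ex.Tame], by simp [Ex.deg]⟩
    trivial trivial (by simp [Ex.Reads]) e9 (pn k (by omega))
    (fun _ _ => by simp [Ex.ev, e1]) (fun _ _ => le_rfl) (fun _ _ => bd)
    (fun i _ => by simp [v7, Ex.ev])
    (by
      intro i hi j hj
      have hb : μ₂ 6 (i * d + j) = if ∃ l < k, I.bit l (dig n i l) j = 0 then 1 else 0 := by
        rw [m6 _ (pair_lt hi hj)]
        simp only [v6, b, pair_div hj, pair_mod hj]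
      simp only [Ex.ev, BinOp.eval]
      simp only [show loopEnv ρ i j (v7 i j) 1 = d by simp [loopEnv, e1],
        show loopEnv ρ i j (v7 i j) 2 = i by simp [loopEnv],
        show loopEnv ρ i j (v7 i j) 4 = j by simp [loopEnv],
        show loopEnv ρ i j (v7 i j) 6 = v7 i j by simp [loopEnv], hb]
      simp only [v7, Nat.forall_lt_succ_right]
      by_cases ha : ∀ x < j, ∃ l < k, I.bit l (dig n i l) x = 0 <;>
        by_cases hb : ∃ l < k, I.bit l (dig n i l) j = 0 <;> simp [ha, hb])
    (fun e _ j _ => (v71 e j).trans (cl 1 h99))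
  have hR4 := hR3.update_mem (A := 7) (f := fun x => if x < n ^ k then v7 x d else μ₂ 7 x)
    (fun x => by split_ifs with h; exacts [(v71 x d).trans (cl 1 h99), hR3.mem_le _ _])
  set μ₃ := Function.update μ₂ 7 (fun x => if x < n ^ k then v7 x d else μ₂ 7 x) with hμ₃
  let ok : ℕ → Prop := fun i => ∀ x < d, ∃ l < k, I.bit l (dig n i l) x = 0
  have m7 : ∀ x < n ^ k, μ₃ 7 x = if ok x then 1 else 0 := fun x hx => by
    simp only [hμ₃, Function.update_self, if_pos hx, v7, ok]
  -- the answer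
  let v8 : ℕ → ℕ → ℕ := fun _ j =>
    if ∃ i < j, ok i then 1 else 0
  have v81 : ∀ e j, v8 e j ≤ 1 := fun e j => by simp only [v8]; split_ifs <;> omega
  have r5 := runs_tabFold (A := 8) (cnt := lit 1) (m := var 9) (init := lit 0)
    (body := lit 0 <ₑ var 6 +ₑ ld 7 (var 4)) hR4 v8 (fun _ => n ^ k) 1 (n ^ k)
    ⟨trivial, cl _ (by omega), by simp [Ex.deg]⟩
    ⟨by simp [Ex.Vars, Glob₂, Glob], by simp [Ex.Tame], by simp [Ex.deg]⟩
    ⟨trivial, cl _ (by omega), by simp [Ex.deg]⟩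
    ⟨by simp [Ex.Vars, Glob₆, Glob], by simp [Ex.Tame], by simp [Ex.deg]⟩
    trivial trivial (by simp [Ex.Reads]) rfl (cl _ (by omega))
    (fun _ _ => by simp [Ex.ev, e9]) (fun _ _ => le_rfl) (fun _ _ => pn k (by omega))
    (fun i _ => by simp [v8, Ex.ev])
    (by
      intro i _ j hj
      simp only [Ex.ev, BinOp.eval]
      simp only [show loopEnv ρ i j (v8 i j) 4 = j by simp [loopEnv],
        show loopEnv ρ i j (v8 i j) 6 = v8 i j by simp [loopEnv], m7 j hj]
      simp only [v8, Nat.exists_lt_succ_right]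
      by_cases hp : ∃ i < j, ok i <;> by_cases hq : ok j <;> simp [hp, hq])
    (fun e _ j _ => (v81 e j).trans (cl 1 h99))
  have hR5 := hR4.update_mem (A := 8) (f := fun x => if x < 1 then v8 x (n ^ k) else μ₃ 8 x)
    (fun x => by split_ifs with h; exacts [(v81 x (n ^ k)).trans (cl 1 h99), hR4.mem_le _ _])
  have hv : v8 0 (n ^ k) = I.answer := if_congr (hasSolution_iff hn).symm rfl rfl
  have r6 := runs_answer (o := o) (v := I.answer) hR5 (by simp [hv]) answer_le ho (fun A hA => by
    rw [Function.update_of_ne (by omega), hμ₃, Function.update_of_ne (by omega), hμ₂,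
      Function.update_of_ne (by omega), hμ₁, Function.update_of_ne (by omega), iz A (by omega)])
  refine (r1.seq <| r2.seq <| r3.seq <| r4.seq <| r5.seq r6).mono ?_
  have h1 : n ^ k ≤ n ^ k * d := Nat.le_mul_of_pos_right _ hd
  have h2 : n ^ k * d ≤ k * n ^ k * d :=
    Nat.mul_le_mul_right d (Nat.le_mul_of_pos_left _ (by omega))
  have h3 : 3 ^ 2 ≤ k ^ 2 := Nat.pow_le_pow_left hk 2
  simp only [Ex.cost]
  linarith

end OVInstance


/-! ### The reduction -/

/-- Bernoulli: `(1 - 1 / (n + 1)) ^ m ≥ 1 - m / (n + 1) ≥ 1 / 2`. This absorbs the cost of the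
all-ones vector. -/
theorem succ_pow_le_two_mul {k m n : ℕ} (hk : 3 ≤ k) (hm : m ≤ k) (hn : k ^ 3 ≤ n) :
    (n + 1) ^ m ≤ 2 * n ^ m := by
  have hkn : 2 * k ≤ n := by nlinarith [sq_nonneg k]
  have hn0 : (0 : ℝ) < n + 1 := by positivity
  have hB := one_add_mul_le_pow (a := -(1 / ((n : ℝ) + 1))) (by
    have : 1 / ((n : ℝ) + 1) ≤ 1 := by
      rw [div_le_one hn0]; linarith [Nat.cast_nonneg (α := ℝ) n]
    linarith) m
  have h1 : 1 + -(1 / ((n : ℝ) + 1)) = n / (n + 1) := by field_simp; ring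
  rw [h1, div_pow, le_div_iff₀ (by positivity)] at hB
  have h2 : (m : ℝ) * (1 / (n + 1)) ≤ 1 / 2 := by
    rw [mul_one_div, div_le_div_iff₀ hn0 (by norm_num)]
    have : ((m * 2 : ℕ) : ℝ) ≤ ((1 * (n + 1) : ℕ) : ℝ) := by exact_mod_cast (by omega)
    push_cast at this
    exact this
  have h3 : (0 : ℝ) ≤ ((n : ℝ) + 1) ^ m := by positivity
  have h4 : ((n : ℝ) + 1) ^ m ≤ 2 * n ^ m := by nlinarith
  exact_mod_cast h4

/-- The constant `16` comes from `k = 4`, where equality holds. From there on a step at most doubles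
the cube. -/
theorem cube_le (k : ℕ) (hk : 3 ≤ k) : k ^ 3 ≤ 16 * 2 ^ (k - 2) := by
  induction k, hk using Nat.le_induction with
  | base => norm_num
  | succ k hk ih =>
    rcases Nat.lt_or_ge k 4 with h | h
    · obtain rfl : k = 3 := by omega
      norm_num
    · rw [show k + 1 - 2 = k - 2 + 1 by omega, pow_succ 2]
      have h1 : (k + 1) ^ 3 ≤ 2 * k ^ 3 := by
        nlinarith [Nat.mul_le_mul_left (k * k) h, Nat.mul_le_mul_left k h]
      omega

theorem OVInstance.card_le {k n d : ℕ} (hk : 0 < k) (I : OVInstance k n d) : n ≤ 2 ^ d := by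
  have := Fintype.card_le_of_injective _ (I.injective ⟨0, hk⟩)
  simpa using this

/-- Brute force loses a factor `n` and wins `d ^ (k - 2)`. For `d ≥ 2`, `n ≤ k ^ 3 ≤ 16 * d ^ (k -
2)`; for `d = 1` there are at most two different vectors. The term `k ^ 2` is absorbed by `k ≤ 2 ^
(k - 1) ≤ (n * d) ^ (k - 1)`, which needs `n * d ≥ 2`. -/
theorem small_bound {k n d : ℕ} (hk : 3 ≤ k) (hnd : 2 ≤ n * d) (h : n ≤ 2 ^ d) (hn : n ≤ k ^ 3) :
    k * n ^ k * d + k ^ 2 ≤ 17 * (k * n ^ (k - 1) * d ^ (k - 1)) := by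
  obtain ⟨m, rfl⟩ : ∃ m, k = m + 2 := ⟨k - 2, by omega⟩
  have hd : 0 < d := by rcases Nat.eq_zero_or_pos d with rfl | h <;> omega
  have h1 : n ≤ 16 * d ^ m := by
    rcases Nat.lt_or_ge d 2 with h' | h'
    · obtain rfl : d = 1 := by omega
      simp at h ⊢
      omega
    · exact hn.trans ((cube_le _ hk).trans
        (Nat.mul_le_mul_left _ (Nat.pow_le_pow_left h' _)))
  have h2 : m + 2 ≤ (n * d) ^ (m + 1) := calc
    m + 2 ≤ 2 ^ (m + 1) := Nat.lt_two_pow_self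
    _ ≤ _ := Nat.pow_le_pow_left hnd _
  have h3 : (m + 2) * n ^ (m + 2) * d ≤ 16 * ((m + 2) * n ^ (m + 1) * d ^ (m + 1)) := calc
    (m + 2) * n ^ (m + 2) * d = (m + 2) * n ^ (m + 1) * d * n := by ring
    _ ≤ (m + 2) * n ^ (m + 1) * d * (16 * d ^ m) := Nat.mul_le_mul_left _ h1
    _ = _ := by ring
  have h4 : (m + 2) ^ 2 ≤ (m + 2) * n ^ (m + 1) * d ^ (m + 1) := by
    rw [sq, mul_assoc, ← mul_pow]
    exact Nat.mul_le_mul_left _ h2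
  have e : m + 2 - 1 = m + 1 := rfl
  rw [e]
  omega

namespace WordRAM

open Ex

/-- Run one of two programs, depending on the value of an expression. -/
def branch (e : Ex) (p q : Prog) : Prog := .seq (setTo 3 e) (.cond 3 p q)

theorem runs_branch {w M T : ℕ} {e : Ex} {p q : Prog} {ρ : ℕ → ℕ} {μ : ℕ → ℕ → ℕ}
    {Post : State → Prop} (hR : Room w M 60 ρ μ) (he : e.Good M 60 Glob)
    (hp : e.ev ρ μ ≠ 0 → Runs w p T (St ρ μ) Post) (hq : e.ev ρ μ = 0 → Runs w q T (St ρ μ) Post) :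
    Runs w (branch e p q) (T + (e.cost + 2)) (St ρ μ) Post := by
  intro s hs
  have g30 : ∀ r, Glob r → r < 30 ∧ r ≠ 3 := by unfold Glob; omega
  obtain ⟨s₁, e₁, m₁, v₁, r₁⟩ := exec_setTo_of_agree (r := 3) (s := s) hR he (by norm_num)
    (fun x hx => ⟨(g30 x hx).1, hs.2 x hx⟩) (fun A _ => by rw [hs.1]) e.reads_true
  have hs₁ : St ρ μ s₁ := ⟨m₁.trans hs.1, fun r hr => by
    rw [r₁ r (g30 r hr).1 (g30 r hr).2, hs.2 r hr]⟩
  by_cases h : e.ev ρ μ = 0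
  · obtain ⟨s', t, e', ht, h'⟩ := hq h s₁ hs₁
    exact ⟨s', _, .seq e₁ (.cond_false (by rw [v₁, h]) e'), by omega, h'⟩
  · obtain ⟨s', t, e', ht, h'⟩ := hp h s₁ hs₁
    exact ⟨s', _, .seq e₁ (.cond_true (by rw [v₁]; exact h) e'), by omega, h'⟩

/-- The reduction. -/
def redProg (k o pd : ℕ) : Prog :=
  branch (var 0 *ₑ var 1 <ₑ lit 2) (tinyProg k)
    (branch (var 0 <ₑ lit (k ^ 3)) (smallProg k) (mainProg k o pd))

end WordRAM

theorem EdgeListGraph.dist_eq_zero_of_card {N : ℕ} (G : EdgeListGraph N) (hN : N = 1)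
    (u v : Fin N) : G.dist u v = 0 := by
  subst hN
  rw [Subsingleton.elim v u]
  exact G.dist_self u

theorem EdgeListGraph.exists_dist_empty {N : ℕ} (hN : N = 2) :
    ∃ u v : Fin N, (EdgeListGraph.empty N).dist u v = ⊤ := by
  subst hN
  exact ⟨0, 1, dist_empty (by decide)⟩

namespace OVInstance

open WordRAM Ex

variable {k n d : ℕ}

/-- The graph has a small diameter if and only if the instance has no solution, and is not too
large. With padding, it is sparse. -/
structure Reduces (I : OVInstance k n d) (pd : ℕ) {N : ℕ} (G : EdgeListGraph N) : Prop where
  pos : 0 < N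
  card_le : N ≤ 8 * (k * n ^ (k - 1) * d ^ (k - 1))
  card_le' : pd = 0 → N ≤ 10 * (k * n ^ (k - 1) + k * n ^ (k - 2) * d ^ (k - 1))
  edges_le : G.edges.length ≤ 56 * (k * n ^ (k - 1) * d ^ (k - 1))
  sparse : pd = 1 → G.edges.length ≤ 28 * k * N
  dist_le : ¬ I.HasSolution → ∀ u v : Fin N, G.dist u v ≤ ((3 * k - 4 : ℕ) : ℕ∞)
  le_dist : I.HasSolution → ∃ u v : Fin N, ((5 * k - 7 : ℕ) : ℕ∞) ≤ G.dist u v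

/-- A single vertex has diameter `0`, and two isolated vertices are infinitely far apart. -/
theorem reduces_empty (hk : 3 ≤ k) (hn : 0 < n) (hd : 0 < d) (I : OVInstance k n d) (pd : ℕ) :
    I.Reduces pd (EdgeListGraph.empty (1 + I.answer)) := by
  have h1 := I.answer_le
  have h2 : k * 1 ≤ k * n ^ (k - 1) := Nat.mul_le_mul_left k (Nat.pow_pos hn)
  have h3 : k * n ^ (k - 1) * 1 ≤ k * n ^ (k - 1) * d ^ (k - 1) :=
    Nat.mul_le_mul_left _ (Nat.pow_pos hd)
  refine ⟨by omega, by omega, fun _ => ?_, by simp [EdgeListGraph.empty],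
    fun _ => by simp [EdgeListGraph.empty], fun h u v => ?_, fun h => ?_⟩
  · have := Nat.zero_le (k * n ^ (k - 2) * d ^ (k - 1))
    omega
  · rw [EdgeListGraph.dist_eq_zero_of_card _ (by simp [answer, h])]
    exact bot_le
  · obtain ⟨u, v, huv⟩ := EdgeListGraph.exists_dist_empty (N := 1 + I.answer) (by simp [answer, h])
    exact ⟨u, v, by rw [huv]; exact le_top⟩

theorem reduces_graph (hk : 3 ≤ k) (hn : k ^ 3 ≤ n) (hd : 0 < d) (I : OVInstance k n d) {pd : ℕ}
    (hpd : pd ≤ 1)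
    (hE : (I.graph hk hd pd).edges.length ≤ 28 * k * (nQ k n * nX k d)) :
    nQ k n * nX k d ≤ 2 * (n ^ (k - 1) * d ^ (k - 1)) ∧ I.Reduces pd (I.graph hk hd pd) := by
  have hn0 : 0 < n := lt_of_lt_of_le (Nat.pow_pos (by omega)) hn
  have h1 : nQ k n ≤ 2 * n ^ (k - 1) := succ_pow_le_two_mul hk (by omega) hn
  have h2 : nB k n ≤ 2 * n ^ (k - 2) := succ_pow_le_two_mul hk (by omega) hn
  have h3 : nQ k n * nX k d ≤ 2 * (n ^ (k - 1) * d ^ (k - 1)) := by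
    rw [← mul_assoc]; exact Nat.mul_le_mul_right _ h1
  have h4 : k * (nQ k n * nX k d) ≤ k * (2 * (n ^ (k - 1) * d ^ (k - 1))) :=
    Nat.mul_le_mul_left k h3
  refine ⟨h3, ⟨?_, ?_, ?_, ?_, ?_, dist_graph_le hk hn0 hd pd, le_dist_graph hk hd pd⟩⟩
  · unfold numV zV; omega
  · have := numV_le (n := n) hk hd hpd
    nlinarith
  · rintro rfl
    have h5 : 2 * (k - 1) * nQ k n ≤ 2 * k * (2 * n ^ (k - 1)) := Nat.mul_le_mul (by omega) h1
    have h6 : (k - 1) * nP k n d ≤ k * (2 * n ^ (k - 2) * d ^ (k - 1)) :=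
      Nat.mul_le_mul (by omega) (Nat.mul_le_mul_right _ h2)
    have h7 : 3 * 1 ≤ k * n ^ (k - 1) := Nat.mul_le_mul hk (Nat.pow_pos hn0)
    have h8 : 0 ≤ k * n ^ (k - 2) * d ^ (k - 1) := Nat.zero_le _
    unfold numV zV cM
    nlinarith
  · refine hE.trans ?_
    nlinarith
  -- The padding alone has `nQ k n * nX k d` vertices, to which the number of edges is compared.
  · rintro rfl
    refine hE.trans (Nat.mul_le_mul_left _ ?_)
    unfold numV cM
    omega

theorem exists_reduction (hk : 3 ≤ k) (hn : 0 < n) (hd : 0 < d) (I : OVInstance k n d) {o pd : ℕ}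
    (hpd : pd ≤ 1) (ho : o = 0 ∨ 20 ≤ o) :
    ∃ (N : ℕ) (G : EdgeListGraph N) (s : State) (t : ℕ),
      Exec (60 * (5 * k + 7) * Nat.size (n * d)) (redProg k o pd) I.init s t ∧
      t ≤ 30000 * (k * n ^ (k - 1) * d ^ (k - 1)) ∧ G.Output o s ∧ I.Reduces pd G := by
  have hR := room_init hk hn hd I
  set w := 60 * (5 * k + 7) * Nat.size (n * d) with hw
  have hk2 : 3 * k ≤ k ^ 2 := by rw [sq]; exact Nat.mul_le_mul_right k hk
  have h1 : k * 1 ≤ k * n ^ (k - 1) := Nat.mul_le_mul_left k (Nat.pow_pos hn)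
  have h2 : k * n ^ (k - 1) * 1 ≤ k * n ^ (k - 1) * d ^ (k - 1) :=
    Nat.mul_le_mul_left _ (Nat.pow_pos hd)
  have hpre : St I.init.reg I.init.mem I.init := ⟨rfl, fun _ _ => rfl⟩
  have hr0 : I.init.reg 0 = n := rfl
  have hr1 : I.init.reg 1 = d := rfl
  -- The threshold occurs as a constant of the program and must fit into a word even if `n` is
  -- small.
  have hk3 : k ^ 3 ≤ roomM k n d := by
    refine le_roomM (c := k ^ 2) (by omega) ?_
    rw [pow_succ k 2]
    refine Nat.mul_le_mul_left _ (Nat.lt_two_pow_self.le.trans (Nat.pow_le_pow_left ?_ k))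
    nlinarith
  have g1 : (var 0 *ₑ var 1 <ₑ lit 2).Good (roomM k n d) 60 Glob :=
    ⟨by simp [Ex.Vars, Glob], by simp [Ex.Tame]; exact const_le_roomM (by omega), by simp [Ex.deg]⟩
  have g2 : (var 0 <ₑ lit (k ^ 3)).Good (roomM k n d) 60 Glob :=
    ⟨by simp [Ex.Vars, Glob], by simp only [Ex.Tame]; exact ⟨trivial, hk3⟩, by simp [Ex.deg]⟩
  have v1 : (var 0 *ₑ var 1 <ₑ lit 2).ev I.init.reg I.init.mem = if n * d < 2 then 1 else 0 := by
    simp only [Ex.ev, BinOp.eval, hr0, hr1]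
  have v2 : (var 0 <ₑ lit (k ^ 3)).ev I.init.reg I.init.mem = if n < k ^ 3 then 1 else 0 := by
    simp only [Ex.ev, BinOp.eval, hr0]
  by_cases c1 : n * d < 2
  · have hn1 : n = 1 := by nlinarith
    have hd1 : d = 1 := by nlinarith
    subst hn1 hd1
    obtain ⟨s, t, e, ht, hs⟩ := runs_branch (T := 100 * k) hR g1
      (fun _ => runs_tiny (o := o) hk ho hR)
      (q := branch (var 0 <ₑ lit (k ^ 3)) (smallProg k) (mainProg k o pd))
      (fun h => by rw [v1, if_pos c1] at h; omega) I.init hpre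
    refine ⟨_, _, s, t, e, ?_, hs, reduces_empty hk hn hd I pd⟩
    simp only [Ex.cost] at ht
    omega
  · by_cases c2 : n < k ^ 3
    · have hb := small_bound hk (by omega) (I.card_le (by omega)) c2.le
      obtain ⟨s, t, e, ht, hs⟩ := runs_branch (p := tinyProg k) hR g1
        (fun h => by rw [v1, if_neg c1] at h; omega)
        (fun _ => runs_branch (q := mainProg k o pd) hR g2
          (fun _ => runs_small (o := o) hk hn hd ho hR)
          (fun h => by rw [v2, if_pos c2] at h; omega)) I.init hpre
      refine ⟨_, _, s, t, e, ?_, hs, reduces_empty hk hn hd I pd⟩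
      simp only [Ex.cost] at ht
      omega
    · have hn3 : k ^ 3 ≤ n := by omega
      obtain ⟨hE, hrun⟩ := runs_main hk hd hpd ho hR hn3
      obtain ⟨hU, hred⟩ := reduces_graph hk hn3 hd I hpd hE
      obtain ⟨s, t, e, ht, hs⟩ := runs_branch (p := tinyProg k) hR g1
        (fun h => by rw [v1, if_neg c1] at h; omega)
        (fun _ => runs_branch (p := smallProg k) hR g2
          (fun h => by rw [v2, if_neg c2] at h; omega)
          (fun _ => hrun)) I.init hpre
      refine ⟨_, _, s, t, e, ?_, hs, hred⟩
      have h3 := Nat.mul_le_mul_left (12000 * k) hU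
      have h4 : 12000 * k * (2 * (n ^ (k - 1) * d ^ (k - 1))) =
        24000 * (k * n ^ (k - 1) * d ^ (k - 1)) := by ring
      simp only [Ex.cost] at ht
      omega

theorem exists_reduction_params (k : ℕ) (hk : 3 ≤ k) :
    ∃ (P : WordRAM.Prog) (c : ℕ), ∀ (n d : ℕ), 0 < n → 0 < d → ∀ I : OVInstance k n d,
        ∃ (N : ℕ) (G : EdgeListGraph N) (s : WordRAM.State) (t : ℕ),
          WordRAM.Exec (c * Nat.size (n * d)) P I.init s t ∧
          0 < N ∧ G.StoredIn s ∧
          t ≤ 30000 * (k * n ^ (k - 1) * d ^ (k - 1)) ∧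
          N ≤ 30000 * (k * n ^ (k - 1) + k * n ^ (k - 2) * d ^ (k - 1)) ∧
          G.edges.length ≤ 30000 * (k * n ^ (k - 1) * d ^ (k - 1)) ∧
          (¬ I.HasSolution → ∀ u v : Fin N, G.dist u v ≤ ((3 * k - 4 : ℕ) : ℕ∞)) ∧
          (I.HasSolution → ∃ u v : Fin N, ((5 * k - 7 : ℕ) : ℕ∞) ≤ G.dist u v) := by
  refine ⟨redProg k 0 0, 60 * (5 * k + 7), fun n d hn hd I => ?_⟩
  obtain ⟨N, G, s, t, e, ht, hs, h⟩ :=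
    exists_reduction hk hn hd I (o := 0) (pd := 0) (by omega) (by omega)
  have h1 := h.card_le' rfl
  have h2 := h.edges_le
  exact ⟨N, G, s, t, e, h.pos, hs.storedIn, ht, by omega, by omega, h.dist_le, h.le_dist⟩

end OVInstance


/-! ### The lower bound -/

theorem WordRAM.State.setReg_reg_self (s : WordRAM.State) (r v : ℕ) : (s.setReg r v).reg r = v := by
  simp [setReg]

theorem WordRAM.State.setReg_reg_of_ne (s : WordRAM.State) {r x : ℕ} (v : ℕ) (h : x ≠ r) :
    (s.setReg r v).reg x = s.reg x := by
  simp [setReg, h]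

theorem rpow_bound {N : ℕ} (hN : 0 < N) {C t τ τ' : ℝ} (hτ : τ ≤ τ') (ht : t ≤ C * (N : ℝ) ^ τ) :
    t ≤ |C| * (N : ℝ) ^ τ' := by
  have h1 : (1 : ℝ) ≤ N := by exact_mod_cast hN
  exact ht.trans (mul_le_mul (le_abs_self C) (Real.rpow_le_rpow_of_exponent_le h1 hτ)
    (by positivity) (abs_nonneg C))

theorem DiameterDistinguishable.mono {K D₁ D₂ : ℕ} {τ τ' : ℝ} (hτ : τ ≤ τ')
    (h : DiameterDistinguishable K D₁ D₂ τ) : DiameterDistinguishable K D₁ D₂ τ' := by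
  obtain ⟨P, c, C, h⟩ := h
  refine ⟨P, c, |C|, fun N hN G hG hD => ?_⟩
  obtain ⟨s, t, e, ht, hs⟩ := h N hN G hG hD
  exact ⟨s, t, e, rpow_bound hN hτ ht, hs⟩

/-- Compare the estimate with `D₁`: a diameter `≤ D₁` forces `E ≤ D₁`, while `E ≤ D₁` forces the
diameter to be at most `α * D₁ < D₂`. An infinite estimate excludes the first case. -/
theorem DiameterApproximable.distinguishable {K D₁ D₂ : ℕ} {α τ τ' : ℝ} (hD₂ : 0 < D₂)
    (hα : α * D₁ < D₂)
    (hτ : τ ≤ τ') (hτ' : 0 ≤ τ') (h : DiameterApproximable K α τ) :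
    DiameterDistinguishable K D₁ D₂ τ' := by
  obtain ⟨P, c, C, h⟩ := h
  refine ⟨.seq P (.seq (.const 2 D₁) (.seq (.op .lt 0 2 0) (.cond 1 (.const 0 1) .skip))),
    c + (D₁ + 1), |C| + 5, fun N hN G hG _ => ?_⟩
  obtain ⟨s, t, e, ht, hs, hs'⟩ := h N hN G hG
  set σ := Nat.size (N + G.edges.length) with hσ
  have hσ1 : 1 ≤ σ := Nat.size_pos.2 (by omega)
  set w := (c + (D₁ + 1)) * σ with hw
  have hcw : c * σ ≤ w := Nat.mul_le_mul_right _ (by omega)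
  have hDw : D₁ + 1 ≤ w := by nlinarith
  have hD : D₁ + 1 < 2 ^ w := hDw.trans_lt Nat.lt_two_pow_self
  -- the answer
  have hE : s.reg 1 = 0 → s.reg 0 ≤ D₁ → G.diam < D₂ := by
    intro h1 h0
    rw [← ENat.toENNReal_lt]
    refine hs'.trans_lt ?_
    have hb : ENNReal.ofReal α * (s.estimate : ℝ≥0∞) ≤ ENNReal.ofReal α * ENNReal.ofReal D₁ := by
      refine mul_le_mul_right ?_ _
      rw [WordRAM.State.estimate, if_pos h1, ENat.toENNReal_coe, ENNReal.ofReal_natCast]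
      exact_mod_cast h0
    refine hb.trans_lt ?_
    rw [ENat.toENNReal_coe, ← ENNReal.ofReal_mul' (Nat.cast_nonneg _), ← ENNReal.ofReal_natCast D₂]
    exact (ENNReal.ofReal_lt_ofReal_iff (by exact_mod_cast hD₂)).2 hα
  have e₁ : WordRAM.Exec w (.const 2 D₁) s _ 1 := .const s 2 D₁ (by omega)
  set s₁ := s.setReg 2 D₁ with hs₁
  have a0 : s₁.reg 0 = s.reg 0 := s.setReg_reg_of_ne _ (by norm_num)
  have a1 : s₁.reg 1 = s.reg 1 := s.setReg_reg_of_ne _ (by norm_num)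
  have a2 : s₁.reg 2 = D₁ := s.setReg_reg_self _ _
  have e₂ : WordRAM.Exec w (.op .lt 0 2 0) s₁ _ 1 := .op s₁ .lt 0 2 0 (by
    simp only [WordRAM.BinOp.eval]; split_ifs <;> omega)
  rw [a0, a2] at e₂
  set s₂ := s₁.setReg 0 (WordRAM.BinOp.lt.eval D₁ (s.reg 0)) with hs₂
  have b0 : s₂.reg 0 = if D₁ < s.reg 0 then 1 else 0 := s₁.setReg_reg_self _ _
  have b1 : s₂.reg 1 = s.reg 1 := (s₁.setReg_reg_of_ne _ (by norm_num)).trans a1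
  have e₀ := e.mono hcw
  have hN1 : (1 : ℝ) ≤ (N : ℝ) ^ τ' := Real.one_le_rpow (by exact_mod_cast hN) hτ'
  have hT := rpow_bound hN hτ ht
  have hT' : ((t + (1 + (1 + (1 + 1))) : ℕ) : ℝ) ≤ (|C| + 5) * (N : ℝ) ^ τ' := by
    push_cast
    linarith
  by_cases h1 : s.reg 1 = 0
  · refine ⟨s₂, _, .seq e₀ (.seq e₁ (.seq e₂ (.cond_false (b1.trans h1) (.skip s₂)))), hT', ?_, ?_⟩
    · intro hG
      have hle := hs.trans hG
      rw [WordRAM.State.estimate, if_pos h1] at hle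
      have : s.reg 0 ≤ D₁ := by exact_mod_cast hle
      rw [b0, if_neg (by omega)]
    · intro hG
      rw [b0, if_pos]
      by_contra hlt
      exact absurd (hE h1 (by omega)) (not_lt.2 hG)
  · refine ⟨s₂.setReg 0 1, _, .seq e₀ (.seq e₁ (.seq e₂ (.cond_true (by rw [b1]; exact h1)
      (.const s₂ 0 1 (by omega))))), hT', ?_, fun _ => s₂.setReg_reg_self _ _⟩
    intro hG
    have hle := hs.trans hG
    rw [WordRAM.State.estimate, if_neg h1] at hle
    exact absurd (top_le_iff.1 hle) (by simp)

/-- Words of logarithmic length for the graph are still words of logarithmic length for the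
instance, up to a factor depending on `k`. -/
theorem size_card_add_edges_le {k n d N E : ℕ} (hn : 0 < n) (hd : 0 < d)
    (hN : N ≤ 8 * (k * n ^ (k - 1) * d ^ (k - 1))) (hE : E ≤ 56 * (k * n ^ (k - 1) * d ^ (k - 1))) :
    Nat.size (N + E) ≤ (2 * k + 7) * Nat.size (n * d) := by
  set σ := Nat.size (n * d) with hσ
  have hσ1 : 1 ≤ σ := Nat.size_pos.2 (Nat.mul_pos hn hd)
  have h1 : n * d < 2 ^ σ := Nat.lt_size_self _
  rw [Nat.size_le]
  calc N + E ≤ 64 * (k * (n * d) ^ (k - 1)) := by rw [mul_pow, ← mul_assoc k]; omega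
    _ ≤ 2 ^ 6 * (2 ^ k * (2 ^ σ) ^ (k - 1)) := Nat.mul_le_mul (by norm_num)
      (Nat.mul_le_mul Nat.lt_two_pow_self.le (Nat.pow_le_pow_left h1.le _))
    _ = 2 ^ (6 + (k + σ * (k - 1))) := by rw [← pow_mul, ← pow_add, ← pow_add]
    _ < 2 ^ ((2 * k + 7) * σ) := Nat.pow_lt_pow_right (by norm_num) (by
      have h2 : σ * (k - 1) ≤ σ * k := Nat.mul_le_mul_left _ (by omega)
      nlinarith)

namespace WordRAM

/-- Run the reduction, and then `P` on the graph. -/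
def composeProg (Q P : Prog) : Prog :=
  let R := max 2 Q.regBound
  .seq Q (.seq (.op .and R 0 0) (.seq (.op .and (R + 1) 1 1)
    (.seq (P.shift R 20) (.op .and 0 R R))))

/-- The reduction writes the edges to arrays `21` and `22`, which are arrays `1` and `2` after the
shift by `20`. The two sizes are copied to the shifted registers `0` and `1`, and all further
shifted cells are still `0`, so `P` finds exactly its initial state. -/
theorem exec_composeProg {w N t t' : ℕ} {Q P : Prog} {s₀ s s' : State} {G : EdgeListGraph N}
    (hQ : Exec w Q s₀ s t) (hs₀ : ∀ r, 2 ≤ r → s₀.reg r = 0) (hs : G.Output 20 s)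
    (hP : Exec w P G.init s' t') (hN : N < 2 ^ w) (hE : G.edges.length < 2 ^ w)
    (hs' : s'.reg 0 < 2 ^ w) :
    ∃ S, Exec w (composeProg Q P) s₀ S (t + (1 + (1 + (t' + 1)))) ∧ S.reg 0 = s'.reg 0 := by
  set R := max 2 Q.regBound with hR
  have hR2 : 2 ≤ R := le_max_left _ _
  have hz : ∀ r, R ≤ r → s.reg r = 0 := fun r hr => by
    rw [hQ.reg_eq r ((le_max_right _ _).trans hr), hs₀ r (hR2.trans hr)]
  have hand : ∀ x, BinOp.and.eval x x = x := fun x => Nat.and_self x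
  have e₁ : Exec w (.op .and R 0 0) s _ 1 := .op s .and R 0 0 (by rw [hand, hs.r0]; exact hN)
  rw [hand, hs.r0] at e₁
  set s₁ := s.setReg R N with hs₁
  have h1 : s₁.reg 1 = G.edges.length :=
    (s.setReg_reg_of_ne _ (by omega)).trans hs.r1
  have e₂ : Exec w (.op .and (R + 1) 1 1) s₁ _ 1 := .op s₁ .and (R + 1) 1 1 (by
    rw [hand, h1]; exact hE)
  rw [hand, h1] at e₂
  set s₂ := s₁.setReg (R + 1) G.edges.length with hs₂
  have hsh : G.init.ShiftOf R 20 s₂ := by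
    refine hs.shiftOf rfl fun r => ?_
    simp only [hs₂, hs₁, State.setReg, EdgeListGraph.init, Function.update_apply]
    by_cases hr0 : r = 0
    · subst hr0; simp
    · by_cases hr1 : r = 1
      · subst hr1; rw [if_pos (by omega)]; simp
      · rw [if_neg (by omega), if_neg (by omega), hz _ (by omega)]; simp [hr0, hr1]
  obtain ⟨S, e₃, hS⟩ := hP.shift s₂ hsh
  have hSR : S.reg R = s'.reg 0 := by simpa using hS.1 0
  have e₄ : Exec w (.op .and 0 R R) S _ 1 := .op S .and 0 R R (by rw [hand, hSR]; exact hs')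
  rw [hand, hSR] at e₄
  exact ⟨_, .seq hQ (.seq e₁ (.seq e₂ (.seq e₃ e₄))), S.setReg_reg_self _ _⟩

end WordRAM

theorem not_diameterDistinguishable {k : ℕ} (hk : 3 ≤ k) (hC : KOVConjecture k) {τ : ℝ}
    (hτ : 1 ≤ τ) (hτ' : τ < 1 + 1 / ((k : ℝ) - 1)) :
    ¬ DiameterDistinguishable (28 * k) (3 * k - 4) (5 * k - 7) τ := by
  rintro ⟨P, c, C, hP⟩
  have hk1 : (0 : ℝ) < k - 1 := by
    have : (3 : ℝ) ≤ k := by exact_mod_cast hk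
    linarith
  have hlt : ((k : ℝ) - 1) * τ < k := by
    have := mul_lt_mul_of_pos_left hτ' hk1
    rw [mul_add, mul_one_div_cancel hk1.ne'] at this
    linarith
  have hkτ : (k : ℝ) - (k - (k - 1) * τ) = (k - 1) * τ := by ring
  -- The saving that makes the exponent of `n` equal to `(k - 1) * τ < k`. The exponent of `d` is
  -- also at most `(k - 1) * τ`, hence at most `k`.
  refine hC (k - (k - 1) * τ) (by linarith) ⟨WordRAM.composeProg (WordRAM.redProg k 20 1) P,
    60 * (5 * k + 7) + (c + 1) * (2 * k + 7), k, 30000 * k + 4 + |C| * (8 * k : ℝ) ^ τ,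
    fun n d hn hd I => ?_⟩
  obtain ⟨N, G, s, t, e, ht, hs, hG⟩ :=
    OVInstance.exists_reduction hk hn hd I (o := 20) (pd := 1) le_rfl (by norm_num)
  have hno : ¬ I.HasSolution → G.diam ≤ ((3 * k - 4 : ℕ) : ℕ∞) := fun h =>
    iSup₂_le (hG.dist_le h)
  have hyes : I.HasSolution → ((5 * k - 7 : ℕ) : ℕ∞) ≤ G.diam := fun h => by
    obtain ⟨u, v, huv⟩ := hG.le_dist h
    exact huv.trans (le_iSup₂ (f := fun u v => G.dist u v) u v)
  obtain ⟨s', t', e', ht', hs0, hs1⟩ := hP N hG.pos G (hG.sparse rfl)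
    ((em I.HasSolution).elim (fun h => .inr (hyes h)) fun h => .inl (hno h))
  set σ := Nat.size (n * d) with hσ
  have hσ1 : 1 ≤ σ := Nat.size_pos.2 (Nat.mul_pos hn hd)
  have hsz := size_card_add_edges_le hn hd hG.card_le hG.edges_le
  set w := (60 * (5 * k + 7) + (c + 1) * (2 * k + 7)) * σ with hw
  have hw1 : 60 * (5 * k + 7) * σ ≤ w := Nat.mul_le_mul_right _ (Nat.le_add_right _ _)
  have hw2 : (c + 1) * Nat.size (N + G.edges.length) ≤ w := calc
    _ ≤ (c + 1) * ((2 * k + 7) * σ) := Nat.mul_le_mul_left _ hsz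
    _ = (c + 1) * (2 * k + 7) * σ := (mul_assoc _ _ _).symm
    _ ≤ w := Nat.mul_le_mul_right _ (Nat.le_add_left _ _)
  have hcw : c * Nat.size (N + G.edges.length) ≤ w :=
    (Nat.mul_le_mul_right _ (by omega)).trans hw2
  have hNE : N + G.edges.length < 2 ^ w := (Nat.lt_size_self _).trans_le
    (Nat.pow_le_pow_right (by norm_num) ((Nat.le_mul_of_pos_left _ (by omega)).trans hw2))
  have hreg : s'.reg 0 ≤ 1 := by
    by_cases h : I.HasSolution
    · rw [hs1 (hyes h)]
    · rw [hs0 (hno h)]; omega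
  obtain ⟨S, eS, hS⟩ := WordRAM.exec_composeProg (e.mono hw1)
    (fun r hr => by simp only [OVInstance.init]; rw [if_neg (by omega), if_neg (by omega)]) hs
    (e'.mono hcw) (by omega) (by omega) (by have := hG.pos; omega)
  refine ⟨S, _, eS, ?_, fun h => hS.trans (hs1 (hyes h)), fun h => hS.trans (hs0 (hno h))⟩
  -- the running time
  rw [hkτ]
  have hn1 : (1 : ℝ) ≤ n := by exact_mod_cast hn
  have hd1 : (1 : ℝ) ≤ d := by exact_mod_cast hd
  have hcast : (((k - 1 : ℕ) : ℝ)) = (k : ℝ) - 1 := by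
    rw [Nat.cast_sub (by omega), Nat.cast_one]
  -- The reduction itself takes time about `n ^ (k - 1)`, which is why `τ ≥ 1` is assumed.
  have hle : (((k - 1 : ℕ) : ℝ)) ≤ (k - 1) * τ := by rw [hcast]; nlinarith
  have hnp : (n : ℝ) ^ (k - 1) ≤ (n : ℝ) ^ (((k : ℝ) - 1) * τ) := by
    rw [← Real.rpow_natCast]; exact Real.rpow_le_rpow_of_exponent_le hn1 hle
  have hdp : (d : ℝ) ^ (k - 1) ≤ (d : ℝ) ^ k := pow_le_pow_right₀ hd1 (by omega)
  set X := (n : ℝ) ^ (((k : ℝ) - 1) * τ) * (d : ℝ) ^ k with hX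
  have hX1 : 1 ≤ X := by
    have h1 : (1 : ℝ) ≤ (n : ℝ) ^ (k - 1) := one_le_pow₀ hn1
    have h2 : (1 : ℝ) ≤ (d : ℝ) ^ k := one_le_pow₀ hd1
    nlinarith
  have hUX : (n : ℝ) ^ (k - 1) * (d : ℝ) ^ (k - 1) ≤ X :=
    mul_le_mul hnp hdp (by positivity) (by positivity)
  have hNX : (N : ℝ) ^ τ ≤ (8 * k : ℝ) ^ τ * X := by
    have h1 : (N : ℝ) ≤ 8 * k * ((n : ℝ) ^ (k - 1) * (d : ℝ) ^ (k - 1)) := by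
      have := hG.card_le
      have : (N : ℝ) ≤ ((8 * (k * n ^ (k - 1) * d ^ (k - 1)) : ℕ) : ℝ) := by exact_mod_cast this
      push_cast at this
      linarith
    refine (Real.rpow_le_rpow (by positivity) h1 (by linarith)).trans ?_
    rw [Real.mul_rpow (x := 8 * (k : ℝ)) (by positivity) (by positivity),
      Real.mul_rpow (x := (n : ℝ) ^ (k - 1)) (by positivity) (by positivity), ← Real.rpow_natCast, ← Real.rpow_natCast,
      ← Real.rpow_mul (by positivity), ← Real.rpow_mul (by positivity), hcast]
    refine mul_le_mul_of_nonneg_left (mul_le_mul_of_nonneg_left ?_ (by positivity)) (by positivity)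
    rw [← Real.rpow_natCast]
    exact Real.rpow_le_rpow_of_exponent_le hd1 hlt.le
  have ht1 : (t : ℝ) ≤ 30000 * k * ((n : ℝ) ^ (k - 1) * (d : ℝ) ^ (k - 1)) := by
    have : (t : ℝ) ≤ ((30000 * (k * n ^ (k - 1) * d ^ (k - 1)) : ℕ) : ℝ) := by exact_mod_cast ht
    push_cast at this
    linarith
  have ht2 : (t' : ℝ) ≤ |C| * ((8 * k : ℝ) ^ τ * X) :=
    (rpow_bound hG.pos le_rfl ht').trans (mul_le_mul_of_nonneg_left hNX (abs_nonneg C))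
  have ht3 : 30000 * (k : ℝ) * ((n : ℝ) ^ (k - 1) * (d : ℝ) ^ (k - 1)) ≤ 30000 * k * X :=
    mul_le_mul_of_nonneg_left hUX (by positivity)
  rw [mul_assoc _ _ ((d : ℝ) ^ k), ← hX]
  push_cast
  linarith


theorem mainTheorem4 :
    ∃ C : ℕ, ∀ k : ℕ, 3 ≤ k →
      -- the reduction
      (∃ (P : WordRAM.Prog) (c : ℕ), ∀ (n d : ℕ), 0 < n → 0 < d → ∀ I : OVInstance k n d,
        ∃ (N : ℕ) (G : EdgeListGraph N) (s : WordRAM.State) (t : ℕ),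
          WordRAM.Exec (c * Nat.size (n * d)) P I.init s t ∧
          0 < N ∧ G.StoredIn s ∧
          t ≤ C * (k * n ^ (k - 1) * d ^ (k - 1)) ∧
          N ≤ C * (k * n ^ (k - 1) + k * n ^ (k - 2) * d ^ (k - 1)) ∧
          G.edges.length ≤ C * (k * n ^ (k - 1) * d ^ (k - 1)) ∧
          (¬ I.HasSolution → ∀ u v : Fin N, G.dist u v ≤ ((3 * k - 4 : ℕ) : ℕ∞)) ∧
          (I.HasSolution → ∃ u v : Fin N, ((5 * k - 7 : ℕ) : ℕ∞) ≤ G.dist u v)) ∧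
      -- the lower bound for sparse graphs
      (KOVConjecture k → ∃ K : ℕ, ∀ δ : ℝ, 0 < δ →
        ¬ DiameterDistinguishable K (3 * k - 4) (5 * k - 7) (1 + 1 / ((k : ℝ) - 1) - δ) ∧
        ∀ ε : ℝ, 0 < ε →
          ¬ DiameterApproximable K ((5 * (k : ℝ) - 7) / (3 * (k : ℝ) - 4) - ε)
              (1 + 1 / ((k : ℝ) - 1) - δ)) := by
  refine ⟨30000, fun k hk => ⟨OVInstance.exists_reduction_params k hk, fun hC =>
    ⟨28 * k, fun δ hδ => ?_⟩⟩⟩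
  have hk3 : (3 : ℝ) ≤ k := by exact_mod_cast hk
  have hk1 : (0 : ℝ) < 1 / ((k : ℝ) - 1) := by
    have : (0 : ℝ) < (k : ℝ) - 1 := by linarith
    positivity
  -- Large `δ` would give exponents below `1`; truncating the saving keeps `1 ≤ τ` and only weakens
  -- the time bound to be refuted.
  set τ := 1 + 1 / ((k : ℝ) - 1) - min δ (1 / ((k : ℝ) - 1)) with hτ
  have h1 : 1 ≤ τ := by
    have := min_le_right δ (1 / ((k : ℝ) - 1))
    linarith
  have h2 : τ < 1 + 1 / ((k : ℝ) - 1) := by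
    have := lt_min hδ hk1
    linarith
  have h3 : 1 + 1 / ((k : ℝ) - 1) - δ ≤ τ := by
    have := min_le_left δ (1 / ((k : ℝ) - 1))
    linarith
  have hmain := not_diameterDistinguishable hk hC h1 h2
  refine ⟨fun h => hmain (h.mono h3), fun ε hε h => hmain
    (h.distinguishable (by omega) ?_ h3 (by linarith))⟩
  have hpos : (0 : ℝ) < 3 * k - 4 := by linarith
  rw [Nat.cast_sub (by omega), Nat.cast_sub (by omega)]
  push_cast
  rw [sub_mul, div_mul_cancel₀ _ hpos.ne']
  nlinarith
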